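/- Work with $\mathbb Z$-graded vector spaces over a field $k$; $|a|$ is the degree of a homogeneous element $a$. A graded vector space $A$ with a degree $0$ associative product and a degree $-1$ bracket $\{\,,\,\}$ is a \emph{Gerstenhaber algebra} if for homogeneous elements, with $s(a)=|a|-1$, $$\{a,b\}=-(-1)^{s(a)s(b)}\{b,a\},\qquad \{a,\{b,c\}\}+(-1)^{s(c)(s(a)+s(b))}\{c,\{a,b\}\}+(-1)^{s(a)(s(b)+s(c))}\{b,\{c,a\}\}=0,$$ $$\{a,bc\}=\{a,b\}c+(-1)^{s(a)|b|}\,b\{a,c\}.$$ \emph{Odd structures.} In the following, "composition along a class of graphs, twisted by $\mathfrak K$" means an algebra over the triple of these graphs twisted by $\mathfrak K(\Gamma)=\mathrm{Det}(\mathrm{Edge}(\Gamma))$: the vertices of a graph are decorated by elements, contracting all edges and merging the resulting vertices gives an operation which is equivariant under relabelling and compatible with substitution of graphs into vertices, every edge has degree $-1$, exchanging two edges changes the sign, and otherwise the Koszul rule holds. A single gluing $a\bullet b$ is written with its symbol, of degree $-1$, between the arguments; disjoint union of two vertices (merger) gives the horizontal composition $\boxminus$ of degree $0$, associative and graded commutative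 up to relabelling. No units are required. A non-connected odd operad $\mathcal O$ is one of the following. 1. (PROP version) An odd PROP: graded spaces $\mathcal O(I,J)$, functorial in bijections of the finite sets $I$ (inputs) and $J$ (outputs), with $\mathfrak K$-twisted compositions along directed graphs without wheels, not necessarily connected; in particular the odd PROP generated by an odd operad. 2. (nc-dioperad version) An odd nc-dioperad: the same with directed forests only. 3. (free nc version) Graded spaces $\mathcal O(\pi)$ for maps $\pi:S\to R$ of finite sets (a box of rooted corollas with set of roots $R$, the corolla with root $r$ having inputs $\pi^{-1}(r)$), functorial in bijections, with $\boxminus:\mathcal O(\pi)\otimes\mathcal O(\rho)\to\mathcal O(\pi\amalg\rho)$ and $\mathfrak K$-twisted compositions along rooted forests connecting the corollas: these are generated by $\boxminus$ and by anticommuting degree $-1$ contractions of one edge from a root to an input of a different corolla. 4. ($B_+$ version) An odd operad with nc-multiplication: graded spaces $\mathcal O(S)$, functorial in bijections of the finite set $S$ of inputs, with equivariant insertions $a\bullet_i b$ of degree $-1$ ($i$ an input of $a$) and an associative equivariant product $\boxminus$ of degree $0$, such that, up to the canonical relabelling, $(a\bullet_i b)\bullet_j c=(-1)^{s(b)s(c)}(a\bullet_j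 c)\bullet_i b$ for distinct inputs $i,j$ of $a$; such that for inputs $i$ of $a$ and $j$ of $b$ the expression $a\bullet_i(b\bullet_j c)-(a\bullet_i b)\bullet_j c$ (which is zero in an ordinary odd operad, and for sums over several roots consists of the terms in which two roots of $c$ are glued to $a$ and to $b$) equals $(-1)^{s(a)s(b)}$ times the one with $(a,i)$ and $(b,j)$ exchanged; and such that $$a\bullet_i(b\boxminus c)=(a\bullet_i b)\boxminus c+(-1)^{s(a)|b|}\,b\boxminus(a\bullet_i c),$$ $$(a\boxminus b)\bullet_i c=\begin{cases}(-1)^{|b|s(c)}(a\bullet_i c)\boxminus b& i\text{ an input of }a,\\ a\boxminus(b\bullet_i c)& i\text{ an input of }b.\end{cases}$$ An odd nc-cyclic operad consists of graded spaces $\mathcal O(S)$, functorial in bijections of the finite set $S$ of flags, with $\mathfrak K$-twisted compositions along forests; it is generated by $\boxminus$ and by the gluings $a\,{}_s\!\bullet_t b=-(-1)^{s(a)s(b)}\,b\,{}_t\!\bullet_s a$ of a flag $s$ of $a$ with a flag $t$ of $b$. Let $\mathcal O^{\oplus}_{\mathbb S}$ be the space of coinvariants, i.e. the direct sum of all components of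 $\mathcal O$ modulo relabelling (for instance $\bigoplus_n\mathcal O(n)_{\mathbb S_n}$ or $\bigoplus_{n,m}\mathcal O(n,m)_{\mathbb S_n\times\mathbb S_m}$), with the induced grading. \textbf{Theorem.} (a) Let $\mathcal O$ be a non-connected odd operad in any of the versions 1--4, let $a\bullet b$ be the sum over all gluings of an input of $a$ with an output (in version 4: with the implicit output) of $b$, and let $\{a\bullet b\}=a\bullet b-(-1)^{s(a)s(b)}\,b\bullet a$ for homogeneous $a,b$. Then $\boxminus$ and $\{\,\bullet\,\}$ descend to $\mathcal O^{\oplus}_{\mathbb S}$ and make it a Gerstenhaber algebra. In versions 1--3 the product is moreover graded commutative. (b) Let $\mathcal O$ be an odd nc-cyclic operad and let $\{a\odot b\}=\sum_{s,t}a\,{}_s\!\bullet_t b$, the sum over all flags $s$ of $a$ and $t$ of $b$. Then $\boxminus$ and $\{\,\odot\,\}$ descend to $\mathcal O^{\oplus}_{\mathbb S}$ and make it a Gerstenhaber algebra with graded commutative product. -/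

import Mathlib

open scoped DirectSum

universe u v

noncomputable section

namespace OddNC

/-! ### Gerstenhaber algebras -/

/-- The bilinear maps `mul` and `br` make the graded vector space `(A, 𝒜)` a Gerstenhaber
(odd Poisson) algebra: `mul` is associative of degree `0`, `br` has degree `-1` and is an odd Lie
bracket, and `br a` is a derivation of `mul`, with the Koszul signs. -/
structure IsGerstenhaber {k : Type v} [Field k] {A : Type u} [AddCommGroup A] [Module k A]
    (𝒜 : ℤ → Submodule k A) (mul br : A →ₗ[k] A →ₗ[k] A) : Prop where
  graded : DirectSum.IsInternal 𝒜
  mul_mem : ∀ {p q : ℤ} {a b : A}, a ∈ 𝒜 p → b ∈ 𝒜 q → mul a b ∈ 𝒜 (p + q)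
  br_mem : ∀ {p q : ℤ} {a b : A}, a ∈ 𝒜 p → b ∈ 𝒜 q → br a b ∈ 𝒜 (p + q - 1)
  mul_assoc : ∀ a b c : A, mul (mul a b) c = mul a (mul b c)
  antisymm : ∀ {p q : ℤ} {a b : A}, a ∈ 𝒜 p → b ∈ 𝒜 q →
    br a b = -(((p - 1) * (q - 1)).negOnePow • br b a)
  jacobi : ∀ {p q r : ℤ} {a b c : A}, a ∈ 𝒜 p → b ∈ 𝒜 q → c ∈ 𝒜 r →
    br a (br b c)
      + ((r - 1) * ((p - 1) + (q - 1))).negOnePow • br c (br a b)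
      + ((p - 1) * ((q - 1) + (r - 1))).negOnePow • br b (br c a) = 0
  leibniz : ∀ {p q : ℤ} {a b : A} (c : A), a ∈ 𝒜 p → b ∈ 𝒜 q →
    br a (mul b c) = mul (br a b) c + ((p - 1) * q).negOnePow • mul b (br a c)

/-- Graded commutativity of a product. -/
def IsGradedComm {k : Type v} [Field k] {A : Type u} [AddCommGroup A] [Module k A]
    (𝒜 : ℤ → Submodule k A) (mul : A →ₗ[k] A →ₗ[k] A) : Prop :=
  ∀ {p q : ℤ} {a b : A}, a ∈ 𝒜 p → b ∈ 𝒜 q → mul a b = (p * q).negOnePow • mul b a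

/-! ### Coinvariants -/

section Coinv

variable (k : Type v) [Field k] {X : Type} (M : X → Type u) [∀ x, AddCommGroup (M x)]
  [∀ x, Module k (M x)] (rel : ∀ x y, Set (M x →ₗ[k] M y))

/-- The subspace of `⨁ x, M x` spanned by the differences `φ a - a`, where `φ` runs over the
given relabelling maps. -/
def relSub : Submodule k (⨁ x, M x) :=
  open scoped Classical in
  Submodule.span k {w | ∃ (x y : X) (φ : M x →ₗ[k] M y) (a : M x), φ ∈ rel x y ∧
    w = DirectSum.lof k X M y (φ a) - DirectSum.lof k X M x a}

/-- `⨁ x, M x` modulo relabelling. -/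
abbrev Coinv : Type u := (⨁ x, M x) ⧸ relSub k M rel

/-- The class of an element of `M x`. -/
def Coinv.mk (x : X) : M x →ₗ[k] Coinv k M rel :=
  open scoped Classical in
  (relSub k M rel).mkQ ∘ₗ DirectSum.lof k X M x

/-- The induced grading: the degree `d` part consists of the sums of classes of elements of
degree `d`. -/
def Coinv.deg (𝒢 : ∀ x, ℤ → Submodule k (M x)) (d : ℤ) : Submodule k (Coinv k M rel) :=
  ⨆ x, (𝒢 x d).map (Coinv.mk k M rel x)

end Coinv

/-! ### Relabelling bijections -/

/-- `S = (S ∖ {s}) ⨿ {s}`. -/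
def split {S : Type} (s : S) : S ≃ {x // x ≠ s} ⊕ Fin 1 :=
  open scoped Classical in
  ((Equiv.optionSubtypeNe s).symm.trans (Equiv.optionEquivSumPUnit.{0} _)).trans
    (Equiv.sumCongr (Equiv.refl _) (Equiv.ofUnique _ _))

/-- `(A ⨿ B) ⨿ C = (A ⨿ C) ⨿ B`. -/
def rightComm (A B C : Type) : (A ⊕ B) ⊕ C ≃ (A ⊕ C) ⊕ B :=
  ((Equiv.sumAssoc A B C).trans (Equiv.sumCongr (Equiv.refl A) (Equiv.sumComm B C))).trans
    (Equiv.sumAssoc A C B).symm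

/-- `A ⨿ (B ⨿ C) = B ⨿ (A ⨿ C)`. -/
def leftComm (A B C : Type) : A ⊕ (B ⊕ C) ≃ B ⊕ (A ⊕ C) :=
  ((Equiv.sumAssoc A B C).symm.trans (Equiv.sumCongr (Equiv.sumComm A B) (Equiv.refl C))).trans
    (Equiv.sumAssoc B A C)

/-- `A ⨿ (B ⨿ C) = (A ⨿ B) ⨿ C`. -/
abbrev unassoc (A B C : Type) : A ⊕ (B ⊕ C) ≃ (A ⊕ B) ⊕ C := (Equiv.sumAssoc A B C).symm

/-- The identity bijection. -/
abbrev one (A : Type) : A ≃ A := Equiv.refl A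

/-! ### Graded `𝕊`-modules and `𝕊`-bimodules in the unbiased (finite set) form -/

/-- A functor from finite sets and bijections to graded vector spaces. -/
structure SModule (k : Type v) [Field k] where
  obj : ∀ (S : Type) [Finite S], Type u
  [addCommGroup : ∀ (S : Type) [Finite S], AddCommGroup (obj S)]
  [module : ∀ (S : Type) [Finite S], Module k (obj S)]
  deg : ∀ (S : Type) [Finite S], ℤ → Submodule k (obj S)
  graded : ∀ (S : Type) [Finite S], DirectSum.IsInternal (deg S)
  map : ∀ {S T : Type} [Finite S] [Finite T], S ≃ T → (obj S →ₗ[k] obj T)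
  map_deg : ∀ {S T : Type} [Finite S] [Finite T] (e : S ≃ T) {d : ℤ} {a : obj S},
    a ∈ deg S d → map e a ∈ deg T d
  map_refl : ∀ {S : Type} [Finite S] (a : obj S), map (Equiv.refl S) a = a
  map_trans : ∀ {S T U : Type} [Finite S] [Finite T] [Finite U] (e : S ≃ T) (f : T ≃ U)
    (a : obj S), map (e.trans f) a = map f (map e a)

attribute [instance] SModule.addCommGroup SModule.module

/-- A functor from pairs (inputs, outputs) of finite sets and bijections to graded vector
spaces. -/
structure SBimodule (k : Type v) [Field k] where
  obj : ∀ (I J : Type) [Finite I] [Finite J], Type u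
  [addCommGroup : ∀ (I J : Type) [Finite I] [Finite J], AddCommGroup (obj I J)]
  [module : ∀ (I J : Type) [Finite I] [Finite J], Module k (obj I J)]
  deg : ∀ (I J : Type) [Finite I] [Finite J], ℤ → Submodule k (obj I J)
  graded : ∀ (I J : Type) [Finite I] [Finite J], DirectSum.IsInternal (deg I J)
  map : ∀ {I J I' J' : Type} [Finite I] [Finite J] [Finite I'] [Finite J'],
    I ≃ I' → J ≃ J' → (obj I J →ₗ[k] obj I' J')
  map_deg : ∀ {I J I' J' : Type} [Finite I] [Finite J] [Finite I'] [Finite J']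
    (e : I ≃ I') (f : J ≃ J') {d : ℤ} {a : obj I J}, a ∈ deg I J d → map e f a ∈ deg I' J' d
  map_refl : ∀ {I J : Type} [Finite I] [Finite J] (a : obj I J),
    map (Equiv.refl I) (Equiv.refl J) a = a
  map_trans : ∀ {I J I' J' I'' J'' : Type} [Finite I] [Finite J] [Finite I'] [Finite J']
    [Finite I''] [Finite J''] (e : I ≃ I') (f : J ≃ J') (e' : I' ≃ I'') (f' : J' ≃ J'')
    (a : obj I J), map (e.trans e') (f.trans f') a = map e' f' (map e f a)

attribute [instance] SBimodule.addCommGroup SBimodule.module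

namespace SModule

variable {k : Type v} [Field k] (O : SModule.{u, v} k)

/-- `⨁ n, O(n)_{𝕊ₙ}`. -/
abbrev coinv : Type u :=
  Coinv k (fun n : ℕ => O.obj (Fin n)) (fun n m => Set.range fun e : Fin n ≃ Fin m => O.map e)

/-- The grading of `⨁ n, O(n)_{𝕊ₙ}`. -/
def coinvDeg : ℤ → Submodule k O.coinv :=
  Coinv.deg k _ _ fun n : ℕ => O.deg (Fin n)

/-- The class `[a]` in the coinvariants of `a ∈ O(S)`, for any finite set `S`. -/
def cls {S : Type} [Finite S] : O.obj S →ₗ[k] O.coinv :=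
  Coinv.mk k (fun n : ℕ => O.obj (Fin n)) _ (Nat.card S) ∘ₗ O.map (Finite.equivFin S)

end SModule

namespace SBimodule

variable {k : Type v} [Field k] (O : SBimodule.{u, v} k)

/-- `⨁ n m, O(n,m)_{𝕊ₙ × 𝕊ₘ}`. -/
abbrev coinv : Type u :=
  Coinv k (fun x : ℕ × ℕ => O.obj (Fin x.1) (Fin x.2)) (fun x y => Set.range
    fun e : (Fin x.1 ≃ Fin y.1) × (Fin x.2 ≃ Fin y.2) => O.map e.1 e.2)

/-- The grading of `⨁ n m, O(n,m)_{𝕊ₙ × 𝕊ₘ}`. -/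
def coinvDeg : ℤ → Submodule k O.coinv :=
  Coinv.deg k _ _ fun x : ℕ × ℕ => O.deg (Fin x.1) (Fin x.2)

/-- The class `[a]` in the coinvariants of `a ∈ O(I,J)`, for any finite sets `I`, `J`. -/
def cls {I J : Type} [Finite I] [Finite J] : O.obj I J →ₗ[k] O.coinv :=
  Coinv.mk k (fun x : ℕ × ℕ => O.obj (Fin x.1) (Fin x.2)) _ (Nat.card I, Nat.card J) ∘ₗ
    O.map (Finite.equivFin I) (Finite.equivFin J)

end SBimodule

/-! ### Sign and labelling conventions for the odd structures

The odd structures are algebras over the triple of the relevant class of graphs, twisted by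
`𝔎(Γ) = Det(Edge(Γ))`: every contracted edge has degree `-1`, and exchanging two edges changes the
sign.  They are presented by their generating operations.  The symbol of a gluing is written
*between* its two arguments, so the signs are those of the Koszul rule for a symbol `•` of degree
`-1` standing between `a` and `b`.

A flag that is going to be glued is singled out by a summand `Fin 1` (or, for `n` ordered edges,
`Fin n`) of the set of flags.  For arbitrary flags the gluing is obtained by transport along
`S = (S ∖ {s}) ⨿ {s}`. -/

/-! ### Version 1: odd PROPs -/

/-- An odd (`𝔎`-twisted) PROP: compositions along directed graphs without wheels, not necessarily
connected.  They are generated by the graphs with two vertices: `glue n a b` connects, for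
`t : Fin n`, the input `t` of `a` with the output `t` of `b`, the edges being ordered as in
`Fin n`.  The full vertical composition is the case in which `a` has no other inputs and `b` no
other outputs; `n = 0` is the horizontal composition and `n = 1` gives the dioperadic
compositions.  A unit is allowed but not required. -/
structure OddPROP (k : Type v) [Field k] extends SBimodule.{u, v} k where
  glue : ∀ (n : ℕ) {I J K L : Type} [Finite I] [Finite J] [Finite K] [Finite L],
    obj (I ⊕ Fin n) J →ₗ[k] obj K (L ⊕ Fin n) →ₗ[k] obj (I ⊕ K) (J ⊕ L)
  glue_deg : ∀ (n : ℕ) {I J K L : Type} [Finite I] [Finite J] [Finite K] [Finite L] {p q : ℤ}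
    {a : obj (I ⊕ Fin n) J} {b : obj K (L ⊕ Fin n)}, a ∈ deg _ _ p → b ∈ deg _ _ q →
    glue n a b ∈ deg _ _ (p + q - n)
  glue_map : ∀ (n : ℕ) {I J K L I' J' K' L' : Type} [Finite I] [Finite J] [Finite K] [Finite L]
    [Finite I'] [Finite J'] [Finite K'] [Finite L']
    (e : I ≃ I') (f : J ≃ J') (g : K ≃ K') (h : L ≃ L')
    (a : obj (I ⊕ Fin n) J) (b : obj K (L ⊕ Fin n)),
    glue n (map (Equiv.sumCongr e (one _)) f a) (map g (Equiv.sumCongr h (one _)) b) =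
      map (Equiv.sumCongr e g) (Equiv.sumCongr f h) (glue n a b)
  /-- Reordering the edges multiplies by the sign of the permutation. -/
  glue_perm : ∀ (n : ℕ) {I J K L : Type} [Finite I] [Finite J] [Finite K] [Finite L]
    (σ : Equiv.Perm (Fin n)) (a : obj (I ⊕ Fin n) J) (b : obj K (L ⊕ Fin n)),
    glue n (map (Equiv.sumCongr (one I) σ) (one J) a) (map (one K) (Equiv.sumCongr (one L) σ) b) =
      Equiv.Perm.sign σ • glue n a b
  /-- Associativity for graphs with vertices `a`, `b`, `c`, having `p` edges between `a` and `b`,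
  `q` edges between `a` and `c`, and `r` edges between `b` and `c`. -/
  glue_assoc : ∀ (p q r : ℕ) {I J K L M N : Type} [Finite I] [Finite J] [Finite K] [Finite L]
    [Finite M] [Finite N] {d : ℤ} (a : obj ((I ⊕ Fin q) ⊕ Fin p) J)
    {b : obj (K ⊕ Fin r) (L ⊕ Fin p)} (c : obj M ((N ⊕ Fin q) ⊕ Fin r)), b ∈ deg _ _ d →
    map (Equiv.sumAssoc I K M) (Equiv.sumAssoc J L N)
      (glue (q + r)
        (map ((Equiv.sumSumSumComm I (Fin q) K (Fin r)).trans
            (Equiv.sumCongr (one (I ⊕ K)) finSumFinEquiv)) (one (J ⊕ L)) (glue p a b))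
        (map (one M) ((Equiv.sumAssoc N (Fin q) (Fin r)).trans
            (Equiv.sumCongr (one N) finSumFinEquiv)) c)) =
    ((q : ℤ) * d).negOnePow •
      glue (p + q)
        (map (((rightComm I (Fin q) (Fin p)).trans (Equiv.sumAssoc I (Fin p) (Fin q))).trans
            (Equiv.sumCongr (one I) finSumFinEquiv)) (one J) a)
        (map (one (K ⊕ M)) ((Equiv.sumSumSumComm L (Fin p) N (Fin q)).trans
            (Equiv.sumCongr (one (L ⊕ N)) finSumFinEquiv)) (glue r b c))
  /-- The horizontal composition is graded commutative up to relabelling. -/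
  glue_zero_comm : ∀ {I J K L : Type} [Finite I] [Finite J] [Finite K] [Finite L] {p q : ℤ}
    {a : obj I J} {b : obj K L}, a ∈ deg _ _ p → b ∈ deg _ _ q →
    glue 0 (map (Equiv.sumEmpty I (Fin 0)).symm (one J) a)
        (map (one K) (Equiv.sumEmpty L (Fin 0)).symm b) =
      (p * q).negOnePow • map (Equiv.sumComm K I) (Equiv.sumComm L J)
        (glue 0 (map (Equiv.sumEmpty K (Fin 0)).symm (one L) b)
          (map (one I) (Equiv.sumEmpty J (Fin 0)).symm a))

namespace OddPROP

variable {k : Type v} [Field k] (O : OddPROP.{u, v} k)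
variable {I J K L : Type} [Finite I] [Finite J] [Finite K] [Finite L]

/-- The horizontal composition `a ⊟ b`. -/
def box (a : O.obj I J) (b : O.obj K L) : O.obj (I ⊕ K) (J ⊕ L) :=
  O.glue 0 (O.map (Equiv.sumEmpty I (Fin 0)).symm (one J) a)
    (O.map (one K) (Equiv.sumEmpty L (Fin 0)).symm b)

/-- The dioperadic composition of the input `i` of `a` with the output `l` of `b`. -/
def comp (i : I) (l : L) (a : O.obj I J) (b : O.obj K L) :
    O.obj ({x // x ≠ i} ⊕ K) (J ⊕ {x // x ≠ l}) :=
  O.glue 1 (O.map (split i) (one J) a) (O.map (one K) (split l) b)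

/-- `a • b`, the sum over all dioperadic gluings, in the coinvariants. -/
def bullet (a : O.obj I J) (b : O.obj K L) : O.coinv :=
  ∑ᶠ (i : I) (l : L), O.cls (O.comp i l a b)

end OddPROP

/-! ### Version 2: odd nc-dioperads -/

/-- An odd (`𝔎`-twisted) nc-dioperad: compositions along directed forests, generated by the gluing
`glue a b` of one input of `a` with one output of `b` and by the horizontal composition `box`. -/
structure OddNCDioperad (k : Type v) [Field k] extends SBimodule.{u, v} k where
  glue : ∀ {I J K L : Type} [Finite I] [Finite J] [Finite K] [Finite L],
    obj (I ⊕ Fin 1) J →ₗ[k] obj K (L ⊕ Fin 1) →ₗ[k] obj (I ⊕ K) (J ⊕ L)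
  box : ∀ {I J K L : Type} [Finite I] [Finite J] [Finite K] [Finite L],
    obj I J →ₗ[k] obj K L →ₗ[k] obj (I ⊕ K) (J ⊕ L)
  glue_deg : ∀ {I J K L : Type} [Finite I] [Finite J] [Finite K] [Finite L] {p q : ℤ}
    {a : obj (I ⊕ Fin 1) J} {b : obj K (L ⊕ Fin 1)}, a ∈ deg _ _ p → b ∈ deg _ _ q →
    glue a b ∈ deg _ _ (p + q - 1)
  box_deg : ∀ {I J K L : Type} [Finite I] [Finite J] [Finite K] [Finite L] {p q : ℤ}
    {a : obj I J} {b : obj K L}, a ∈ deg _ _ p → b ∈ deg _ _ q →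
    box a b ∈ deg _ _ (p + q)
  glue_map : ∀ {I J K L I' J' K' L' : Type} [Finite I] [Finite J] [Finite K] [Finite L]
    [Finite I'] [Finite J'] [Finite K'] [Finite L']
    (e : I ≃ I') (f : J ≃ J') (g : K ≃ K') (h : L ≃ L')
    (a : obj (I ⊕ Fin 1) J) (b : obj K (L ⊕ Fin 1)),
    glue (map (Equiv.sumCongr e (one _)) f a) (map g (Equiv.sumCongr h (one _)) b) =
      map (Equiv.sumCongr e g) (Equiv.sumCongr f h) (glue a b)
  box_map : ∀ {I J K L I' J' K' L' : Type} [Finite I] [Finite J] [Finite K] [Finite L]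
    [Finite I'] [Finite J'] [Finite K'] [Finite L']
    (e : I ≃ I') (f : J ≃ J') (g : K ≃ K') (h : L ≃ L') (a : obj I J) (b : obj K L),
    box (map e f a) (map g h b) = map (Equiv.sumCongr e g) (Equiv.sumCongr f h) (box a b)
  /-- An output of `c` is glued to `b`, an output of `b` is glued to `a`. -/
  glue_chain : ∀ {I J K L M N : Type} [Finite I] [Finite J] [Finite K] [Finite L]
    [Finite M] [Finite N] (a : obj (I ⊕ Fin 1) J) (b : obj (K ⊕ Fin 1) (L ⊕ Fin 1))
    (c : obj M (N ⊕ Fin 1)),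
    map (Equiv.sumAssoc I K M) (Equiv.sumAssoc J L N)
      (glue (map (unassoc I K (Fin 1)) (one _) (glue a b)) c) =
    glue a (map (one _) (rightComm L (Fin 1) N) (glue b c))
  /-- Outputs of `b` and of `c` are glued to two different inputs of `a`. -/
  glue_inputs : ∀ {I J K L M N : Type} [Finite I] [Finite J] [Finite K] [Finite L]
    [Finite M] [Finite N] {q r : ℤ} (a : obj ((I ⊕ Fin 1) ⊕ Fin 1) J)
    {b : obj K (L ⊕ Fin 1)} {c : obj M (N ⊕ Fin 1)}, b ∈ deg _ _ q → c ∈ deg _ _ r →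
    glue (map (rightComm I (Fin 1) K) (one _) (glue a b)) c =
    ((q - 1) * (r - 1)).negOnePow • map (rightComm I M K) (rightComm J N L)
      (glue (map (rightComm I (Fin 1) M) (one _)
        (glue (map (rightComm I (Fin 1) (Fin 1)) (one _) a) c)) b)
  /-- Two different outputs of `c` are glued to `a` and to `b`. -/
  glue_outputs : ∀ {I J K L M N : Type} [Finite I] [Finite J] [Finite K] [Finite L]
    [Finite M] [Finite N] {p q : ℤ} {a : obj (I ⊕ Fin 1) J} {b : obj (K ⊕ Fin 1) L}
    (c : obj M ((N ⊕ Fin 1) ⊕ Fin 1)), a ∈ deg _ _ p → b ∈ deg _ _ q →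
    glue a (map (one _) (unassoc L N (Fin 1)) (glue b c)) =
    ((p - 1) * (q - 1)).negOnePow • map (leftComm K I M) (leftComm L J N)
      (glue b (map (one _) (unassoc J N (Fin 1))
        (glue a (map (one _) (rightComm N (Fin 1) (Fin 1)) c))))
  box_assoc : ∀ {I J K L M N : Type} [Finite I] [Finite J] [Finite K] [Finite L]
    [Finite M] [Finite N] (a : obj I J) (b : obj K L) (c : obj M N),
    map (Equiv.sumAssoc I K M) (Equiv.sumAssoc J L N) (box (box a b) c) = box a (box b c)
  box_comm : ∀ {I J K L : Type} [Finite I] [Finite J] [Finite K] [Finite L] {p q : ℤ}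
    {a : obj I J} {b : obj K L}, a ∈ deg _ _ p → b ∈ deg _ _ q →
    box a b = (p * q).negOnePow • map (Equiv.sumComm K I) (Equiv.sumComm L J) (box b a)
  box_glue : ∀ {I J K L M N : Type} [Finite I] [Finite J] [Finite K] [Finite L]
    [Finite M] [Finite N] (a : obj I J) (b : obj (K ⊕ Fin 1) L) (c : obj M (N ⊕ Fin 1)),
    map (Equiv.sumAssoc I K M) (Equiv.sumAssoc J L N)
      (glue (map (unassoc I K (Fin 1)) (one _) (box a b)) c) = box a (glue b c)
  glue_box : ∀ {I J K L M N : Type} [Finite I] [Finite J] [Finite K] [Finite L]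
    [Finite M] [Finite N] (a : obj (I ⊕ Fin 1) J) (b : obj K (L ⊕ Fin 1)) (c : obj M N),
    map (Equiv.sumAssoc I K M) (Equiv.sumAssoc J L N) (box (glue a b) c) =
      glue a (map (one _) (rightComm L (Fin 1) N) (box b c))

namespace OddNCDioperad

variable {k : Type v} [Field k] (O : OddNCDioperad.{u, v} k)
variable {I J K L : Type} [Finite I] [Finite J] [Finite K] [Finite L]

/-- The gluing of the input `i` of `a` with the output `l` of `b`. -/
def comp (i : I) (l : L) (a : O.obj I J) (b : O.obj K L) :
    O.obj ({x // x ≠ i} ⊕ K) (J ⊕ {x // x ≠ l}) :=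
  O.glue (O.map (split i) (one J) a) (O.map (one K) (split l) b)

/-- `a • b`, the sum over all gluings, in the coinvariants. -/
def bullet (a : O.obj I J) (b : O.obj K L) : O.coinv :=
  ∑ᶠ (i : I) (l : L), O.cls (O.comp i l a b)

end OddNCDioperad

/-! ### Version 3: odd free nc-operads -/

/-- A box of rooted corollas is a map `π : S → R` of finite sets: `R` is the set of roots, and the
corolla with root `r` has the set of inputs `π ⁻¹ r`.  Joining the root `r` to an input `s` of
another corolla of the box and contracting the edge gives the following box. -/
def contractBox {S R : Type} (π : S → R) (s : S) (r : R) (h : π s ≠ r) :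
    {x // x ≠ s} → {y // y ≠ r} :=
  open scoped Classical in
  fun x => if hx : π x = r then ⟨π s, h⟩ else ⟨π x, hx⟩

/-- An odd (`𝔎`-twisted) free nc-operad: compositions along rooted forests connecting boxed
corollas.  They are generated by the disjoint union `box` of boxes and by the contraction
`contract π s r h` of a single edge from the root `r` to the input `s`.  The contraction is an
operator of degree `-1` written in front of its argument.

In the axioms, a relabelling between two sets built from subsets of the same set is determined by
the condition that it commutes with the inclusions. -/
structure OddFreeNCOperad (k : Type v) [Field k] where
  obj : ∀ {S R : Type} [Finite S] [Finite R], (S → R) → Type u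
  [addCommGroup : ∀ {S R : Type} [Finite S] [Finite R] (π : S → R), AddCommGroup (obj π)]
  [module : ∀ {S R : Type} [Finite S] [Finite R] (π : S → R), Module k (obj π)]
  deg : ∀ {S R : Type} [Finite S] [Finite R] (π : S → R), ℤ → Submodule k (obj π)
  graded : ∀ {S R : Type} [Finite S] [Finite R] (π : S → R), DirectSum.IsInternal (deg π)
  map : ∀ {S R S' R' : Type} [Finite S] [Finite R] [Finite S'] [Finite R'] {π : S → R}
    {π' : S' → R'} (e : S ≃ S') (f : R ≃ R'), (∀ x, π' (e x) = f (π x)) → (obj π →ₗ[k] obj π')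
  map_deg : ∀ {S R S' R' : Type} [Finite S] [Finite R] [Finite S'] [Finite R'] {π : S → R}
    {π' : S' → R'} (e : S ≃ S') (f : R ≃ R') (h : ∀ x, π' (e x) = f (π x)) {d : ℤ} {a : obj π},
    a ∈ deg π d → map e f h a ∈ deg π' d
  map_refl : ∀ {S R : Type} [Finite S] [Finite R] {π : S → R} (a : obj π),
    map (Equiv.refl S) (Equiv.refl R) (fun _ => rfl) a = a
  map_trans : ∀ {S R S' R' S'' R'' : Type} [Finite S] [Finite R] [Finite S'] [Finite R']
    [Finite S''] [Finite R''] {π : S → R} {π' : S' → R'} {π'' : S'' → R''}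
    (e : S ≃ S') (f : R ≃ R') (h : ∀ x, π' (e x) = f (π x))
    (e' : S' ≃ S'') (f' : R' ≃ R'') (h' : ∀ x, π'' (e' x) = f' (π' x))
    (h'' : ∀ x, π'' ((e.trans e') x) = (f.trans f') (π x)) (a : obj π),
    map (e.trans e') (f.trans f') h'' a = map e' f' h' (map e f h a)
  contract : ∀ {S R : Type} [Finite S] [Finite R] (π : S → R) (s : S) (r : R) (h : π s ≠ r),
    obj π →ₗ[k] obj (contractBox π s r h)
  box : ∀ {S R T Q : Type} [Finite S] [Finite R] [Finite T] [Finite Q] {π : S → R} {ρ : T → Q},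
    obj π →ₗ[k] obj ρ →ₗ[k] obj (Sum.map π ρ)
  contract_deg : ∀ {S R : Type} [Finite S] [Finite R] (π : S → R) (s : S) (r : R) (h : π s ≠ r)
    {d : ℤ} {a : obj π}, a ∈ deg π d → contract π s r h a ∈ deg _ (d - 1)
  box_deg : ∀ {S R T Q : Type} [Finite S] [Finite R] [Finite T] [Finite Q] {π : S → R}
    {ρ : T → Q} {p q : ℤ} {a : obj π} {b : obj ρ}, a ∈ deg π p → b ∈ deg ρ q →
    box a b ∈ deg _ (p + q)
  contract_map : ∀ {S R S' R' : Type} [Finite S] [Finite R] [Finite S'] [Finite R'] {π : S → R}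
    {π' : S' → R'} (e : S ≃ S') (f : R ≃ R') (h : ∀ x, π' (e x) = f (π x))
    (s : S) (r : R) (hs : π s ≠ r) (hs' : π' (e s) ≠ f r)
    (e' : {x // x ≠ s} ≃ {x // x ≠ e s}) (f' : {y // y ≠ r} ≃ {y // y ≠ f r})
    (h' : ∀ x, contractBox π' (e s) (f r) hs' (e' x) = f' (contractBox π s r hs x)),
    (∀ x, (e' x).1 = e x.1) → (∀ y, (f' y).1 = f y.1) → ∀ a : obj π,
    contract π' (e s) (f r) hs' (map e f h a) = map e' f' h' (contract π s r hs a)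
  box_map : ∀ {S R T Q S' R' T' Q' : Type} [Finite S] [Finite R] [Finite T] [Finite Q]
    [Finite S'] [Finite R'] [Finite T'] [Finite Q'] {π : S → R} {ρ : T → Q} {π' : S' → R'}
    {ρ' : T' → Q'} (e : S ≃ S') (f : R ≃ R') (h : ∀ x, π' (e x) = f (π x))
    (e' : T ≃ T') (f' : Q ≃ Q') (h' : ∀ x, ρ' (e' x) = f' (ρ x))
    (h'' : ∀ x, Sum.map π' ρ' (Equiv.sumCongr e e' x) = Equiv.sumCongr f f' (Sum.map π ρ x))
    (a : obj π) (b : obj ρ),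
    box (map e f h a) (map e' f' h' b) =
      map (Equiv.sumCongr e e') (Equiv.sumCongr f f') h'' (box a b)
  /-- Contracting two edges in the opposite order changes the sign. -/
  contract_contract : ∀ {S R : Type} [Finite S] [Finite R] (π : S → R) (s s' : S) (r r' : R)
    (hss : s' ≠ s) (hss' : s ≠ s') (hrr : r' ≠ r) (hrr' : r ≠ r')
    (h₁ : π s ≠ r) (h₂ : contractBox π s r h₁ ⟨s', hss⟩ ≠ ⟨r', hrr⟩)
    (h₁' : π s' ≠ r') (h₂' : contractBox π s' r' h₁' ⟨s, hss'⟩ ≠ ⟨r, hrr'⟩)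
    (e : {x : {x // x ≠ s} // x ≠ ⟨s', hss⟩} ≃ {x : {x // x ≠ s'} // x ≠ ⟨s, hss'⟩})
    (f : {y : {y // y ≠ r} // y ≠ ⟨r', hrr⟩} ≃ {y : {y // y ≠ r'} // y ≠ ⟨r, hrr'⟩})
    (h : ∀ x, contractBox (contractBox π s' r' h₁') ⟨s, hss'⟩ ⟨r, hrr'⟩ h₂' (e x) =
      f (contractBox (contractBox π s r h₁) ⟨s', hss⟩ ⟨r', hrr⟩ h₂ x)),
    (∀ x, (e x).1.1 = x.1.1) → (∀ y, (f y).1.1 = y.1.1) → ∀ a : obj π,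
    map e f h (contract _ ⟨s', hss⟩ ⟨r', hrr⟩ h₂ (contract π s r h₁ a)) =
      -contract _ ⟨s, hss'⟩ ⟨r, hrr'⟩ h₂' (contract π s' r' h₁' a)
  /-- Contracting an edge inside the first box commutes with the disjoint union. -/
  contract_box : ∀ {S R T Q : Type} [Finite S] [Finite R] [Finite T] [Finite Q] {π : S → R}
    {ρ : T → Q} (s : S) (r : R) (hs : π s ≠ r) (hs' : Sum.map π ρ (Sum.inl s) ≠ Sum.inl r)
    (e : {x // x ≠ s} ⊕ T ≃ {x : S ⊕ T // x ≠ Sum.inl s})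
    (f : {y // y ≠ r} ⊕ Q ≃ {y : R ⊕ Q // y ≠ Sum.inl r})
    (h : ∀ x, contractBox (Sum.map π ρ) (Sum.inl s) (Sum.inl r) hs' (e x) =
      f (Sum.map (contractBox π s r hs) ρ x)),
    (∀ x, (e x).1 = Sum.map Subtype.val id x) → (∀ y, (f y).1 = Sum.map Subtype.val id y) →
    ∀ (a : obj π) (b : obj ρ),
    map e f h (box (contract π s r hs a) b) =
      contract (Sum.map π ρ) (Sum.inl s) (Sum.inl r) hs' (box a b)
  box_assoc : ∀ {S R T Q U P : Type} [Finite S] [Finite R] [Finite T] [Finite Q] [Finite U]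
    [Finite P] {π : S → R} {ρ : T → Q} {τ : U → P}
    (h : ∀ x, Sum.map π (Sum.map ρ τ) (Equiv.sumAssoc S T U x) =
      Equiv.sumAssoc R Q P (Sum.map (Sum.map π ρ) τ x))
    (a : obj π) (b : obj ρ) (c : obj τ),
    map (Equiv.sumAssoc S T U) (Equiv.sumAssoc R Q P) h (box (box a b) c) = box a (box b c)
  box_comm : ∀ {S R T Q : Type} [Finite S] [Finite R] [Finite T] [Finite Q] {π : S → R}
    {ρ : T → Q} (h : ∀ x, Sum.map π ρ (Equiv.sumComm T S x) =
      Equiv.sumComm Q R (Sum.map ρ π x)) {p q : ℤ} {a : obj π} {b : obj ρ},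
    a ∈ deg π p → b ∈ deg ρ q →
    box a b = (p * q).negOnePow • map (Equiv.sumComm T S) (Equiv.sumComm Q R) h (box b a)

attribute [instance] OddFreeNCOperad.addCommGroup OddFreeNCOperad.module

namespace OddFreeNCOperad

variable {k : Type v} [Field k] (O : OddFreeNCOperad.{u, v} k)

/-- The boxes with standard sets of inputs and of roots. -/
abbrev StdBox : Type := Σ n m : ℕ, Fin n → Fin m

/-- The sum of the `O(n₁,…,nₘ)` modulo all relabellings of inputs and roots. -/
abbrev coinv : Type u :=
  Coinv k (fun x : StdBox => O.obj x.2.2) (fun x y => {φ | ∃ (e : Fin x.1 ≃ Fin y.1)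
    (f : Fin x.2.1 ≃ Fin y.2.1) (h : ∀ i, y.2.2 (e i) = f (x.2.2 i)), φ = O.map e f h})

/-- The grading of the coinvariants. -/
def coinvDeg : ℤ → Submodule k O.coinv :=
  Coinv.deg k _ _ fun x : StdBox => O.deg x.2.2

variable {S R T Q : Type} [Finite S] [Finite R] [Finite T] [Finite Q]

/-- The class `[a]` in the coinvariants of `a ∈ O(π)`, for any box `π`. -/
def cls {π : S → R} : O.obj π →ₗ[k] O.coinv :=
  Coinv.mk k (fun x : StdBox => O.obj x.2.2) _
      ⟨Nat.card S, Nat.card R, fun i => Finite.equivFin R (π ((Finite.equivFin S).symm i))⟩ ∘ₗ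
    O.map (Finite.equivFin S) (Finite.equivFin R) (fun x => by simp)

/-- The gluing of the root `q` of `b` to the input `s` of `a`, where the symbol of the contraction
still stands in front of `a` and `b`. -/
def preComp {π : S → R} {ρ : T → Q} (s : S) (q : Q) (a : O.obj π) (b : O.obj ρ) :
    O.obj (contractBox (Sum.map π ρ) (Sum.inl s) (Sum.inr q) (by simp)) :=
  O.contract (Sum.map π ρ) (Sum.inl s) (Sum.inr q) (by simp) (O.box a b)

/-- `a • b` for `a` of degree `p`: the sum over all gluings of a root of `b` to an input of `a`, in
the coinvariants.  Moving the symbol of the contraction from the front to its place between `a` and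
`b` gives the sign. -/
def bullet {π : S → R} {ρ : T → Q} (p : ℤ) (a : O.obj π) (b : O.obj ρ) : O.coinv :=
  p.negOnePow • ∑ᶠ (s : S) (q : Q), O.cls (O.preComp s q a b)

end OddFreeNCOperad

/-! ### Version 4: odd operads with nc-multiplication (the `B₊` version) -/

/-- An odd operad with nc-multiplication.  The elements of `obj S` have the inputs `S`; the gluing
`glue a b` inserts `b` into an input of `a`, implicitly summing over the roots of `b`.

The nested insertions `a • (b • c)` and `(a • b) • c` agree if there is a single root.
In the presence of several roots (for instance in the free extension, where the compositions are
sums over all roots) their difference consists of the terms in which two different roots of `c` are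
glued to `a` and to `b`; the axiom `glue_nested` says that this difference is symmetric
in `a` and `b`.  Ordinary odd operads, for which the difference is zero, are included. -/
structure OddNCMultOperad (k : Type v) [Field k] extends SModule.{u, v} k where
  glue : ∀ {S T : Type} [Finite S] [Finite T],
    obj (S ⊕ Fin 1) →ₗ[k] obj T →ₗ[k] obj (S ⊕ T)
  box : ∀ {S T : Type} [Finite S] [Finite T], obj S →ₗ[k] obj T →ₗ[k] obj (S ⊕ T)
  glue_deg : ∀ {S T : Type} [Finite S] [Finite T] {p q : ℤ} {a : obj (S ⊕ Fin 1)} {b : obj T},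
    a ∈ deg _ p → b ∈ deg _ q → glue a b ∈ deg _ (p + q - 1)
  box_deg : ∀ {S T : Type} [Finite S] [Finite T] {p q : ℤ} {a : obj S} {b : obj T},
    a ∈ deg _ p → b ∈ deg _ q → box a b ∈ deg _ (p + q)
  glue_map : ∀ {S T S' T' : Type} [Finite S] [Finite T] [Finite S'] [Finite T']
    (e : S ≃ S') (f : T ≃ T') (a : obj (S ⊕ Fin 1)) (b : obj T),
    glue (map (Equiv.sumCongr e (one _)) a) (map f b) = map (Equiv.sumCongr e f) (glue a b)
  box_map : ∀ {S T S' T' : Type} [Finite S] [Finite T] [Finite S'] [Finite T']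
    (e : S ≃ S') (f : T ≃ T') (a : obj S) (b : obj T),
    box (map e a) (map f b) = map (Equiv.sumCongr e f) (box a b)
  /-- Insertions of `b` and of `c` into two different inputs of `a`. -/
  glue_parallel : ∀ {S T U : Type} [Finite S] [Finite T] [Finite U] {q r : ℤ}
    (a : obj ((S ⊕ Fin 1) ⊕ Fin 1)) {b : obj T} {c : obj U}, b ∈ deg _ q → c ∈ deg _ r →
    glue (map (rightComm S (Fin 1) T) (glue a b)) c =
    ((q - 1) * (r - 1)).negOnePow • map (rightComm S U T)
      (glue (map (rightComm S (Fin 1) U) (glue (map (rightComm S (Fin 1) (Fin 1)) a) c)) b)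
  /-- Insertions of `b` into `a` and of `c` into `b`. -/
  glue_nested : ∀ {S T U : Type} [Finite S] [Finite T] [Finite U] {p q : ℤ}
    {a : obj (S ⊕ Fin 1)} {b : obj (T ⊕ Fin 1)} (c : obj U), a ∈ deg _ p → b ∈ deg _ q →
    glue a (glue b c)
        - map (Equiv.sumAssoc S T U) (glue (map (unassoc S T (Fin 1)) (glue a b)) c) =
    ((p - 1) * (q - 1)).negOnePow • map (leftComm T S U)
      (glue b (glue a c)
        - map (Equiv.sumAssoc T S U) (glue (map (unassoc T S (Fin 1)) (glue b a)) c))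
  box_assoc : ∀ {S T U : Type} [Finite S] [Finite T] [Finite U] (a : obj S) (b : obj T)
    (c : obj U), map (Equiv.sumAssoc S T U) (box (box a b) c) = box a (box b c)
  /-- `a • (b ⊟ c) = (a • b) ⊟ c ± b ⊟ (a • c)`. -/
  glue_box : ∀ {S T U : Type} [Finite S] [Finite T] [Finite U] {p q : ℤ}
    {a : obj (S ⊕ Fin 1)} {b : obj T} (c : obj U), a ∈ deg _ p → b ∈ deg _ q →
    glue a (box b c) = map (Equiv.sumAssoc S T U) (box (glue a b) c)
      + ((p - 1) * q).negOnePow • map (leftComm T S U) (box b (glue a c))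
  /-- `(a ⊟ b) • c = ± (a • c) ⊟ b` if the input belongs to `a`. -/
  box_glue_left : ∀ {S T U : Type} [Finite S] [Finite T] [Finite U] {q r : ℤ}
    (a : obj (S ⊕ Fin 1)) {b : obj T} {c : obj U}, b ∈ deg _ q → c ∈ deg _ r →
    glue (map (rightComm S (Fin 1) T) (box a b)) c =
      (q * (r - 1)).negOnePow • map (rightComm S U T) (box (glue a c) b)
  /-- `(a ⊟ b) • c = a ⊟ (b • c)` if the input belongs to `b`. -/
  box_glue_right : ∀ {S T U : Type} [Finite S] [Finite T] [Finite U]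
    (a : obj S) (b : obj (T ⊕ Fin 1)) (c : obj U),
    map (Equiv.sumAssoc S T U) (glue (map (unassoc S T (Fin 1)) (box a b)) c) =
      box a (glue b c)

namespace OddNCMultOperad

variable {k : Type v} [Field k] (O : OddNCMultOperad.{u, v} k)
variable {S T : Type} [Finite S] [Finite T]

/-- The insertion of `b` into the input `s` of `a`. -/
def comp (s : S) (a : O.obj S) (b : O.obj T) : O.obj ({x // x ≠ s} ⊕ T) :=
  O.glue (O.map (split s) a) b

/-- `a • b`, the sum over all insertions, in the coinvariants. -/
def bullet (a : O.obj S) (b : O.obj T) : O.coinv :=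
  ∑ᶠ s : S, O.cls (O.comp s a b)

end OddNCMultOperad

/-! ### Odd nc-cyclic operads -/

/-- An odd (`𝔎`-twisted) nc-cyclic operad: compositions along forests, generated by the gluing
`glue a b` of a flag of `a` with a flag of `b` and by the horizontal composition `box`. -/
structure OddNCCyclicOperad (k : Type v) [Field k] extends SModule.{u, v} k where
  glue : ∀ {S T : Type} [Finite S] [Finite T],
    obj (S ⊕ Fin 1) →ₗ[k] obj (T ⊕ Fin 1) →ₗ[k] obj (S ⊕ T)
  box : ∀ {S T : Type} [Finite S] [Finite T], obj S →ₗ[k] obj T →ₗ[k] obj (S ⊕ T)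
  glue_deg : ∀ {S T : Type} [Finite S] [Finite T] {p q : ℤ} {a : obj (S ⊕ Fin 1)}
    {b : obj (T ⊕ Fin 1)}, a ∈ deg _ p → b ∈ deg _ q → glue a b ∈ deg _ (p + q - 1)
  box_deg : ∀ {S T : Type} [Finite S] [Finite T] {p q : ℤ} {a : obj S} {b : obj T},
    a ∈ deg _ p → b ∈ deg _ q → box a b ∈ deg _ (p + q)
  glue_map : ∀ {S T S' T' : Type} [Finite S] [Finite T] [Finite S'] [Finite T']
    (e : S ≃ S') (f : T ≃ T') (a : obj (S ⊕ Fin 1)) (b : obj (T ⊕ Fin 1)),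
    glue (map (Equiv.sumCongr e (one _)) a) (map (Equiv.sumCongr f (one _)) b) =
      map (Equiv.sumCongr e f) (glue a b)
  box_map : ∀ {S T S' T' : Type} [Finite S] [Finite T] [Finite S'] [Finite T']
    (e : S ≃ S') (f : T ≃ T') (a : obj S) (b : obj T),
    box (map e a) (map f b) = map (Equiv.sumCongr e f) (box a b)
  glue_comm : ∀ {S T : Type} [Finite S] [Finite T] {p q : ℤ} {a : obj (S ⊕ Fin 1)}
    {b : obj (T ⊕ Fin 1)}, a ∈ deg _ p → b ∈ deg _ q →
    glue a b = -(((p - 1) * (q - 1)).negOnePow • map (Equiv.sumComm T S) (glue b a))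
  /-- `a` and `c` are glued to two different flags of `b`. -/
  glue_assoc : ∀ {S T U : Type} [Finite S] [Finite T] [Finite U]
    (a : obj (S ⊕ Fin 1)) (b : obj ((T ⊕ Fin 1) ⊕ Fin 1)) (c : obj (U ⊕ Fin 1)),
    map (Equiv.sumAssoc S T U) (glue (map (unassoc S T (Fin 1)) (glue a b)) c) =
      glue a (map (rightComm T (Fin 1) U) (glue (map (rightComm T (Fin 1) (Fin 1)) b) c))
  box_assoc : ∀ {S T U : Type} [Finite S] [Finite T] [Finite U] (a : obj S) (b : obj T)
    (c : obj U), map (Equiv.sumAssoc S T U) (box (box a b) c) = box a (box b c)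
  box_comm : ∀ {S T : Type} [Finite S] [Finite T] {p q : ℤ} {a : obj S} {b : obj T},
    a ∈ deg _ p → b ∈ deg _ q →
    box a b = (p * q).negOnePow • map (Equiv.sumComm T S) (box b a)
  box_glue : ∀ {S T U : Type} [Finite S] [Finite T] [Finite U]
    (a : obj S) (b : obj (T ⊕ Fin 1)) (c : obj (U ⊕ Fin 1)),
    map (Equiv.sumAssoc S T U) (glue (map (unassoc S T (Fin 1)) (box a b)) c) =
      box a (glue b c)

namespace OddNCCyclicOperad

variable {k : Type v} [Field k] (O : OddNCCyclicOperad.{u, v} k)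
variable {S T : Type} [Finite S] [Finite T]

/-- The gluing of the flag `s` of `a` with the flag `t` of `b`. -/
def comp (s : S) (t : T) (a : O.obj S) (b : O.obj T) : O.obj ({x // x ≠ s} ⊕ {x // x ≠ t}) :=
  O.glue (O.map (split s) a) (O.map (split t) b)

/-- `{a ⊙ b}`, the sum over all gluings of a flag of `a` with a flag of `b`, in the
coinvariants. -/
def odot (a : O.obj S) (b : O.obj T) : O.coinv :=
  ∑ᶠ (s : S) (t : T), O.cls (O.comp s t a b)

end OddNCCyclicOperad

end OddNC

end

set_option linter.unusedSimpArgs false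

noncomputable section

namespace OddNC

/-! ### Graded vector spaces -/

section Graded

variable {k : Type v} [Field k] {A : Type u} [AddCommGroup A] [Module k A]

/-! In the coinvariants relabellings become identities, and a sum over all flags does not depend on
how the flags are named. So the product and the summed gluings descend (`exists_lift₂` and the two
lemmas `pointed_congr`, `sum_pointed_map`). The homogeneous parts of the coinvariants are additively
generated by classes of homogeneous elements with standard flag sets, so every identity needs
checking only on these (`GeneratesGrading`).

The Leibniz rule holds because a flag of `a ⊟ b` is a flag of `a` or a flag of `b`. The Jacobi
identity comes from expanding an iterated gluing as a sum over graphs with three vertices, in three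
ways.

For dioperads, the chains in `a • (b • c)` and `(a • b) • c` agree. What is left of the associator
is the sum where `a` and `b` are glued to two outputs of `c`, minus the sum where `b` and `c` are
glued to two inputs of `a`. The first is graded symmetric in `a, b`, the second in `b, c`, so
antisymmetrization kills both (`commutator_jacobi`). This generalizes the pre-Lie argument. For
nc-multiplications the first part is the nested correction, whose symmetry is an axiom. An odd PROP
restricts to a dioperad by keeping zero or one edge; the exchange axioms come from a gluing along
two edges, whose transposition gives the sign `-1`.

For cyclic operads, `{a ⊙ {b ⊙ c}}` is a sum over paths with `b` or with `c` in the middle. A path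
may be read from either end, so the six path sums cancel in pairs (`jacobi_of_reversal`).

For free nc-operads, let `Δ` be the sum of all contractions of one edge. Contractions anticommute,
so `Δ² = 0`. The edges of `a ⊟ b` lie inside `a`, inside `b`, or run between them, so the bracket
is, up to sign, the failure of `Δ` to be a derivation. The Jacobi identity follows from `Δ² = 0` and
the Leibniz rule (`jacobi_of_batalinVilkovisky`). -/

/-- The decomposition of an internally graded vector space. -/
def gradedEquiv {𝒜 : ℤ → Submodule k A} (h : DirectSum.IsInternal 𝒜) : A ≃ₗ[k] ⨁ d, 𝒜 d :=
  (LinearEquiv.ofBijective (DirectSum.coeLinearMap 𝒜) (show Function.Bijective _ from h)).symm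

theorem gradedEquiv_of_mem {𝒜 : ℤ → Submodule k A} (h : DirectSum.IsInternal 𝒜) {d : ℤ} {a : A}
    (ha : a ∈ 𝒜 d) : gradedEquiv h a = DirectSum.lof k ℤ (fun i => 𝒜 i) d ⟨a, ha⟩ := by
  rw [gradedEquiv, LinearEquiv.symm_apply_eq]
  exact (DirectSum.coeLinearMap_lof 𝒜 d ⟨a, ha⟩).symm

/-- The projection onto the component of degree `d` of an internally graded vector space. -/
def gradedProj {𝒜 : ℤ → Submodule k A} (h : DirectSum.IsInternal 𝒜) (d : ℤ) : A →ₗ[k] A :=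
  (𝒜 d).subtype ∘ₗ DirectSum.component k ℤ (fun i => 𝒜 i) d ∘ₗ (gradedEquiv h).toLinearMap

theorem gradedProj_of_mem {𝒜 : ℤ → Submodule k A} (h : DirectSum.IsInternal 𝒜) {d e : ℤ} {a : A}
    (ha : a ∈ 𝒜 e) : gradedProj h d a = if e = d then a else 0 := by
  simp only [gradedProj, LinearMap.comp_apply, LinearEquiv.coe_coe, gradedEquiv_of_mem h ha]
  by_cases hed : e = d
  · subst hed
    simp [DirectSum.component.lof_self]
  · rw [DirectSum.component.of]
    simp [hed]

theorem linearMap_ext_of_isInternal {𝒜 : ℤ → Submodule k A} (h : DirectSum.IsInternal 𝒜)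
    {V : Type*} [AddCommGroup V] [Module k V] {f g : A →ₗ[k] V}
    (hfg : ∀ d, ∀ a ∈ 𝒜 d, f a = g a) : f = g := by
  ext a
  have ha : a ∈ ⨆ d, 𝒜 d := by rw [h.submodule_iSup_eq_top]; trivial
  induction ha using Submodule.iSup_induction' with
  | mem d x hx => exact hfg d x hx
  | zero => simp
  | add x y _ _ hx hy => simp [hx, hy]

/-- A graded bilinear map may be multiplied by signs which depend on the degrees. -/
theorem exists_signed {𝒜 : ℤ → Submodule k A} (h : DirectSum.IsInternal 𝒜)
    {V : Type*} [AddCommGroup V] [Module k V] (σ : ℤ → ℤ → ℤˣ) (B : A →ₗ[k] A →ₗ[k] V) :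
    ∃ B' : A →ₗ[k] A →ₗ[k] V, ∀ {p q : ℤ} {a b : A}, a ∈ 𝒜 p → b ∈ 𝒜 q →
      B' a b = σ p q • B a b := by
  -- The sign is constant on each pair of components, so the twisted restrictions of `B` are
  -- bilinear and assemble by the universal property of the direct sum, one variable at a time.
  let inner : ∀ p : ℤ, (⨁ q, 𝒜 q) →ₗ[k] 𝒜 p →ₗ[k] V := fun p =>
    DirectSum.toModule k ℤ _ fun q => σ p q • (B.compl₁₂ (𝒜 p).subtype (𝒜 q).subtype).flip
  let outer : (⨁ p, 𝒜 p) →ₗ[k] (⨁ q, 𝒜 q) →ₗ[k] V :=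
    DirectSum.toModule k ℤ _ fun p => (inner p).flip
  refine ⟨outer.compl₁₂ (gradedEquiv h).toLinearMap (gradedEquiv h).toLinearMap,
    fun {p q a b} ha hb => ?_⟩
  simp only [LinearMap.compl₁₂_apply, LinearEquiv.coe_coe, gradedEquiv_of_mem h ha,
    gradedEquiv_of_mem h hb, outer, inner,
    DirectSum.toModule_lof, LinearMap.flip_apply]
  simp

end Graded

/-! ### Coinvariants -/

namespace Coinv

variable {k : Type v} [Field k] {X : Type} {M : X → Type u} [∀ x, AddCommGroup (M x)]
  [∀ x, Module k (M x)] {rel : ∀ x y, Set (M x →ₗ[k] M y)}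

theorem mk_rel {x y : X} {φ : M x →ₗ[k] M y} (hφ : φ ∈ rel x y) (a : M x) :
    Coinv.mk k M rel y (φ a) = Coinv.mk k M rel x a := by
  classical
  simp only [Coinv.mk, LinearMap.comp_apply]
  rw [← sub_eq_zero, ← map_sub, Submodule.mkQ_apply, Submodule.Quotient.mk_eq_zero]
  exact Submodule.subset_span ⟨x, y, φ, a, hφ, by congr⟩

theorem induction {p : Coinv k M rel → Prop} (zero : p 0) (mk : ∀ x a, p (Coinv.mk k M rel x a))
    (add : ∀ a b, p a → p b → p (a + b)) (w : Coinv k M rel) : p w := by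
  classical
  obtain ⟨w, rfl⟩ := Submodule.mkQ_surjective _ w
  induction w using DirectSum.induction_on with
  | zero => simpa using zero
  | of x a => convert mk x a; simp only [Coinv.mk, DirectSum.lof_eq_of, LinearMap.comp_apply]
  | add a b ha hb => rw [map_add]; exact add _ _ ha hb

variable {V : Type*} [AddCommGroup V] [Module k V]

/-- Linear maps out of the coinvariants. -/
theorem exists_lift (f : ∀ x, M x →ₗ[k] V)
    (hf : ∀ x y, ∀ φ ∈ rel x y, ∀ a, f y (φ a) = f x a) :
    ∃ F : Coinv k M rel →ₗ[k] V, ∀ x a, F (Coinv.mk k M rel x a) = f x a := by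
  classical
  refine ⟨(relSub k M rel).liftQ (DirectSum.toModule k X V f) ?_, fun x a => ?_⟩
  · rw [relSub, Submodule.span_le]
    rintro _ ⟨x, y, φ, a, hφ, rfl⟩
    have h1 := hf x y φ hφ a
    simp only [SetLike.mem_coe, LinearMap.mem_ker, map_sub, sub_eq_zero]
    convert h1 <;> convert DirectSum.toModule_lof k _ _
  · simp only [Coinv.mk, LinearMap.comp_apply, Submodule.mkQ_apply, Submodule.liftQ_apply]
    convert DirectSum.toModule_lof k _ _

/-- Bilinear maps out of the coinvariants. -/
theorem exists_lift₂ (f : ∀ x y, M x →ₗ[k] M y →ₗ[k] V)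
    (hf₁ : ∀ x x', ∀ φ ∈ rel x x', ∀ y a b, f x' y (φ a) b = f x y a b)
    (hf₂ : ∀ y y', ∀ φ ∈ rel y y', ∀ x a b, f x y' a (φ b) = f x y a b) :
    ∃ F : Coinv k M rel →ₗ[k] Coinv k M rel →ₗ[k] V,
      ∀ x y a b, F (Coinv.mk k M rel x a) (Coinv.mk k M rel y b) = f x y a b := by
  -- The second variable is lifted with the first one fixed, then the first. The flips keep the
  -- variable being lifted in front.
  choose g hg using fun x => exists_lift (rel := rel) (fun y => (f x y).flip)
    (fun y y' φ hφ b => by ext a; exact hf₂ y y' φ hφ x a b)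
  obtain ⟨F, hF⟩ := exists_lift (rel := rel) (fun x => (g x).flip) (fun x x' φ hφ a => by
    refine LinearMap.ext fun w => ?_
    induction w using Coinv.induction with
    | mk y b => simpa [hg] using hf₁ x x' φ hφ y a b
    | add w w' h h' => simp only [map_add, h, h']
    | zero => simp)
  exact ⟨F, fun x y a b => by simp [hF, hg]⟩

theorem mk_mem_deg {𝒢 : ∀ x, ℤ → Submodule k (M x)} {x : X} {d : ℤ} {a : M x} (ha : a ∈ 𝒢 x d) :
    Coinv.mk k M rel x a ∈ Coinv.deg k M rel 𝒢 d :=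
  Submodule.mem_iSup_of_mem x (Submodule.mem_map_of_mem ha)

theorem deg_induction {𝒢 : ∀ x, ℤ → Submodule k (M x)} {d : ℤ} {p : Coinv k M rel → Prop}
    (zero : p 0) (add : ∀ a b, p a → p b → p (a + b))
    (mk : ∀ x, ∀ a ∈ 𝒢 x d, p (Coinv.mk k M rel x a)) {w : Coinv k M rel}
    (hw : w ∈ Coinv.deg k M rel 𝒢 d) : p w := by
  rw [Coinv.deg] at hw
  induction hw using Submodule.iSup_induction' with
  | mem x w hw => obtain ⟨a, ha, rfl⟩ := hw; exact mk x a ha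
  | zero => exact zero
  | add a b _ _ ha hb => exact add a b ha hb

/-- Relabellings preserve degrees, so they commute with the projections onto homogeneous parts.
These projections therefore descend, and the descended ones separate the components. -/
theorem deg_isInternal {𝒢 : ∀ x, ℤ → Submodule k (M x)}
    (h𝒢 : ∀ x, DirectSum.IsInternal (𝒢 x))
    (hrel : ∀ x y, ∀ φ ∈ rel x y, ∀ d, ∀ a ∈ 𝒢 x d, φ a ∈ 𝒢 y d) :
    DirectSum.IsInternal (Coinv.deg k M rel 𝒢) := by
  choose proj hproj using fun d : ℤ => exists_lift (rel := rel)
    (fun x => Coinv.mk k M rel x ∘ₗ gradedProj (h𝒢 x) d) (fun x y φ hφ => by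
      refine LinearMap.congr_fun (f := (Coinv.mk k M rel y ∘ₗ gradedProj (h𝒢 y) d) ∘ₗ φ) ?_
      refine linearMap_ext_of_isInternal (h𝒢 x) fun e a ha => ?_
      simp only [LinearMap.comp_apply, gradedProj_of_mem (h𝒢 x) ha,
        gradedProj_of_mem (h𝒢 y) (hrel x y φ hφ e a ha)]
      split_ifs
      · exact mk_rel hφ a
      · simp)
  have key : ∀ d e : ℤ, ∀ w ∈ Coinv.deg k M rel 𝒢 e, proj d w = if e = d then w else 0 := by
    intro d e w hw
    refine deg_induction (p := fun w => proj d w = if e = d then w else 0) (by simp)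
      (fun a b ha hb => by rw [map_add, ha, hb]; split_ifs <;> simp) (fun x a ha => ?_) hw
    simp only [hproj, LinearMap.comp_apply, gradedProj_of_mem (h𝒢 x) ha]
    split_ifs <;> simp
  refine DirectSum.isInternal_submodule_of_iSupIndep_of_iSup_eq_top ?_ ?_
  · rw [iSupIndep_def]
    intro d
    rw [Submodule.disjoint_def]
    intro w hw hw'
    -- The components of degree other than `d` lie in the kernel of `proj d`, whereas `proj d` fixes
    -- `w`.
    have h0 : proj d w = 0 := by
      have : (⨆ j, ⨆ (_ : j ≠ d), Coinv.deg k M rel 𝒢 j) ≤ LinearMap.ker (proj d) := by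
        refine iSup₂_le fun j hj w hw => ?_
        rw [LinearMap.mem_ker, key d j w hw, if_neg hj]
      exact this hw'
    rwa [key d d w hw, if_pos rfl] at h0
  · rw [eq_top_iff]
    rintro w -
    induction w using Coinv.induction with
    | mk x a =>
      have ha : a ∈ ⨆ d, 𝒢 x d := by rw [(h𝒢 x).submodule_iSup_eq_top]; trivial
      induction ha using Submodule.iSup_induction' with
      | mem d a ha => exact Submodule.mem_iSup_of_mem d (mk_mem_deg ha)
      | zero => simp
      | add a b _ _ ha hb => rw [map_add]; exact add_mem ha hb
    | add w w' h h' => exact add_mem h h'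
    | zero => exact zero_mem _

end Coinv

/-- Reduces the sign bookkeeping to parities: the longer Koszul sign identities below are settled by
splitting on the parity of the degrees. -/
theorem negOnePow_eq_ite (n : ℤ) : n.negOnePow = if Even n then 1 else -1 := by
  split_ifs with h
  · exact Int.negOnePow_even n h
  · exact Int.negOnePow_odd n (Int.not_even_iff_odd.mp h)

/-! ### Criteria for Gerstenhaber algebras -/

section Criteria

variable {k : Type v} [Field k] {A : Type u} [AddCommGroup A] [Module k A]

theorem map_units_smul_right {V W : Type*} [AddCommGroup V] [Module k V] [AddCommGroup W]
    [Module k W] (f : V →ₗ[k] W) (s : ℤˣ) (x : V) : f (s • x) = s • f x := by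
  simp [Units.smul_def]

theorem map_units_smul_left {V W : Type*} [AddCommGroup V] [Module k V] [AddCommGroup W]
    [Module k W] (f : V →ₗ[k] W →ₗ[k] A) (s : ℤˣ) (x : V) (y : W) :
    f (s • x) y = s • f x y := by
  simp [Units.smul_def]

theorem units_smul_mem (N : Submodule k A) (s : ℤˣ) {x : A} (hx : x ∈ N) : s • x ∈ N := by
  rcases Int.units_eq_one_or s with rfl | rfl <;> simpa using hx

/-- The graded commutator of an operation of degree `-1`. -/
theorem exists_commutator {𝒜 : ℤ → Submodule k A} (hint : DirectSum.IsInternal 𝒜)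
    (bul : A →ₗ[k] A →ₗ[k] A) :
    ∃ br : A →ₗ[k] A →ₗ[k] A, ∀ {p q : ℤ} {a b : A}, a ∈ 𝒜 p → b ∈ 𝒜 q →
      br a b = bul a b - ((p - 1) * (q - 1)).negOnePow • bul b a := by
  obtain ⟨B, hB⟩ := exists_signed hint (fun p q => ((p - 1) * (q - 1)).negOnePow) bul.flip
  exact ⟨bul - B, fun ha hb => by simp [hB ha hb]⟩

/-- A family `g` of homogeneous elements, with degrees `d`, whose sums exhaust the homogeneous
components of the grading `𝒜`. -/
structure GeneratesGrading (𝒜 : ℤ → Submodule k A) {ι : Type*} (g : ι → A) (d : ι → ℤ) :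
    Prop where
  mem : ∀ i, g i ∈ 𝒜 (d i)
  closure : ∀ p, ∀ a ∈ 𝒜 p, a ∈ AddSubmonoid.closure {x | ∃ i, d i = p ∧ g i = x}

namespace GeneratesGrading

variable {𝒜 : ℤ → Submodule k A} {ι : Type*} {g : ι → A} {d : ι → ℤ}
  (hg : GeneratesGrading 𝒜 g d)

include hg

/-- Generation is by sums alone, so only additivity of the property has to be checked, never
compatibility with scalars. -/
theorem induction {P : A → Prop} {p : ℤ} (zero : P 0) (add : ∀ x y, P x → P y → P (x + y))
    (gen : ∀ i, d i = p → P (g i)) {a : A} (ha : a ∈ 𝒜 p) : P a := by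
  have h := hg.closure p a ha
  clear ha
  induction h using AddSubmonoid.closure_induction with
  | mem x hx => obtain ⟨i, hi, rfl⟩ := hx; exact gen i hi
  | zero => exact zero
  | add x y _ _ hx hy => exact add x y hx hy

theorem linearMap_ext (hint : DirectSum.IsInternal 𝒜) {V : Type*} [AddCommGroup V] [Module k V]
    {f f' : A →ₗ[k] V} (h : ∀ i, f (g i) = f' (g i)) : f = f' := by
  refine linearMap_ext_of_isInternal hint fun p a ha => ?_
  exact hg.induction (P := fun a => f a = f' a) (by simp) (fun x y hx hy => by simp [hx, hy])
    (fun i _ => h i) ha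

theorem bilinear_mem {n : ℤ} {B : A →ₗ[k] A →ₗ[k] A}
    (h : ∀ i j, B (g i) (g j) ∈ 𝒜 (d i + d j + n)) {p q : ℤ} {a b : A} (ha : a ∈ 𝒜 p)
    (hb : b ∈ 𝒜 q) : B a b ∈ 𝒜 (p + q + n) := by
  refine hg.induction (P := fun a => B a b ∈ 𝒜 (p + q + n)) (by simp)
    (fun x y hx hy => by simpa using add_mem hx hy) (fun i hi => ?_) ha
  refine hg.induction (P := fun b => B (g i) b ∈ 𝒜 (p + q + n)) (by simp)
    (fun x y hx hy => by simpa using add_mem hx hy) (fun j hj => ?_) hb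
  rw [← hi, ← hj]
  exact h i j

theorem mul_assoc (hint : DirectSum.IsInternal 𝒜) {mul : A →ₗ[k] A →ₗ[k] A}
    (h : ∀ i j l, mul (mul (g i) (g j)) (g l) = mul (g i) (mul (g j) (g l))) (a b c : A) :
    mul (mul a b) c = mul a (mul b c) := by
  -- The three arguments are not assumed homogeneous, so associativity is stated as an equality of
  -- trilinear maps, which may be tested on generators.
  have key : mul.compr₂ mul = LinearMap.compl₁₂ (LinearMap.llcomp k A A A) mul mul := by
    refine hg.linearMap_ext hint fun i => hg.linearMap_ext hint fun j =>
      hg.linearMap_ext hint fun l => ?_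
    simpa using h i j l
  simpa using LinearMap.congr_fun (LinearMap.congr_fun (LinearMap.congr_fun key a) b) c

theorem isGradedComm {mul : A →ₗ[k] A →ₗ[k] A}
    (h : ∀ i j, mul (g i) (g j) = (d i * d j).negOnePow • mul (g j) (g i)) :
    IsGradedComm 𝒜 mul := by
  intro p q a b ha hb
  refine hg.induction (P := fun a => mul a b = (p * q).negOnePow • mul b a) (by simp)
    (fun x y hx hy => by simp [hx, hy]) (fun i hi => ?_) ha
  refine hg.induction (P := fun b => mul (g i) b = (p * q).negOnePow • mul b (g i)) (by simp)
    (fun x y hx hy => by simp [hx, hy]) (fun j hj => ?_) hb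
  rw [← hi, ← hj]
  exact h i j

theorem antisymm {br : A →ₗ[k] A →ₗ[k] A}
    (h : ∀ i j, br (g i) (g j) = -(((d i - 1) * (d j - 1)).negOnePow • br (g j) (g i)))
    {p q : ℤ} {a b : A} (ha : a ∈ 𝒜 p) (hb : b ∈ 𝒜 q) :
    br a b = -(((p - 1) * (q - 1)).negOnePow • br b a) := by
  refine hg.induction (P := fun a => br a b = -(((p - 1) * (q - 1)).negOnePow • br b a)) (by simp)
    (fun x y hx hy => by simp only [map_add, LinearMap.add_apply, hx, hy, smul_add, neg_add])
    (fun i hi => ?_) ha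
  refine hg.induction
    (P := fun b => br (g i) b = -(((p - 1) * (q - 1)).negOnePow • br b (g i))) (by simp)
    (fun x y hx hy => by simp only [map_add, LinearMap.add_apply, hx, hy, smul_add, neg_add])
    (fun j hj => ?_) hb
  rw [← hi, ← hj]
  exact h i j

theorem jacobi {br : A →ₗ[k] A →ₗ[k] A}
    (h : ∀ i j l, br (g i) (br (g j) (g l))
      + ((d l - 1) * ((d i - 1) + (d j - 1))).negOnePow • br (g l) (br (g i) (g j))
      + ((d i - 1) * ((d j - 1) + (d l - 1))).negOnePow • br (g j) (br (g l) (g i)) = 0)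
    {p q r : ℤ} {a b c : A} (ha : a ∈ 𝒜 p) (hb : b ∈ 𝒜 q) (hc : c ∈ 𝒜 r) :
    br a (br b c)
      + ((r - 1) * ((p - 1) + (q - 1))).negOnePow • br c (br a b)
      + ((p - 1) * ((q - 1) + (r - 1))).negOnePow • br b (br c a) = 0 := by
  generalize hs : ((r - 1) * ((p - 1) + (q - 1))).negOnePow = s
  generalize ht : ((p - 1) * ((q - 1) + (r - 1))).negOnePow = t
  refine hg.induction (P := fun a => br a (br b c) + s • br c (br a b) + t • br b (br c a) = 0)
    (by simp) (fun x y hx hy => ?_) (fun i hi => ?_) ha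
  -- The right side is written as `0 + 0` and each zero is replaced by the identity for one summand,
  -- which leaves plain additivity.
  · rw [← add_zero (0 : A)]; nth_rw 1 [← hx]; rw [← hy]
    simp only [map_add, LinearMap.add_apply, smul_add]; abel
  refine hg.induction
    (P := fun b => br (g i) (br b c) + s • br c (br (g i) b) + t • br b (br c (g i)) = 0)
    (by simp) (fun x y hx hy => ?_) (fun j hj => ?_) hb
  · rw [← add_zero (0 : A)]; nth_rw 1 [← hx]; rw [← hy]
    simp only [map_add, LinearMap.add_apply, smul_add]; abel
  refine hg.induction
    (P := fun c => br (g i) (br (g j) c) + s • br c (br (g i) (g j)) + t • br (g j) (br c (g i)) = 0)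
    (by simp) (fun x y hx hy => ?_) (fun l hl => ?_) hc
  · rw [← add_zero (0 : A)]; nth_rw 1 [← hx]; rw [← hy]
    simp only [map_add, LinearMap.add_apply, smul_add]; abel
  rw [← hs, ← ht, ← hi, ← hj, ← hl]
  exact h i j l

theorem leibniz (hint : DirectSum.IsInternal 𝒜) {mul br : A →ₗ[k] A →ₗ[k] A}
    (h : ∀ i j l, br (g i) (mul (g j) (g l)) =
      mul (br (g i) (g j)) (g l) + ((d i - 1) * d j).negOnePow • mul (g j) (br (g i) (g l)))
    {p q : ℤ} {a b : A} (c : A) (ha : a ∈ 𝒜 p) (hb : b ∈ 𝒜 q) :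
    br a (mul b c) = mul (br a b) c + ((p - 1) * q).negOnePow • mul b (br a c) := by
  generalize hs : ((p - 1) * q).negOnePow = s
  refine hg.induction (P := fun a => br a (mul b c) = mul (br a b) c + s • mul b (br a c))
    (by simp) (fun x y hx hy => ?_) (fun i hi => ?_) ha
  · simp only [map_add, LinearMap.add_apply, hx, hy, smul_add]; abel
  refine hg.induction
    (P := fun b => br (g i) (mul b c) = mul (br (g i) b) c + s • mul b (br (g i) c))
    (by simp) (fun x y hx hy => ?_) (fun j hj => ?_) hb
  · simp only [map_add, LinearMap.add_apply, hx, hy, smul_add]; abel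
  have key : br (g i) ∘ₗ mul (g j) = mul (br (g i) (g j)) + s • (mul (g j) ∘ₗ br (g i)) := by
    refine hg.linearMap_ext hint fun l => ?_
    rw [← hs, ← hi, ← hj]
    simpa using h i j l
  simpa using LinearMap.congr_fun key c

/-- A criterion on generators for a Gerstenhaber algebra. -/
theorem isGerstenhaber (hint : DirectSum.IsInternal 𝒜) {mul br : A →ₗ[k] A →ₗ[k] A}
    (mul_mem : ∀ i j, mul (g i) (g j) ∈ 𝒜 (d i + d j))
    (br_mem : ∀ i j, br (g i) (g j) ∈ 𝒜 (d i + d j - 1))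
    (mul_assoc : ∀ i j l, mul (mul (g i) (g j)) (g l) = mul (g i) (mul (g j) (g l)))
    (antisymm : ∀ i j,
      br (g i) (g j) = -(((d i - 1) * (d j - 1)).negOnePow • br (g j) (g i)))
    (jacobi : ∀ i j l, br (g i) (br (g j) (g l))
      + ((d l - 1) * ((d i - 1) + (d j - 1))).negOnePow • br (g l) (br (g i) (g j))
      + ((d i - 1) * ((d j - 1) + (d l - 1))).negOnePow • br (g j) (br (g l) (g i)) = 0)
    (leibniz : ∀ i j l, br (g i) (mul (g j) (g l)) =
      mul (br (g i) (g j)) (g l) + ((d i - 1) * d j).negOnePow • mul (g j) (br (g i) (g l))) :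
    IsGerstenhaber 𝒜 mul br where
  graded := hint
  mul_mem ha hb := by
    simpa using hg.bilinear_mem (n := 0) (fun i j => by simpa using mul_mem i j) ha hb
  br_mem ha hb := hg.bilinear_mem (n := -1) br_mem ha hb
  mul_assoc := hg.mul_assoc hint mul_assoc
  antisymm := hg.antisymm antisymm
  jacobi := hg.jacobi jacobi
  leibniz c ha hb := hg.leibniz hint leibniz c ha hb

/-! ### Graded commutators of an operation of degree `-1` -/

section Commutator

variable {mul bul br : A →ₗ[k] A →ₗ[k] A}
  (hbr : ∀ {p q : ℤ} {a b : A}, a ∈ 𝒜 p → b ∈ 𝒜 q →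
    br a b = bul a b - ((p - 1) * (q - 1)).negOnePow • bul b a)
  (bul_mem : ∀ i j, bul (g i) (g j) ∈ 𝒜 (d i + d j - 1))

include hbr

theorem commutator_antisymm (i j : ι) :
    br (g i) (g j) = -(((d i - 1) * (d j - 1)).negOnePow • br (g j) (g i)) := by
  rw [hbr (hg.mem i) (hg.mem j), hbr (hg.mem j) (hg.mem i)]
  by_cases hi : Even (d i) <;> by_cases hj : Even (d j) <;>
    simp only [negOnePow_eq_ite, Int.even_mul, Int.even_sub, Int.even_add, Int.not_even_one, hi, hj,
      iff_self, iff_true, iff_false, true_iff, false_iff, not_true_eq_false, not_false_eq_true,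
      or_true, true_or, or_self, if_true, if_false, Units.neg_smul, one_smul, neg_neg, smul_neg,
      map_neg, LinearMap.neg_apply] <;> abel

/-- No commutativity of `mul` enters. `bul_mul` yields the two terms in which `a` stands left of the
gluing symbol and `mul_bul` the two in which it stands right; these match the four terms of the
claim one by one. -/
theorem commutator_leibniz (mul_mem : ∀ i j, mul (g i) (g j) ∈ 𝒜 (d i + d j))
    (bul_mul : ∀ i j l, bul (g i) (mul (g j) (g l)) =
      mul (bul (g i) (g j)) (g l) + ((d i - 1) * d j).negOnePow • mul (g j) (bul (g i) (g l)))
    (mul_bul : ∀ i j l, bul (mul (g i) (g j)) (g l) =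
      mul (g i) (bul (g j) (g l)) + (d j * (d l - 1)).negOnePow • mul (bul (g i) (g l)) (g j))
    (i j l : ι) : br (g i) (mul (g j) (g l)) =
      mul (br (g i) (g j)) (g l) + ((d i - 1) * d j).negOnePow • mul (g j) (br (g i) (g l)) := by
  rw [hbr (hg.mem i) (mul_mem j l), hbr (hg.mem i) (hg.mem j), hbr (hg.mem i) (hg.mem l),
    bul_mul, mul_bul]
  simp only [map_sub, LinearMap.sub_apply, map_units_smul_right, LinearMap.smul_apply]
  by_cases hi : Even (d i) <;> by_cases hj : Even (d j) <;> by_cases hl : Even (d l) <;>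
    simp only [negOnePow_eq_ite, Int.even_mul, Int.even_sub, Int.even_add, Int.not_even_one, hi, hj,
      hl, iff_self, iff_true, iff_false, true_iff, false_iff, not_true_eq_false, not_false_eq_true,
      or_true, true_or, or_self, if_true, if_false, Units.neg_smul, one_smul, neg_neg, smul_neg,
      map_neg, LinearMap.neg_apply] <;> abel

include bul_mem

theorem commutator_mem (i j : ι) : br (g i) (g j) ∈ 𝒜 (d i + d j - 1) := by
  rw [hbr (hg.mem i) (hg.mem j)]
  exact sub_mem (bul_mem i j) (units_smul_mem _ _ (by simpa [add_comm] using bul_mem j i))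

/-- If the associator of `bul` is the difference of a part symmetric in the first two and of a part
symmetric in the last two arguments, then its commutator satisfies the Jacobi identity. -/
theorem commutator_jacobi (N P : ι → ι → ι → A)
    (assoc : ∀ i j l, bul (g i) (bul (g j) (g l)) =
      bul (bul (g i) (g j)) (g l) + N i j l - P i j l)
    (N_symm : ∀ i j l, N i j l = ((d i - 1) * (d j - 1)).negOnePow • N j i l)
    (P_symm : ∀ i j l, P i j l = ((d j - 1) * (d l - 1)).negOnePow • P i l j) (i j l : ι) :
    br (g i) (br (g j) (g l))
      + ((d l - 1) * ((d i - 1) + (d j - 1))).negOnePow • br (g l) (br (g i) (g j))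
      + ((d i - 1) * ((d j - 1) + (d l - 1))).negOnePow • br (g j) (br (g l) (g i)) = 0 := by
  have hbb : ∀ i j l, br (g i) (br (g j) (g l)) =
      bul (g i) (bul (g j) (g l))
        - ((d i - 1) * (d j + d l - 1 - 1)).negOnePow • bul (bul (g j) (g l)) (g i)
      - ((d j - 1) * (d l - 1)).negOnePow • (bul (g i) (bul (g l) (g j))
        - ((d i - 1) * (d l + d j - 1 - 1)).negOnePow • bul (bul (g l) (g j)) (g i)) := by
    intro i j l
    rw [hbr (hg.mem j) (hg.mem l), map_sub, map_units_smul_right,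
      hbr (hg.mem i) (bul_mem j l), hbr (hg.mem i) (bul_mem l j)]
  -- The Jacobi sum is the signed sum of the associators over the six orders of the arguments. A
  -- part that is graded symmetric in two neighbouring arguments drops out of it, so one
  -- representative of each `N` and each `P` suffices.
  rw [hbb i j l, hbb l i j, hbb j l i, assoc i j l, assoc i l j, assoc j i l, assoc j l i,
    assoc l i j, assoc l j i, N_symm j i l, N_symm l i j, N_symm l j i, P_symm i l j,
    P_symm j l i, P_symm l j i]
  by_cases hi : Even (d i) <;> by_cases hj : Even (d j) <;> by_cases hl : Even (d l) <;>
    simp only [negOnePow_eq_ite, Int.even_mul, Int.even_sub, Int.even_add, Int.not_even_one, hi, hj,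
      hl, iff_self, iff_true, iff_false, true_iff, false_iff, not_true_eq_false, not_false_eq_true,
      or_true, true_or, or_self, if_true, if_false, Units.neg_smul, one_smul, neg_neg, smul_neg,
      map_neg, LinearMap.neg_apply] <;> abel

end Commutator

/-! ### Leibniz rules when the product is graded commutative -/

section Commutative

variable {mul : A →ₗ[k] A →ₗ[k] A} (comm : IsGradedComm 𝒜 mul)

include comm

/-- With a commutative product it is convenient to compute the gluing with the glued factor in
front; commutativity puts it where `commutator_leibniz` expects it. -/
theorem bul_mul_of_comm {bul : A →ₗ[k] A →ₗ[k] A}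
    (bul_mem : ∀ i j, bul (g i) (g j) ∈ 𝒜 (d i + d j - 1))
    (h : ∀ i j l, bul (g i) (mul (g j) (g l)) = mul (bul (g i) (g j)) (g l)
      + (d j * d l).negOnePow • mul (bul (g i) (g l)) (g j)) (i j l : ι) :
    bul (g i) (mul (g j) (g l)) =
      mul (bul (g i) (g j)) (g l) + ((d i - 1) * d j).negOnePow • mul (g j) (bul (g i) (g l)) := by
  rw [h, comm (bul_mem i l) (hg.mem j)]
  by_cases hi : Even (d i) <;> by_cases hj : Even (d j) <;> by_cases hl : Even (d l) <;>
    simp only [negOnePow_eq_ite, Int.even_mul, Int.even_sub, Int.even_add, Int.not_even_one, hi, hj,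
      hl, iff_self, iff_true, iff_false, true_iff, false_iff, not_true_eq_false, not_false_eq_true,
      or_true, true_or, or_self, if_true, if_false, Units.neg_smul, one_smul, neg_neg, smul_neg,
      map_neg, LinearMap.neg_apply]

theorem mul_bul_of_comm {bul : A →ₗ[k] A →ₗ[k] A}
    (bul_mem : ∀ i j, bul (g i) (g j) ∈ 𝒜 (d i + d j - 1))
    (h : ∀ i j l, bul (mul (g i) (g j)) (g l) = mul (g i) (bul (g j) (g l))
      + (d i * d j).negOnePow • mul (g j) (bul (g i) (g l))) (i j l : ι) :
    bul (mul (g i) (g j)) (g l) =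
      mul (g i) (bul (g j) (g l)) + (d j * (d l - 1)).negOnePow • mul (bul (g i) (g l)) (g j) := by
  rw [h, comm (bul_mem i l) (hg.mem j)]
  by_cases hi : Even (d i) <;> by_cases hj : Even (d j) <;> by_cases hl : Even (d l) <;>
    simp only [negOnePow_eq_ite, Int.even_mul, Int.even_sub, Int.even_add, Int.not_even_one, hi, hj,
      hl, iff_self, iff_true, iff_false, true_iff, false_iff, not_true_eq_false, not_false_eq_true,
      or_true, true_or, or_self, if_true, if_false, Units.neg_smul, one_smul, neg_neg, smul_neg,
      map_neg, LinearMap.neg_apply]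

/-- A graded antisymmetric bracket with the Leibniz rule in its first argument has the Leibniz rule
in its second argument. -/
theorem leibniz_of_comm {br : A →ₗ[k] A →ₗ[k] A}
    (mul_mem : ∀ i j, mul (g i) (g j) ∈ 𝒜 (d i + d j))
    (br_mem : ∀ i j, br (g i) (g j) ∈ 𝒜 (d i + d j - 1))
    (antisymm : ∀ i j,
      br (g i) (g j) = -(((d i - 1) * (d j - 1)).negOnePow • br (g j) (g i)))
    (h : ∀ i j l, br (mul (g i) (g j)) (g l) = mul (g i) (br (g j) (g l))
      + (d i * d j).negOnePow • mul (g j) (br (g i) (g l))) (i j l : ι) :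
    br (g i) (mul (g j) (g l)) =
      mul (br (g i) (g j)) (g l) + ((d i - 1) * d j).negOnePow • mul (g j) (br (g i) (g l)) := by
  rw [hg.antisymm antisymm (hg.mem i) (mul_mem j l), h, comm (br_mem i j) (hg.mem l),
    antisymm j i, antisymm l i]
  simp only [map_neg, LinearMap.neg_apply, map_units_smul_right, LinearMap.smul_apply]
  by_cases hi : Even (d i) <;> by_cases hj : Even (d j) <;> by_cases hl : Even (d l) <;>
    simp only [negOnePow_eq_ite, Int.even_mul, Int.even_sub, Int.even_add, Int.not_even_one, hi, hj,
      hl, iff_self, iff_true, iff_false, true_iff, false_iff, not_true_eq_false, not_false_eq_true,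
      or_true, true_or, or_self, if_true, if_false, Units.neg_smul, one_smul, neg_neg, smul_neg,
      map_neg, LinearMap.neg_apply] <;> abel

end Commutative

end GeneratesGrading

/-- The Jacobi identity for a bracket whose iterations are sums of two contributions of the same
type `X`, which are symmetric under reversal of their arguments. -/
theorem jacobi_of_reversal {ι : Type*} {g : ι → A} {d : ι → ℤ} {br : A →ₗ[k] A →ₗ[k] A}
    (X : ι → ι → ι → A)
    (br_br : ∀ i j l, br (g i) (br (g j) (g l)) =
      X i j l - ((d j - 1) * (d l - 1)).negOnePow • X i l j)
    (X_symm : ∀ i j l, X i j l =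
      ((d i - 1) * (d j - 1) + (d j - 1) * (d l - 1) + (d i - 1) * (d l - 1)).negOnePow • X l j i)
    (i j l : ι) : br (g i) (br (g j) (g l))
      + ((d l - 1) * ((d i - 1) + (d j - 1))).negOnePow • br (g l) (br (g i) (g j))
      + ((d i - 1) * ((d j - 1) + (d l - 1))).negOnePow • br (g j) (br (g l) (g i)) = 0 := by
  -- Of the six terms, the two with the same middle argument are exchanged by reversal and cancel.
  rw [br_br, br_br, br_br, X_symm l j i, X_symm j l i, X_symm j i l]
  by_cases hi : Even (d i) <;> by_cases hj : Even (d j) <;> by_cases hl : Even (d l) <;>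
    simp only [negOnePow_eq_ite, Int.even_mul, Int.even_sub, Int.even_add, Int.not_even_one, hi, hj,
      hl, iff_self, iff_true, iff_false, true_iff, false_iff, not_true_eq_false, not_false_eq_true,
      or_true, true_or, or_self, if_true, if_false, Units.neg_smul, one_smul, neg_neg, smul_neg,
      map_neg, LinearMap.neg_apply] <;> abel

/-- The Jacobi identity for the bracket of a Batalin–Vilkovisky operator. -/
theorem jacobi_of_batalinVilkovisky {𝒜 : ℤ → Submodule k A} {mul br : A →ₗ[k] A →ₗ[k] A}
    {Δ : A →ₗ[k] A} (hΔ : ∀ a, Δ (Δ a) = 0) (Δ_mem : ∀ {p a}, a ∈ 𝒜 p → Δ a ∈ 𝒜 (p - 1))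
    (mul_mem : ∀ {p q : ℤ} {a b : A}, a ∈ 𝒜 p → b ∈ 𝒜 q → mul a b ∈ 𝒜 (p + q))
    (br_mem : ∀ {p q : ℤ} {a b : A}, a ∈ 𝒜 p → b ∈ 𝒜 q → br a b ∈ 𝒜 (p + q - 1))
    (Δ_mul : ∀ {p q : ℤ} {a b : A}, a ∈ 𝒜 p → b ∈ 𝒜 q →
      Δ (mul a b) = mul (Δ a) b + p.negOnePow • mul a (Δ b) + p.negOnePow • br a b)
    (antisymm : ∀ {p q : ℤ} {a b : A}, a ∈ 𝒜 p → b ∈ 𝒜 q →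
      br a b = -(((p - 1) * (q - 1)).negOnePow • br b a))
    (leibniz : ∀ {p q : ℤ} {a b : A} (c : A), a ∈ 𝒜 p → b ∈ 𝒜 q →
      br a (mul b c) = mul (br a b) c + ((p - 1) * q).negOnePow • mul b (br a c))
    {p q r : ℤ} {a b c : A} (ha : a ∈ 𝒜 p) (hb : b ∈ 𝒜 q) (hc : c ∈ 𝒜 r) :
    br a (br b c)
      + ((r - 1) * ((p - 1) + (q - 1))).negOnePow • br c (br a b)
      + ((p - 1) * ((q - 1) + (r - 1))).negOnePow • br b (br c a) = 0 := by
  -- `Δ` is applied to its own product formula. The left side vanishes, the two terms `Δ a · Δ b`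
  -- cancel, and what remains says that `Δ` is a derivation of the bracket.
  have deriv : ∀ {p q : ℤ} {a b : A}, a ∈ 𝒜 p → b ∈ 𝒜 q →
      Δ (br a b) = br (Δ a) b - p.negOnePow • br a (Δ b) := by
    intro p q a b ha hb
    have h := hΔ (mul a b)
    rw [Δ_mul ha hb, map_add, map_add, map_units_smul_right, map_units_smul_right,
      Δ_mul (Δ_mem ha) hb, Δ_mul ha (Δ_mem hb), hΔ, hΔ] at h
    rw [← sub_eq_zero]
    by_cases hp : Even p <;>
      simp only [negOnePow_eq_ite, Int.even_sub, Int.not_even_one, hp, iff_self, iff_false,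
        not_true_eq_false, not_false_eq_true, if_true, if_false, Units.neg_smul, one_smul,
        map_zero, LinearMap.zero_apply] at h ⊢
    · refine Eq.trans ?_ h
      abel
    · refine Eq.trans ?_ (neg_eq_zero.mpr h)
      abel
  -- The derivation property on `{a, bc}`: after both sides are expanded by the Leibniz rule and the
  -- product formula, every term containing `Δ` cancels and the Jacobi sum remains.
  have h := deriv ha (mul_mem hb hc)
  rw [Δ_mul hb hc, leibniz c ha hb, leibniz c (Δ_mem ha) hb, map_add, map_add, map_add,
    map_units_smul_right, map_units_smul_right, map_units_smul_right,
    leibniz c ha (Δ_mem hb), leibniz (Δ c) ha hb, Δ_mul (br_mem ha hb) hc,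
    Δ_mul hb (br_mem ha hc), deriv ha hb, deriv ha hc, ← sub_eq_zero,
    antisymm (br_mem ha hb) hc, antisymm ha hc] at h
  simp only [map_sub, map_neg, LinearMap.sub_apply, map_units_smul_right, LinearMap.smul_apply] at h
  by_cases hp : Even p <;> by_cases hq : Even q <;> by_cases hr : Even r <;>
    simp only [negOnePow_eq_ite, Int.even_mul, Int.even_sub, Int.even_add, Int.not_even_one, hp, hq,
      hr, iff_self, iff_true, iff_false, true_iff, false_iff, not_true_eq_false, not_false_eq_true,
      or_true, true_or, or_self, if_true, if_false, Units.neg_smul, one_smul, neg_neg, smul_neg,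
      map_neg, LinearMap.neg_apply] at h ⊢
  -- The parities decide whether the remainder is the Jacobi sum or its negative.
  all_goals first
    | refine Eq.trans ?_ h; abel1
    | refine Eq.trans ?_ (neg_eq_zero.mpr h); abel1

end Criteria

/-! ### Relabelling bijections -/

theorem self_trans_symm_trans {A B C : Type*} (e : A ≃ B) (f : A ≃ C) :
    e.trans (e.symm.trans f) = f := by
  ext x
  simp

theorem rightComm_natural {A B C A' B' C' : Type} (e : A ≃ A') (f : B ≃ B') (g : C ≃ C') :
    (Equiv.sumCongr (Equiv.sumCongr e f) g).trans (rightComm A' B' C') =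
      (rightComm A B C).trans (Equiv.sumCongr (Equiv.sumCongr e g) f) := by
  ext ((x | x) | x) <;> rfl

theorem unassoc_natural {A B C A' B' C' : Type} (e : A ≃ A') (f : B ≃ B') (g : C ≃ C') :
    (Equiv.sumCongr e (Equiv.sumCongr f g)).trans (unassoc A' B' C') =
      (unassoc A B C).trans (Equiv.sumCongr (Equiv.sumCongr e f) g) := by
  ext (x | (x | x)) <;> rfl

theorem sumComm_trans_unassoc (A B C : Type) :
    (Equiv.sumComm (A ⊕ C) B).trans (unassoc B A C) =
      (rightComm A C B).trans (Equiv.sumCongr (Equiv.sumComm A B) (one C)) := by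
  ext ((x | x) | x) <;> rfl

theorem sumComm_trans_rightComm (A B C : Type) :
    (Equiv.sumComm B (A ⊕ C)).trans (rightComm A C B) =
      (unassoc B A C).trans (Equiv.sumCongr (Equiv.sumComm B A) (one C)) := by
  ext (x | (x | x)) <;> rfl

theorem rightComm_trans_rightComm (A B C : Type) :
    (rightComm A B C).trans (rightComm A C B) = Equiv.refl _ := by
  ext ((x | x) | x) <;> rfl

@[simp]
theorem split_self {S : Type} (s : S) : split s s = Sum.inr 0 := by
  classical
  simp only [split, Equiv.trans_apply]
  -- The decidability instance has to be the classical one that `split` was built with.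
  rw [show (@Equiv.optionSubtypeNe S (fun a b => Classical.propDecidable (a = b)) s).symm s = none by
    rw [Equiv.symm_apply_eq]; simp]
  rfl

@[simp]
theorem split_symm_inr {S : Type} (s : S) (x : Fin 1) : (split s).symm (Sum.inr x) = s := by
  rw [Equiv.symm_apply_eq, split_self, Subsingleton.elim x 0]

@[simp]
theorem split_symm_inl {S : Type} (s : S) (x : {x // x ≠ s}) : (split s).symm (Sum.inl x) = x := by
  simp [split, Equiv.optionEquivSumPUnit]

/-- A bijection `A ⨿ {*} = B ⨿ {*}` preserving the base points comes from a bijection `A = B`. -/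
theorem exists_sumCongr_eq {A B : Type} (e : A ⊕ Fin 1 ≃ B ⊕ Fin 1)
    (he : e (Sum.inr 0) = Sum.inr 0) : ∃ h : A ≃ B, e = Equiv.sumCongr h (one _) := by
  have h1 : ∀ a, ∃ b, e (Sum.inl a) = Sum.inl b := by
    intro a
    rcases hb : e (Sum.inl a) with b | b
    · exact ⟨b, rfl⟩
    · rw [Subsingleton.elim b 0, ← he] at hb
      simpa using e.injective hb
  choose f hf using h1
  have hbij : Function.Bijective f := by
    constructor
    · intro a a' h
      have : e (Sum.inl a) = e (Sum.inl a') := by rw [hf, hf, h]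
      simpa using e.injective this
    · intro b
      obtain ⟨a | a, ha⟩ := e.surjective (Sum.inl b)
      · exact ⟨a, by simpa [hf] using ha⟩
      · rw [Subsingleton.elim a 0, he] at ha
        simp at ha
  refine ⟨Equiv.ofBijective f hbij, ?_⟩
  ext (a | a)
  · simp [hf]
  · rw [Subsingleton.elim a 0, he]; rfl

/-! ### Graded `𝕊`-modules -/

namespace SModule

variable {k : Type v} [Field k] (O : SModule.{u, v} k)

section Coinvariants

variable {S T : Type} [Finite S] [Finite T]

/-- The class of an element with a standard set of flags. -/
abbrev stdCls (n : ℕ) : O.obj (Fin n) →ₗ[k] O.coinv :=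
  Coinv.mk k (fun n : ℕ => O.obj (Fin n)) (fun n m => Set.range fun e : Fin n ≃ Fin m => O.map e) n

/-- The class does not depend on the enumeration chosen inside `cls`; any other one differs from it
by a relabelling of standard sets. -/
theorem cls_eq_stdCls (n : ℕ) (e : S ≃ Fin n) (a : O.obj S) :
    O.cls a = O.stdCls n (O.map e a) := by
  have h : O.stdCls n (O.map ((Finite.equivFin S).symm.trans e) (O.map (Finite.equivFin S) a)) =
      O.stdCls _ (O.map (Finite.equivFin S) a) :=
    Coinv.mk_rel (rel := fun n m => Set.range fun e : Fin n ≃ Fin m => O.map e)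
      (Set.mem_range_self _) _
  rw [← O.map_trans, self_trans_symm_trans] at h
  exact h.symm

@[simp]
theorem cls_map (e : S ≃ T) (a : O.obj S) : O.cls (O.map e a) = O.cls a := by
  rw [O.cls_eq_stdCls _ (Finite.equivFin T), O.cls_eq_stdCls _ (e.trans (Finite.equivFin T)),
    O.map_trans]

theorem cls_mem {p : ℤ} {a : O.obj S} (ha : a ∈ O.deg S p) : O.cls a ∈ O.coinvDeg p :=
  Coinv.mk_mem_deg (𝒢 := fun n : ℕ => O.deg (Fin n)) (O.map_deg _ ha)

theorem coinvDeg_isInternal : DirectSum.IsInternal O.coinvDeg := by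
  refine Coinv.deg_isInternal (fun n => O.graded (Fin n)) ?_
  rintro n m _ ⟨e, rfl⟩ d a ha
  exact O.map_deg e ha

/-- Homogeneous elements with standard sets of flags. -/
abbrev Gen : Type u := Σ (n : ℕ) (p : ℤ), O.deg (Fin n) p

theorem generatesGrading :
    GeneratesGrading O.coinvDeg (fun i : O.Gen => O.cls i.2.2.1) (fun i => i.2.1) where
  mem i := O.cls_mem i.2.2.2
  closure p a ha := by
    refine Coinv.deg_induction
      (p := fun a => a ∈ AddSubmonoid.closure {x | ∃ i : O.Gen, i.2.1 = p ∧ O.cls i.2.2.1 = x})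
      (zero_mem _) (fun a b => add_mem) (fun n a ha => ?_) ha
    refine AddSubmonoid.subset_closure ⟨⟨n, p, a, ha⟩, rfl, ?_⟩
    rw [O.cls_eq_stdCls n (Equiv.refl _), O.map_refl]

/-- The way product and gluings descend: a family over all finite sets that ignores relabelling is
determined by its values on the sets `Fin n`. -/
theorem exists_bilinear {V : Type*} [AddCommGroup V] [Module k V]
    (B : ∀ (S T : Type) [Finite S] [Finite T], O.obj S →ₗ[k] O.obj T →ₗ[k] V)
    (hB : ∀ {S T S' T' : Type} [Finite S] [Finite T] [Finite S'] [Finite T'] (e : S ≃ S')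
      (f : T ≃ T') (a : O.obj S) (b : O.obj T), B S' T' (O.map e a) (O.map f b) = B S T a b) :
    ∃ F : O.coinv →ₗ[k] O.coinv →ₗ[k] V, ∀ (S T : Type) [Finite S] [Finite T] (a : O.obj S)
      (b : O.obj T), F (O.cls a) (O.cls b) = B S T a b := by
  obtain ⟨F, hF⟩ := Coinv.exists_lift₂ (k := k) (M := fun n : ℕ => O.obj (Fin n))
    (rel := fun n m => Set.range fun e : Fin n ≃ Fin m => O.map e)
    (fun n m => B (Fin n) (Fin m))
    (by
      rintro n m _ ⟨e, rfl⟩ l a b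
      simpa [O.map_refl] using hB e (Equiv.refl _) a b)
    (by
      rintro n m _ ⟨e, rfl⟩ l a b
      simpa [O.map_refl] using hB (Equiv.refl _) e a b)
  refine ⟨F, fun S T _ _ a b => ?_⟩
  rw [O.cls_eq_stdCls _ (Finite.equivFin S), O.cls_eq_stdCls _ (Finite.equivFin T), hF, hB]

end Coinvariants

/-! Sums over the ways to single out a flag. -/

section PointedSums

variable {V : Type*}

section

variable {F : ∀ (S : Type) [Finite S], O.obj (S ⊕ Fin 1) → V}
  (hF : ∀ {S S' : Type} [Finite S] [Finite S'] (e : S ≃ S') (a : O.obj (S ⊕ Fin 1)),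
    F S' (O.map (Equiv.sumCongr e (one _)) a) = F S a)

include hF

/-- Two bijections that single out the same flag differ by a relabelling of the remaining flags, to
which `F` is blind. The complement may thus be modelled by any set. -/
theorem pointed_congr {S S₁ S₂ : Type} [Finite S] [Finite S₁] [Finite S₂] (e₁ : S ≃ S₁ ⊕ Fin 1)
    (e₂ : S ≃ S₂ ⊕ Fin 1) (h : e₁.symm (Sum.inr 0) = e₂.symm (Sum.inr 0)) (a : O.obj S) :
    F S₁ (O.map e₁ a) = F S₂ (O.map e₂ a) := by
  obtain ⟨f, hf⟩ := exists_sumCongr_eq (e₁.symm.trans e₂) (by simp [h])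
  rw [← hF f, ← hf, ← O.map_trans, self_trans_symm_trans]

variable [AddCommMonoid V]

theorem sum_pointed_map {S T : Type} [Finite S] [Finite T] (e : S ≃ T) (a : O.obj S) :
    ∑ᶠ t, F _ (O.map (split t) (O.map e a)) = ∑ᶠ s, F _ (O.map (split s) a) := by
  rw [← finsum_comp_equiv e]
  refine finsum_congr fun s => ?_
  rw [← O.map_trans]
  exact O.pointed_congr hF _ _ (by simp) a

/-- The source of every two-term expansion below: a flag of a composite belongs to one of the two
pieces. -/
theorem sum_pointed_sum {S T : Type} [Finite S] [Finite T] (a : O.obj (S ⊕ T)) :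
    ∑ᶠ x, F _ (O.map (split x) a) =
      ∑ᶠ s : S, F _ (O.map (rightComm _ (Fin 1) T) (O.map (Equiv.sumCongr (split s) (one T)) a)) +
      ∑ᶠ t : T, F _ (O.map (unassoc S _ (Fin 1)) (O.map (Equiv.sumCongr (one S) (split t)) a)) := by
  cases nonempty_fintype S
  cases nonempty_fintype T
  simp only [finsum_eq_sum_of_fintype, Fintype.sum_sum_type]
  congr 1
  · refine Finset.sum_congr rfl fun s _ => ?_
    rw [← O.map_trans]
    exact O.pointed_congr hF _ _ (by simp [rightComm]) a
  · refine Finset.sum_congr rfl fun s _ => ?_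
    rw [← O.map_trans]
    exact O.pointed_congr hF _ _ (by simp) a

end

theorem sum_ne_swap [AddCommMonoid V] {S : Type} [Finite S] (Φ : S → S → V) :
    ∑ᶠ (s : S) (s' : {x // x ≠ s}), Φ s s' = ∑ᶠ (s : S) (s' : {x // x ≠ s}), Φ s' s := by
  classical
  cases nonempty_fintype S
  simp only [finsum_eq_sum_of_fintype]
  rw [Finset.sum_sigma', Finset.sum_sigma']
  refine Finset.sum_bij' (fun x _ => ⟨x.2.1, x.1, x.2.2.symm⟩) (fun x _ => ⟨x.2.1, x.1, x.2.2.symm⟩)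
    ?_ ?_ ?_ ?_ ?_ <;> simp

/-- Singling out two flags in the opposite order. -/
theorem sum_pointed_swap [AddCommMonoid V]
    {F : ∀ (S : Type) [Finite S], O.obj ((S ⊕ Fin 1) ⊕ Fin 1) → V}
    (hF : ∀ {S S' : Type} [Finite S] [Finite S'] (e : S ≃ S') (a : O.obj ((S ⊕ Fin 1) ⊕ Fin 1)),
      F S' (O.map (Equiv.sumCongr (Equiv.sumCongr e (one _)) (one _)) a) = F S a)
    {S : Type} [Finite S] (a : O.obj S) :
    ∑ᶠ (s : S) (s' : {x // x ≠ s}), F _ (O.map (Equiv.sumCongr (split s') (one _))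
        (O.map (split s) a)) =
      ∑ᶠ (s : S) (s' : {x // x ≠ s}), F _ (O.map (rightComm _ (Fin 1) (Fin 1))
        (O.map (Equiv.sumCongr (split s') (one _)) (O.map (split s) a))) := by
  classical
  -- The version of `pointed_congr` for two ordered marked flags, obtained by removing one base
  -- point after the other.
  have key : ∀ {S₁ S₂ : Type} [Finite S₁] [Finite S₂] (e₁ : S ≃ (S₁ ⊕ Fin 1) ⊕ Fin 1)
      (e₂ : S ≃ (S₂ ⊕ Fin 1) ⊕ Fin 1), e₁.symm (Sum.inr 0) = e₂.symm (Sum.inr 0) →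
      e₁.symm (Sum.inl (Sum.inr 0)) = e₂.symm (Sum.inl (Sum.inr 0)) →
      F S₁ (O.map e₁ a) = F S₂ (O.map e₂ a) := by
    intro S₁ S₂ _ _ e₁ e₂ h h'
    obtain ⟨f, hf⟩ := exists_sumCongr_eq (e₁.symm.trans e₂) (by simp [h])
    obtain ⟨f', hf'⟩ := exists_sumCongr_eq f (by
      have h2 := congrArg (fun e => e (Sum.inl (Sum.inr 0))) hf
      simpa [h'] using h2.symm)
    rw [← hF f', ← hf', ← hf, ← O.map_trans, self_trans_symm_trans]
  -- The value on the diagonal is a filler: only pairs of distinct flags are summed.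
  let Φ : S → S → V := fun s s' => if h : s' ≠ s then
    F _ (O.map (Equiv.sumCongr (split ⟨s', h⟩) (one _)) (O.map (split s) a)) else 0
  have hΦ : ∀ (s : S) (s' : {x // x ≠ s}), Φ s s' =
      F _ (O.map (Equiv.sumCongr (split s') (one _)) (O.map (split s) a)) := by
    intro s s'
    simp only [Φ]
    rw [dif_pos s'.2]
  have hΦ' : ∀ (s : S) (s' : {x // x ≠ s}), Φ s' s = F _ (O.map (rightComm _ (Fin 1) (Fin 1))
      (O.map (Equiv.sumCongr (split s') (one _)) (O.map (split s) a))) := by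
    intro s s'
    simp only [Φ]
    rw [dif_pos s'.2.symm, ← O.map_trans, ← O.map_trans, ← O.map_trans]
    exact key _ _ (by simp [rightComm]) (by simp [rightComm])
  simp only [← hΦ, ← hΦ']
  exact sum_ne_swap Φ

end PointedSums

end SModule

/-! ### Sums over finite index types -/

section Finsum

variable {k : Type v} [Field k] {A B V : Type*} [AddCommGroup A] [AddCommGroup B]
  [AddCommGroup V] [Module k A] [Module k B] [Module k V] {ι : Type*} [Finite ι]

theorem finsum_linear_apply (f : ι → A →ₗ[k] V) (a : A) : (∑ᶠ i, f i) a = ∑ᶠ i, f i a := by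
  cases nonempty_fintype ι
  simp [finsum_eq_sum_of_fintype]

theorem finsum_bilinear_apply (f : ι → A →ₗ[k] B →ₗ[k] V) (a : A) (b : B) :
    (∑ᶠ i, f i) a b = ∑ᶠ i, f i a b := by
  rw [finsum_linear_apply, finsum_linear_apply]

theorem map_finsum_linear (f : A →ₗ[k] V) (x : ι → A) : f (∑ᶠ i, x i) = ∑ᶠ i, f (x i) := by
  cases nonempty_fintype ι
  simp [finsum_eq_sum_of_fintype]

theorem map_finsum_left (f : A →ₗ[k] B →ₗ[k] V) (x : ι → A) (b : B) :
    f (∑ᶠ i, x i) b = ∑ᶠ i, f (x i) b := by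
  rw [map_finsum_linear, finsum_linear_apply]

theorem finsum_add_finite (x y : ι → A) : ∑ᶠ i, (x i + y i) = ∑ᶠ i, x i + ∑ᶠ i, y i :=
  finsum_add_distrib (Set.toFinite _) (Set.toFinite _)

theorem finsum_sub_finite (x y : ι → A) : ∑ᶠ i, (x i - y i) = ∑ᶠ i, x i - ∑ᶠ i, y i :=
  finsum_sub_distrib (Set.toFinite _) (Set.toFinite _)

theorem finsum_units_smul (s : ℤˣ) (x : ι → A) : ∑ᶠ i, s • x i = s • ∑ᶠ i, x i := by
  cases nonempty_fintype ι
  simp only [finsum_eq_sum_of_fintype, Finset.smul_sum]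

theorem finsum_mem_submodule (N : Submodule k A) {x : ι → A} (h : ∀ i, x i ∈ N) :
    ∑ᶠ i, x i ∈ N := by
  cases nonempty_fintype ι
  rw [finsum_eq_sum_of_fintype]
  exact sum_mem fun i _ => h i

theorem finsum_swap {κ : Type*} [Finite κ] (x : ι → κ → A) :
    ∑ᶠ (i) (j), x i j = ∑ᶠ (j) (i), x i j := by
  cases nonempty_fintype ι
  cases nonempty_fintype κ
  simp only [finsum_eq_sum_of_fintype]
  exact Finset.sum_comm

theorem finsum_reverse {κ μ : Type*} [Finite κ] [Finite μ] (x : ι → κ → μ → A) :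
    ∑ᶠ (i) (j) (l), x i j l = ∑ᶠ (l) (j) (i), x i j l := by
  rw [finsum_swap]
  simp only [finsum_swap (fun i l => x i _ l)]
  exact finsum_swap _

theorem finsum_rotate {κ μ : Type*} [Finite κ] [Finite μ] (x : ι → κ → μ → A) :
    ∑ᶠ (i) (j) (l), x i j l = ∑ᶠ (l) (i) (j), x i j l := by
  simp only [finsum_swap (fun j l => x _ j l)]
  exact finsum_swap _

end Finsum

/-! ### Odd operads with nc-multiplication -/

namespace OddNCMultOperad

variable {k : Type v} [Field k] (O : OddNCMultOperad.{u, v} k)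
variable {S T U : Type} [Finite S] [Finite T] [Finite U]

theorem exists_mul : ∃ mul : O.coinv →ₗ[k] O.coinv →ₗ[k] O.coinv,
    ∀ (S T : Type) [Finite S] [Finite T] (a : O.obj S) (b : O.obj T),
      mul (O.cls a) (O.cls b) = O.cls (O.box a b) :=
  O.exists_bilinear (fun S T _ _ => O.box.compr₂ O.cls) fun e f a b => by
    simp [O.box_map]

theorem cls_glue_map {S S' : Type} [Finite S] [Finite S'] (e : S ≃ S') (a : O.obj (S ⊕ Fin 1))
    (b : O.obj T) :
    O.cls (O.glue (O.map (Equiv.sumCongr e (one _)) a) b) = O.cls (O.glue a b) := by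
  have h := O.glue_map e (one T) a b
  rw [O.map_refl] at h
  rw [h, O.cls_map]

theorem bullet_map {S' T' : Type} [Finite S'] [Finite T'] (e : S ≃ S') (f : T ≃ T')
    (a : O.obj S) (b : O.obj T) : O.bullet (O.map e a) (O.map f b) = O.bullet a b := by
  have h := O.sum_pointed_map (F := fun S _ x => O.cls (O.glue x (O.map f b)))
    (fun e a => O.cls_glue_map e a _) e a
  refine h.trans (finsum_congr fun s => ?_)
  have h' := O.glue_map (one _) f (O.map (split s) a) b
  rw [one, Equiv.sumCongr_refl, O.map_refl] at h'
  rw [h', O.cls_map, comp]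

theorem exists_bul : ∃ bul : O.coinv →ₗ[k] O.coinv →ₗ[k] O.coinv,
    ∀ (S T : Type) [Finite S] [Finite T] (a : O.obj S) (b : O.obj T),
      bul (O.cls a) (O.cls b) = O.bullet a b := by
  obtain ⟨bul, h⟩ := O.exists_bilinear
    (fun S T _ _ => ∑ᶠ s, (O.glue ∘ₗ O.map (split s)).compr₂ O.cls) (fun e f a b => by
      simpa [finsum_bilinear_apply, bullet, comp] using O.bullet_map e f a b)
  refine ⟨bul, fun S T _ _ a b => ?_⟩
  rw [h, finsum_bilinear_apply]
  rfl

theorem bullet_mem {p q : ℤ} {a : O.obj S} {b : O.obj T} (ha : a ∈ O.deg S p)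
    (hb : b ∈ O.deg T q) : O.bullet a b ∈ O.coinvDeg (p + q - 1) :=
  finsum_mem_submodule _ fun _ => O.cls_mem (O.glue_deg (O.map_deg _ ha) hb)

/-- The element `c` goes either into a remaining input of `a`, beside `b`, or into an input of `b`.
-/
theorem bullet_glue (a : O.obj (S ⊕ Fin 1)) (b : O.obj T) (c : O.obj U) :
    O.bullet (O.glue a b) c =
      ∑ᶠ s : S, O.cls (O.glue (O.map (rightComm _ (Fin 1) T)
        (O.glue (O.map (Equiv.sumCongr (split s) (one _)) a) b)) c) +
      ∑ᶠ t : T, O.cls (O.glue (O.map (unassoc S _ (Fin 1)) (O.glue a (O.map (split t) b))) c) := by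
  refine (O.sum_pointed_sum (F := fun S _ x => O.cls (O.glue x c))
    (fun e a => O.cls_glue_map e a _) _).trans ?_
  congr 1
  · refine finsum_congr fun s => ?_
    have h := O.glue_map (split s) (one T) a b
    rw [O.map_refl] at h
    rw [← h]
  · refine finsum_congr fun t => ?_
    have h := O.glue_map (one S) (split t) a b
    rw [one, Equiv.sumCongr_refl, O.map_refl] at h
    rw [← h]

theorem bullet_box_left {q r : ℤ} (a : O.obj S) {b : O.obj T} {c : O.obj U} (hb : b ∈ O.deg T q)
    (hc : c ∈ O.deg U r) : O.bullet (O.box a b) c =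
      ∑ᶠ t, O.cls (O.box a (O.comp t b c)) +
      (q * (r - 1)).negOnePow • ∑ᶠ s, O.cls (O.box (O.comp s a c) b) := by
  refine (O.sum_pointed_sum (F := fun S _ x => O.cls (O.glue x c))
    (fun e a => O.cls_glue_map e a _) _).trans ?_
  rw [add_comm, ← finsum_units_smul]
  congr 1
  · refine finsum_congr fun t => ?_
    have h := O.box_map (one S) (split t) a b
    rw [O.map_refl] at h
    rw [← h, ← O.cls_map (Equiv.sumAssoc S _ U), O.box_glue_right]
    rfl
  · refine finsum_congr fun s => ?_
    have h := O.box_map (split s) (one T) a b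
    rw [O.map_refl] at h
    rw [← h, O.box_glue_left _ hb hc, map_units_smul_right, O.cls_map]
    rfl

theorem bullet_box_right {p q : ℤ} {a : O.obj S} {b : O.obj T} (c : O.obj U)
    (ha : a ∈ O.deg S p) (hb : b ∈ O.deg T q) : O.bullet a (O.box b c) =
      ∑ᶠ s, O.cls (O.box (O.comp s a b) c) +
      ((p - 1) * q).negOnePow • ∑ᶠ s, O.cls (O.box b (O.comp s a c)) := by
  rw [← finsum_units_smul, ← finsum_add_finite]
  refine finsum_congr fun s => ?_
  rw [comp, O.glue_box c (O.map_deg _ ha) hb, map_add, map_units_smul_right, O.cls_map, O.cls_map]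
  rfl

/-- The nested insertions, corrected by those of `c` into the inserted element `b`. -/
def nested (a : O.obj S) (b : O.obj T) (c : O.obj U) : O.coinv :=
  ∑ᶠ (s : S) (t : T), O.cls (O.glue (O.map (split s) a) (O.glue (O.map (split t) b) c) -
    O.map (Equiv.sumAssoc _ _ U) (O.glue (O.map (unassoc _ _ (Fin 1))
      (O.glue (O.map (split s) a) (O.map (split t) b))) c))

/-- The insertions into two different inputs of `a`. -/
def parallel (a : O.obj S) (b : O.obj T) (c : O.obj U) : O.coinv :=
  ∑ᶠ (s : S) (s' : {x // x ≠ s}), O.cls (O.glue (O.map (rightComm _ (Fin 1) T)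
    (O.glue (O.map (Equiv.sumCongr (split s') (one _)) (O.map (split s) a)) b)) c)

theorem nested_symm {p q : ℤ} {a : O.obj S} {b : O.obj T} (c : O.obj U) (ha : a ∈ O.deg S p)
    (hb : b ∈ O.deg T q) :
    O.nested a b c = ((p - 1) * (q - 1)).negOnePow • O.nested b a c := by
  rw [nested, nested, finsum_swap, ← finsum_units_smul]
  refine finsum_congr fun t => ?_
  rw [← finsum_units_smul]
  refine finsum_congr fun s => ?_
  rw [O.glue_nested c (O.map_deg _ ha) (O.map_deg _ hb), map_units_smul_right, O.cls_map]

theorem parallel_symm {q r : ℤ} (a : O.obj S) {b : O.obj T} {c : O.obj U} (hb : b ∈ O.deg T q)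
    (hc : c ∈ O.deg U r) :
    O.parallel a b c = ((q - 1) * (r - 1)).negOnePow • O.parallel a c b := by
  -- `glue_parallel` returns the two chosen inputs of `a` in the opposite order. The sum over
  -- ordered pairs of inputs does not notice this.
  have h := O.sum_pointed_swap (F := fun S _ x => O.cls (O.glue (O.map (rightComm S (Fin 1) U)
    (O.glue x c)) b)) (fun {S S'} _ _ e a => by
      have h := O.glue_map (Equiv.sumCongr e (one (Fin 1))) (one U) a c
      rw [O.map_refl] at h
      rw [h, ← O.map_trans, ← O.cls_glue_map (Equiv.sumCongr e (one U))
        (O.map (rightComm S (Fin 1) U) (O.glue a c)), ← O.map_trans, rightComm_natural]) a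
  rw [parallel, parallel, h, ← finsum_units_smul]
  refine finsum_congr fun s => ?_
  rw [← finsum_units_smul]
  refine finsum_congr fun s' => ?_
  rw [O.glue_parallel _ hb hc, map_units_smul_right, O.cls_map]

theorem exists_isGerstenhaber : ∃ mul br : O.coinv →ₗ[k] O.coinv →ₗ[k] O.coinv,
    (∀ (S T : Type) [Finite S] [Finite T] (a : O.obj S) (b : O.obj T),
      mul (O.cls a) (O.cls b) = O.cls (O.box a b)) ∧
    (∀ (S T : Type) [Finite S] [Finite T] (p q : ℤ) (a : O.obj S) (b : O.obj T),
      a ∈ O.deg S p → b ∈ O.deg T q →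
      br (O.cls a) (O.cls b) =
        O.bullet a b - ((p - 1) * (q - 1)).negOnePow • O.bullet b a) ∧
    IsGerstenhaber O.coinvDeg mul br := by
  obtain ⟨mul, hmul⟩ := O.exists_mul
  obtain ⟨bul, hbul⟩ := O.exists_bul
  obtain ⟨br, hbr⟩ := exists_commutator O.coinvDeg_isInternal bul
  have hg := O.generatesGrading
  have mul_mem : ∀ i j : O.Gen, mul (O.cls i.2.2.1) (O.cls j.2.2.1) ∈ O.coinvDeg (i.2.1 + j.2.1) :=
    fun i j => by
      rw [hmul]
      exact O.cls_mem (O.box_deg i.2.2.2 j.2.2.2)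
  have bul_mem : ∀ i j : O.Gen,
      bul (O.cls i.2.2.1) (O.cls j.2.2.1) ∈ O.coinvDeg (i.2.1 + j.2.1 - 1) :=
    fun i j => by
      rw [hbul]
      exact O.bullet_mem i.2.2.2 j.2.2.2
  refine ⟨mul, br, hmul, fun S T _ _ p q a b ha hb => ?_,
    hg.isGerstenhaber O.coinvDeg_isInternal mul_mem (hg.commutator_mem hbr bul_mem) ?_
      (hg.commutator_antisymm hbr)
      (hg.commutator_jacobi hbr bul_mem (fun i j l => O.nested i.2.2.1 j.2.2.1 l.2.2.1)
        (fun i j l => O.parallel i.2.2.1 j.2.2.1 l.2.2.1) ?_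
        (fun i j l => O.nested_symm _ i.2.2.2 j.2.2.2)
        (fun i j l => O.parallel_symm _ j.2.2.2 l.2.2.2))
      (hg.commutator_leibniz hbr mul_mem ?_ ?_)⟩
  · rw [hbr (O.cls_mem ha) (O.cls_mem hb), hbul, hbul]
  · intro i j l
    rw [hmul, hmul, hmul, hmul, ← O.box_assoc, O.cls_map]
  -- The expansion of `(a • b) • c` consists of the parallel insertions and of the successive ones;
  -- the latter are exactly what `nested` subtracts from `a • (b • c)`.
  · intro i j l
    rw [hbul, hbul, bullet, bullet, map_finsum_left, map_finsum_linear]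
    simp only [hbul, comp, bullet_glue, finsum_add_finite]
    rw [nested, parallel]
    simp only [map_sub, finsum_sub_finite, O.cls_map, bullet, comp]
    rw [finsum_swap]
    abel
  · intro i j l
    rw [hmul, hbul, O.bullet_box_right _ i.2.2.2 j.2.2.2, hbul, hbul, bullet, bullet,
      map_finsum_left, map_finsum_linear]
    simp only [hmul]
  · intro i j l
    rw [hmul, hbul, O.bullet_box_left _ j.2.2.2 l.2.2.2, hbul, hbul, bullet, bullet,
      map_finsum_left, map_finsum_linear]
    simp only [hmul]

end OddNCMultOperad

/-! ### Odd nc-cyclic operads -/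

namespace OddNCCyclicOperad

variable {k : Type v} [Field k] (O : OddNCCyclicOperad.{u, v} k)
variable {S T U S' T' : Type} [Finite S] [Finite T] [Finite U] [Finite S'] [Finite T']

theorem exists_mul : ∃ mul : O.coinv →ₗ[k] O.coinv →ₗ[k] O.coinv,
    ∀ (S T : Type) [Finite S] [Finite T] (a : O.obj S) (b : O.obj T),
      mul (O.cls a) (O.cls b) = O.cls (O.box a b) :=
  O.exists_bilinear (fun S T _ _ => O.box.compr₂ O.cls) fun e f a b => by
    simp [O.box_map]

theorem glue_map_left (e : S ≃ S') (a : O.obj (S ⊕ Fin 1)) (b : O.obj (T ⊕ Fin 1)) :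
    O.glue (O.map (Equiv.sumCongr e (one _)) a) b =
      O.map (Equiv.sumCongr e (one T)) (O.glue a b) := by
  have h := O.glue_map e (one T) a b
  rwa [one, one, Equiv.sumCongr_refl, O.map_refl] at h

theorem glue_map_right (f : T ≃ T') (a : O.obj (S ⊕ Fin 1)) (b : O.obj (T ⊕ Fin 1)) :
    O.glue a (O.map (Equiv.sumCongr f (one _)) b) =
      O.map (Equiv.sumCongr (one S) f) (O.glue a b) := by
  have h := O.glue_map (one S) f a b
  rwa [one, one, Equiv.sumCongr_refl, O.map_refl] at h

theorem cls_glue_map_left (e : S ≃ S') (a : O.obj (S ⊕ Fin 1)) (b : O.obj (T ⊕ Fin 1)) :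
    O.cls (O.glue (O.map (Equiv.sumCongr e (one _)) a) b) = O.cls (O.glue a b) := by
  rw [O.glue_map_left, O.cls_map]

theorem cls_glue_map_right (f : T ≃ T') (a : O.obj (S ⊕ Fin 1)) (b : O.obj (T ⊕ Fin 1)) :
    O.cls (O.glue a (O.map (Equiv.sumCongr f (one _)) b)) = O.cls (O.glue a b) := by
  rw [O.glue_map_right, O.cls_map]

theorem cls_glue_comm {p q : ℤ} {a : O.obj (S ⊕ Fin 1)} {b : O.obj (T ⊕ Fin 1)}
    (ha : a ∈ O.deg _ p) (hb : b ∈ O.deg _ q) :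
    O.cls (O.glue a b) = -(((p - 1) * (q - 1)).negOnePow • O.cls (O.glue b a)) := by
  rw [O.glue_comm ha hb, map_neg, map_units_smul_right, O.cls_map]

theorem odot_map (e : S ≃ S') (f : T ≃ T') (a : O.obj S) (b : O.obj T) :
    O.odot (O.map e a) (O.map f b) = O.odot a b := by
  refine (O.sum_pointed_map (F := fun S _ x => ∑ᶠ t, O.cls (O.glue x (O.map (split t) (O.map f b))))
    (fun e a => finsum_congr fun t => O.cls_glue_map_left e a _) e a).trans ?_
  exact finsum_congr fun s => O.sum_pointed_map
    (F := fun T _ y => O.cls (O.glue (O.map (split s) a) y)) (fun f b => O.cls_glue_map_right f _ b) f b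

theorem exists_br : ∃ br : O.coinv →ₗ[k] O.coinv →ₗ[k] O.coinv,
    ∀ (S T : Type) [Finite S] [Finite T] (a : O.obj S) (b : O.obj T),
      br (O.cls a) (O.cls b) = O.odot a b := by
  obtain ⟨br, h⟩ := O.exists_bilinear
    (fun S T _ _ => ∑ᶠ (s : S) (t : T), (O.glue.compl₁₂ (O.map (split s)) (O.map (split t))).compr₂
      O.cls) (fun e f a b => by
      simpa [finsum_bilinear_apply, odot, comp] using O.odot_map e f a b)
  refine ⟨br, fun S T _ _ a b => ?_⟩
  rw [h]
  simp only [finsum_bilinear_apply]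
  rfl

theorem odot_mem {p q : ℤ} {a : O.obj S} {b : O.obj T} (ha : a ∈ O.deg S p)
    (hb : b ∈ O.deg T q) : O.odot a b ∈ O.coinvDeg (p + q - 1) :=
  finsum_mem_submodule _ fun _ => finsum_mem_submodule _ fun _ =>
    O.cls_mem (O.glue_deg (O.map_deg _ ha) (O.map_deg _ hb))

theorem odot_antisymm {p q : ℤ} {a : O.obj S} {b : O.obj T} (ha : a ∈ O.deg S p)
    (hb : b ∈ O.deg T q) : O.odot a b = -(((p - 1) * (q - 1)).negOnePow • O.odot b a) := by
  rw [odot, odot, ← Units.neg_smul, finsum_swap, ← finsum_units_smul]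
  refine finsum_congr fun t => ?_
  rw [← finsum_units_smul]
  refine finsum_congr fun s => ?_
  rw [comp, comp, O.cls_glue_comm (O.map_deg _ ha) (O.map_deg _ hb), Units.neg_smul]

theorem odot_glue (a : O.obj S) (b : O.obj (T ⊕ Fin 1)) (c : O.obj (U ⊕ Fin 1)) :
    O.odot a (O.glue b c) =
      ∑ᶠ (s : S) (t : T), O.cls (O.glue (O.map (split s) a) (O.map (rightComm _ (Fin 1) U)
        (O.glue (O.map (Equiv.sumCongr (split t) (one _)) b) c))) +
      ∑ᶠ (s : S) (u : U), O.cls (O.glue (O.map (split s) a) (O.map (unassoc T _ (Fin 1))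
        (O.glue b (O.map (Equiv.sumCongr (split u) (one _)) c)))) := by
  rw [← finsum_add_finite]
  refine finsum_congr fun s => ?_
  refine (O.sum_pointed_sum (F := fun T _ y => O.cls (O.glue (O.map (split s) a) y))
    (fun f b => O.cls_glue_map_right f _ b) _).trans ?_
  simp only [O.glue_map_left, O.glue_map_right]

theorem odot_box {p q : ℤ} {a : O.obj S} {b : O.obj T} (c : O.obj U) (ha : a ∈ O.deg S p)
    (hb : b ∈ O.deg T q) : O.odot (O.box a b) c =
      ∑ᶠ (t : T) (u : U), O.cls (O.box a (O.comp t u b c)) +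
      (p * q).negOnePow • ∑ᶠ (s : S) (u : U), O.cls (O.box b (O.comp s u a c)) := by
  refine (O.sum_pointed_sum (F := fun S _ x => ∑ᶠ u, O.cls (O.glue x (O.map (split u) c)))
    (fun e a => finsum_congr fun u => O.cls_glue_map_left e a _) _).trans ?_
  rw [add_comm, ← finsum_units_smul]
  congr 1
  · refine finsum_congr fun t => finsum_congr fun u => ?_
    have h := O.box_map (one S) (split t) a b
    rw [O.map_refl] at h
    rw [← h, ← O.cls_map (Equiv.sumAssoc S _ _), O.box_glue]
    rfl
  · refine finsum_congr fun s => ?_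
    rw [← finsum_units_smul]
    refine finsum_congr fun u => ?_
    -- The axiom `box_glue` treats only a flag of the second factor, so the factors of `a ⊟ b` are
    -- exchanged first.
    have h := O.box_map (split s) (one T) a b
    rw [O.map_refl] at h
    rw [← h, O.box_comm (O.map_deg _ ha) hb, map_units_smul_right, map_units_smul_left,
      map_units_smul_right, ← O.map_trans, sumComm_trans_rightComm, O.map_trans,
      O.cls_glue_map_left, ← O.cls_map (Equiv.sumAssoc T _ _), O.box_glue]
    rfl

/-- The gluings of `a` and of `c` to two different flags of `b`. -/
def tripleGlue (a : O.obj S) (b : O.obj T) (c : O.obj U) : O.coinv :=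
  ∑ᶠ (s : S) (u : U) (t : T) (t' : {x // x ≠ t}), O.cls (O.glue (O.map (split s) a)
    (O.map (rightComm _ (Fin 1) _) (O.glue (O.map (Equiv.sumCongr (split t') (one _))
      (O.map (split t) b)) (O.map (split u) c))))

/-- A path read from its other end. `glue_assoc` moves the brackets, then `glue_comm` exchanges `c`
with the glued pair and `a` with `b`. The two minus signs cancel, and the shifted degree of the pair
is `(p - 1) + (q - 1)`, which gives the three products in the exponent. -/
theorem tripleGlue_symm {p q r : ℤ} {a : O.obj S} {b : O.obj T} {c : O.obj U}
    (ha : a ∈ O.deg S p) (hb : b ∈ O.deg T q) (hc : c ∈ O.deg U r) :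
    O.tripleGlue a b c = ((p - 1) * (q - 1) + (q - 1) * (r - 1) + (p - 1) * (r - 1)).negOnePow •
      O.tripleGlue c b a := by
  rw [tripleGlue, tripleGlue, finsum_swap, ← finsum_units_smul]
  refine finsum_congr fun u => ?_
  rw [← finsum_units_smul]
  refine finsum_congr fun s => ?_
  have h := O.sum_pointed_swap (F := fun T _ y => O.cls (O.glue (O.map (split u) c)
    (O.map (rightComm T (Fin 1) _) (O.glue y (O.map (split s) a))))) (fun e y => by
      rw [O.glue_map_left, ← O.map_trans, rightComm_natural, O.map_trans, O.cls_glue_map_right]) b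
  rw [h, ← finsum_units_smul]
  refine finsum_congr fun t => ?_
  rw [← finsum_units_smul]
  refine finsum_congr fun t' => ?_
  generalize hy : O.map (Equiv.sumCongr (split t') (one _)) (O.map (split t) b) = y
  have hy' : O.map (rightComm _ (Fin 1) (Fin 1)) y ∈ O.deg _ q :=
    O.map_deg _ (hy ▸ O.map_deg _ (O.map_deg _ hb))
  -- A double exchange of the two marked flags of `b` is inserted to reach the form of the right
  -- side of `glue_assoc`.
  have hyy : y = O.map (rightComm _ (Fin 1) (Fin 1)) (O.map (rightComm _ (Fin 1) (Fin 1)) y) := by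
    rw [← O.map_trans, rightComm_trans_rightComm, O.map_refl]
  conv_lhs => rw [hyy]
  rw [← O.glue_assoc, O.cls_map, O.cls_glue_comm (O.map_deg _ (O.glue_deg (O.map_deg _ ha) hy'))
    (O.map_deg _ hc), O.glue_comm (O.map_deg _ ha) hy', map_neg, map_units_smul_right,
    ← O.map_trans, sumComm_trans_unassoc, O.map_trans, map_neg, map_neg, map_units_smul_right,
    map_units_smul_right, O.cls_glue_map_right, smul_neg, neg_neg, smul_smul,
    ← Int.negOnePow_add]
  congr 2
  ring

/-- The element `a` is attached either to `b` or to `c`. In the second case `glue_comm` turns the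
edge between `b` and `c` around, which presents the graph as a path with `c` in the middle and costs
the sign. -/
theorem sum_odot_glue {q r : ℤ} (a : O.obj S) {b : O.obj T} {c : O.obj U}
    (hb : b ∈ O.deg T q) (hc : c ∈ O.deg U r) :
    ∑ᶠ (t : T) (u : U), O.odot a (O.comp t u b c) =
      O.tripleGlue a b c - ((q - 1) * (r - 1)).negOnePow • O.tripleGlue a c b := by
  have h : ∀ (s : S) (t : T) (u : U) (u' : {x // x ≠ u}),
      O.cls (O.glue (O.map (split s) a) (O.map (unassoc _ _ (Fin 1)) (O.glue (O.map (split t) b)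
        (O.map (Equiv.sumCongr (split u') (one _)) (O.map (split u) c))))) =
      -(((q - 1) * (r - 1)).negOnePow • O.cls (O.glue (O.map (split s) a)
        (O.map (rightComm _ (Fin 1) _) (O.glue (O.map (Equiv.sumCongr (split u') (one _))
          (O.map (split u) c)) (O.map (split t) b))))) := by
    intro s t u u'
    rw [O.glue_comm (O.map_deg _ hb) (O.map_deg _ (O.map_deg _ hc)), map_neg, map_units_smul_right,
      ← O.map_trans, sumComm_trans_unassoc, O.map_trans, map_neg, map_neg, map_units_smul_right,
      map_units_smul_right, O.cls_glue_map_right]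
  simp only [comp, odot_glue, h, finsum_add_finite, finsum_neg_distrib, finsum_units_smul]
  rw [tripleGlue, tripleGlue, ← sub_eq_add_neg]
  exact congrArg₂ _ (finsum_reverse _) (congrArg _ (finsum_rotate _))

theorem exists_isGerstenhaber : ∃ mul br : O.coinv →ₗ[k] O.coinv →ₗ[k] O.coinv,
    (∀ (S T : Type) [Finite S] [Finite T] (a : O.obj S) (b : O.obj T),
      mul (O.cls a) (O.cls b) = O.cls (O.box a b)) ∧
    (∀ (S T : Type) [Finite S] [Finite T] (a : O.obj S) (b : O.obj T),
      br (O.cls a) (O.cls b) = O.odot a b) ∧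
    IsGerstenhaber O.coinvDeg mul br ∧ IsGradedComm O.coinvDeg mul := by
  obtain ⟨mul, hmul⟩ := O.exists_mul
  obtain ⟨br, hbr⟩ := O.exists_br
  have hg := O.generatesGrading
  have mul_mem : ∀ i j : O.Gen, mul (O.cls i.2.2.1) (O.cls j.2.2.1) ∈ O.coinvDeg (i.2.1 + j.2.1) :=
    fun i j => by
      rw [hmul]
      exact O.cls_mem (O.box_deg i.2.2.2 j.2.2.2)
  have br_mem : ∀ i j : O.Gen,
      br (O.cls i.2.2.1) (O.cls j.2.2.1) ∈ O.coinvDeg (i.2.1 + j.2.1 - 1) :=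
    fun i j => by
      rw [hbr]
      exact O.odot_mem i.2.2.2 j.2.2.2
  have antisymm : ∀ i j : O.Gen, br (O.cls i.2.2.1) (O.cls j.2.2.1) =
      -(((i.2.1 - 1) * (j.2.1 - 1)).negOnePow • br (O.cls j.2.2.1) (O.cls i.2.2.1)) :=
    fun i j => by
      rw [hbr, hbr]
      exact O.odot_antisymm i.2.2.2 j.2.2.2
  have comm : IsGradedComm O.coinvDeg mul := hg.isGradedComm fun i j => by
    rw [hmul, hmul, O.box_comm i.2.2.2 j.2.2.2, map_units_smul_right, O.cls_map]
  refine ⟨mul, br, hmul, hbr, hg.isGerstenhaber O.coinvDeg_isInternal mul_mem br_mem ?_ antisymm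
    (jacobi_of_reversal (fun i j l => O.tripleGlue i.2.2.1 j.2.2.1 l.2.2.1) ?_
      fun i j l => O.tripleGlue_symm i.2.2.2 j.2.2.2 l.2.2.2)
    (hg.leibniz_of_comm comm mul_mem br_mem antisymm ?_), comm⟩
  · intro i j l
    rw [hmul, hmul, hmul, hmul, ← O.box_assoc, O.cls_map]
  · intro i j l
    rw [hbr, odot]
    simp only [map_finsum_linear, hbr]
    exact O.sum_odot_glue _ j.2.2.2 l.2.2.2
  · intro i j l
    rw [hmul, hbr, O.odot_box _ i.2.2.2 j.2.2.2, hbr, hbr, odot, odot]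
    simp only [map_finsum_linear, hmul]

end OddNCCyclicOperad

/-! ### Graded `𝕊`-bimodules -/

namespace SBimodule

variable {k : Type v} [Field k] (O : SBimodule.{u, v} k)
variable {I J I' J' I'' J'' : Type} [Finite I] [Finite J] [Finite I'] [Finite J'] [Finite I'']
  [Finite J'']

theorem map_map (e : I ≃ I') (f : J ≃ J') (e' : I' ≃ I'') (f' : J' ≃ J'') (a : O.obj I J) :
    O.map e' f' (O.map e f a) = O.map (e.trans e') (f.trans f') a :=
  (O.map_trans e f e' f' a).symm

/-- The `𝕊`-module of the inputs, for a fixed set of outputs. -/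
abbrev inputs (J : Type) [Finite J] : SModule.{u, v} k where
  obj I _ := O.obj I J
  deg I _ := O.deg I J
  graded I _ := O.graded I J
  map e := O.map e (one J)
  map_deg e _ _ ha := O.map_deg e (one J) ha
  map_refl a := O.map_refl a
  map_trans e f a := O.map_trans e (one J) f (one J) a

/-- The `𝕊`-module of the outputs, for a fixed set of inputs. -/
abbrev outputs (I : Type) [Finite I] : SModule.{u, v} k where
  obj J _ := O.obj I J
  deg J _ := O.deg I J
  graded J _ := O.graded I J
  map f := O.map (one I) f
  map_deg f _ _ ha := O.map_deg (one I) f ha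
  map_refl a := O.map_refl a
  map_trans e f a := O.map_trans (one I) e (one I) f a

/-- The class of an element with standard sets of inputs and outputs. -/
abbrev stdCls (n m : ℕ) : O.obj (Fin n) (Fin m) →ₗ[k] O.coinv :=
  Coinv.mk k (fun x : ℕ × ℕ => O.obj (Fin x.1) (Fin x.2)) (fun x y => Set.range
    fun e : (Fin x.1 ≃ Fin y.1) × (Fin x.2 ≃ Fin y.2) => O.map e.1 e.2) (n, m)

/-- Here too the enumerations chosen inside `cls` are immaterial, now for inputs and outputs
independently. -/
theorem cls_eq_stdCls (n m : ℕ) (e : I ≃ Fin n) (f : J ≃ Fin m) (a : O.obj I J) :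
    O.cls a = O.stdCls n m (O.map e f a) := by
  have h : O.stdCls n m (O.map ((Finite.equivFin I).symm.trans e) ((Finite.equivFin J).symm.trans f)
        (O.map (Finite.equivFin I) (Finite.equivFin J) a)) =
      O.stdCls _ _ (O.map (Finite.equivFin I) (Finite.equivFin J) a) :=
    Coinv.mk_rel (k := k) (M := fun x : ℕ × ℕ => O.obj (Fin x.1) (Fin x.2))
      (rel := fun x y => Set.range
        fun e : (Fin x.1 ≃ Fin y.1) × (Fin x.2 ≃ Fin y.2) => O.map e.1 e.2)
      (x := (Nat.card I, Nat.card J)) (y := (n, m))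
      (φ := O.map ((Finite.equivFin I).symm.trans e) ((Finite.equivFin J).symm.trans f))
      ⟨((Finite.equivFin I).symm.trans e, (Finite.equivFin J).symm.trans f), rfl⟩ _
  rw [← O.map_trans, self_trans_symm_trans, self_trans_symm_trans] at h
  exact h.symm

@[simp]
theorem cls_map (e : I ≃ I') (f : J ≃ J') (a : O.obj I J) : O.cls (O.map e f a) = O.cls a := by
  rw [O.cls_eq_stdCls _ _ (Finite.equivFin I') (Finite.equivFin J'),
    O.cls_eq_stdCls _ _ (e.trans (Finite.equivFin I')) (f.trans (Finite.equivFin J')), O.map_trans]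

theorem cls_mem {p : ℤ} {a : O.obj I J} (ha : a ∈ O.deg I J p) : O.cls a ∈ O.coinvDeg p :=
  Coinv.mk_mem_deg (𝒢 := fun x : ℕ × ℕ => O.deg (Fin x.1) (Fin x.2))
    (x := (Nat.card I, Nat.card J)) (O.map_deg _ _ ha)

theorem coinvDeg_isInternal : DirectSum.IsInternal O.coinvDeg := by
  refine Coinv.deg_isInternal (fun x => O.graded (Fin x.1) (Fin x.2)) ?_
  rintro x y _ ⟨e, rfl⟩ d a ha
  exact O.map_deg e.1 e.2 ha

/-- Homogeneous elements with standard sets of inputs and outputs. -/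
abbrev Gen : Type u := Σ (x : ℕ × ℕ) (p : ℤ), O.deg (Fin x.1) (Fin x.2) p

theorem generatesGrading :
    GeneratesGrading O.coinvDeg (fun i : O.Gen => O.cls i.2.2.1) (fun i => i.2.1) where
  mem i := O.cls_mem i.2.2.2
  closure p a ha := by
    refine Coinv.deg_induction
      (p := fun a => a ∈ AddSubmonoid.closure {x | ∃ i : O.Gen, i.2.1 = p ∧ O.cls i.2.2.1 = x})
      (zero_mem _) (fun a b => add_mem) (fun x a ha => ?_) ha
    refine AddSubmonoid.subset_closure ⟨⟨x, p, a, ha⟩, rfl, ?_⟩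
    rw [O.cls_eq_stdCls x.1 x.2 (Equiv.refl _) (Equiv.refl _), O.map_refl]

theorem exists_bilinear {V : Type*} [AddCommGroup V] [Module k V]
    (B : ∀ (I J K L : Type) [Finite I] [Finite J] [Finite K] [Finite L],
      O.obj I J →ₗ[k] O.obj K L →ₗ[k] V)
    (hB : ∀ {I J K L I' J' K' L' : Type} [Finite I] [Finite J] [Finite K] [Finite L] [Finite I']
      [Finite J'] [Finite K'] [Finite L'] (e : I ≃ I') (f : J ≃ J') (g : K ≃ K') (h : L ≃ L')
      (a : O.obj I J) (b : O.obj K L),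
      B I' J' K' L' (O.map e f a) (O.map g h b) = B I J K L a b) :
    ∃ F : O.coinv →ₗ[k] O.coinv →ₗ[k] V, ∀ (I J K L : Type) [Finite I] [Finite J] [Finite K]
      [Finite L] (a : O.obj I J) (b : O.obj K L), F (O.cls a) (O.cls b) = B I J K L a b := by
  obtain ⟨F, hF⟩ := Coinv.exists_lift₂ (k := k) (M := fun x : ℕ × ℕ => O.obj (Fin x.1) (Fin x.2))
    (rel := fun x y => Set.range
      fun e : (Fin x.1 ≃ Fin y.1) × (Fin x.2 ≃ Fin y.2) => O.map e.1 e.2)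
    (fun x y => B (Fin x.1) (Fin x.2) (Fin y.1) (Fin y.2))
    (by
      rintro x y _ ⟨e, rfl⟩ l a b
      simpa [O.map_refl] using hB e.1 e.2 (Equiv.refl _) (Equiv.refl _) a b)
    (by
      rintro x y _ ⟨e, rfl⟩ l a b
      simpa [O.map_refl] using hB (Equiv.refl _) (Equiv.refl _) e.1 e.2 a b)
  refine ⟨F, fun I J K L _ _ _ _ a b => ?_⟩
  rw [O.cls_eq_stdCls _ _ (Finite.equivFin I) (Finite.equivFin J),
    O.cls_eq_stdCls _ _ (Finite.equivFin K) (Finite.equivFin L)]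
  exact (hF (_, _) (_, _) _ _).trans (hB _ _ _ _ _ _)

end SBimodule

/-! ### Odd nc-dioperads -/

namespace OddNCDioperad

variable {k : Type v} [Field k] (O : OddNCDioperad.{u, v} k)
variable {I J K L M N I' J' K' L' : Type} [Finite I] [Finite J] [Finite K] [Finite L] [Finite M]
  [Finite N] [Finite I'] [Finite J'] [Finite K'] [Finite L']

theorem exists_mul : ∃ mul : O.coinv →ₗ[k] O.coinv →ₗ[k] O.coinv,
    ∀ (I J K L : Type) [Finite I] [Finite J] [Finite K] [Finite L] (a : O.obj I J) (b : O.obj K L),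
      mul (O.cls a) (O.cls b) = O.cls (O.box a b) :=
  O.exists_bilinear (fun I J K L _ _ _ _ => O.box.compr₂ O.cls) fun e f g h a b => by
    simp [O.box_map]

theorem glue_map_left (e : I ≃ I') (f : J ≃ J') (a : O.obj (I ⊕ Fin 1) J)
    (b : O.obj K (L ⊕ Fin 1)) :
    O.glue (O.map (Equiv.sumCongr e (one _)) f a) b =
      O.map (Equiv.sumCongr e (one K)) (Equiv.sumCongr f (one L)) (O.glue a b) := by
  have h := O.glue_map e f (one K) (one L) a b
  rwa [one, one, one, Equiv.sumCongr_refl, O.map_refl] at h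

theorem glue_map_right (g : K ≃ K') (h : L ≃ L') (a : O.obj (I ⊕ Fin 1) J)
    (b : O.obj K (L ⊕ Fin 1)) :
    O.glue a (O.map g (Equiv.sumCongr h (one _)) b) =
      O.map (Equiv.sumCongr (one I) g) (Equiv.sumCongr (one J) h) (O.glue a b) := by
  have h := O.glue_map (one I) (one J) g h a b
  rwa [one, one, one, Equiv.sumCongr_refl, O.map_refl] at h

theorem glue_map_inputs_left (e : I ≃ I') (a : O.obj (I ⊕ Fin 1) J) (b : O.obj K (L ⊕ Fin 1)) :
    O.glue (O.map (Equiv.sumCongr e (one _)) (one J) a) b =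
      O.map (Equiv.sumCongr e (one K)) (one (J ⊕ L)) (O.glue a b) := by
  rw [O.glue_map_left, one, one, one, one, Equiv.sumCongr_refl]

theorem glue_map_outputs_left (f : J ≃ J') (a : O.obj (I ⊕ Fin 1) J) (b : O.obj K (L ⊕ Fin 1)) :
    O.glue (O.map (one (I ⊕ Fin 1)) f a) b =
      O.map (one (I ⊕ K)) (Equiv.sumCongr f (one L)) (O.glue a b) := by
  have h := O.glue_map_left (one I) f a b
  rwa [one, one, one, Equiv.sumCongr_refl, Equiv.sumCongr_refl] at h

theorem glue_map_inputs_right (g : K ≃ K') (a : O.obj (I ⊕ Fin 1) J) (b : O.obj K (L ⊕ Fin 1)) :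
    O.glue a (O.map g (one (L ⊕ Fin 1)) b) =
      O.map (Equiv.sumCongr (one I) g) (one (J ⊕ L)) (O.glue a b) := by
  have h := O.glue_map_right g (one L) a b
  rwa [one, one, one, one, Equiv.sumCongr_refl, Equiv.sumCongr_refl] at h

theorem glue_map_outputs_right (h : L ≃ L') (a : O.obj (I ⊕ Fin 1) J) (b : O.obj K (L ⊕ Fin 1)) :
    O.glue a (O.map (one K) (Equiv.sumCongr h (one _)) b) =
      O.map (one (I ⊕ K)) (Equiv.sumCongr (one J) h) (O.glue a b) := by
  rw [O.glue_map_right, one, one, one, one, Equiv.sumCongr_refl]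

theorem cls_glue_map_left (e : I ≃ I') (f : J ≃ J') (a : O.obj (I ⊕ Fin 1) J)
    (b : O.obj K (L ⊕ Fin 1)) :
    O.cls (O.glue (O.map (Equiv.sumCongr e (one _)) f a) b) = O.cls (O.glue a b) := by
  rw [O.glue_map_left, O.cls_map]

theorem cls_glue_map_right (g : K ≃ K') (h : L ≃ L') (a : O.obj (I ⊕ Fin 1) J)
    (b : O.obj K (L ⊕ Fin 1)) :
    O.cls (O.glue a (O.map g (Equiv.sumCongr h (one _)) b)) = O.cls (O.glue a b) := by
  rw [O.glue_map_right, O.cls_map]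

theorem bullet_map (e : I ≃ I') (f : J ≃ J') (g : K ≃ K') (h : L ≃ L') (a : O.obj I J)
    (b : O.obj K L) : O.bullet (O.map e f a) (O.map g h b) = O.bullet a b := by
  -- Each relabelling is factored into one of inputs and one of outputs, so that the one-sided
  -- results for `inputs` and `outputs` apply.
  have h₁ : O.map e f a = O.map e (one J') (O.map (one I) f a) := by
    rw [O.map_map]; rfl
  have h₂ : O.map g h b = O.map (one K') h (O.map g (one L) b) := by
    rw [O.map_map]; rfl
  rw [h₁, h₂]
  refine ((O.inputs J').sum_pointed_map (F := fun I _ x => ∑ᶠ l, O.cls (O.glue x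
    (O.map (one K') (split l) (O.map (one K') h (O.map g (one L) b)))))
    (fun e a => finsum_congr fun t => O.cls_glue_map_left e _ a _) e (O.map (one I) f a)).trans ?_
  refine finsum_congr fun i => ((O.outputs K').sum_pointed_map (F := fun L _ y => O.cls
    (O.glue (O.map (split i) (one J') (O.map (one I) f a)) y))
    (fun h b => O.cls_glue_map_right _ h _ b) h (O.map g (one L) b)).trans ?_
  refine finsum_congr fun l => ?_
  have h₃ : O.map (split i) (one J') (O.map (one I) f a) =
      O.map (one _) f (O.map (split i) (one J) a) := by
    rw [O.map_map, O.map_map]; rfl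
  have h₄ : O.map (one K') (split l) (O.map g (one L) b) =
      O.map g (one _) (O.map (one K) (split l) b) := by
    rw [O.map_map, O.map_map]; rfl
  rw [h₃, h₄, O.glue_map_outputs_left, O.glue_map_inputs_right, O.cls_map, O.cls_map]
  rfl

theorem exists_bul : ∃ bul : O.coinv →ₗ[k] O.coinv →ₗ[k] O.coinv,
    ∀ (I J K L : Type) [Finite I] [Finite J] [Finite K] [Finite L] (a : O.obj I J) (b : O.obj K L),
      bul (O.cls a) (O.cls b) = O.bullet a b := by
  obtain ⟨bul, h⟩ := O.exists_bilinear
    (fun I J K L _ _ _ _ => ∑ᶠ (i : I) (l : L),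
      (O.glue.compl₁₂ (O.map (split i) (one J)) (O.map (one K) (split l))).compr₂ O.cls)
    (fun e f g h a b => by
      simpa [finsum_bilinear_apply, bullet, comp] using O.bullet_map e f g h a b)
  refine ⟨bul, fun I J K L _ _ _ _ a b => ?_⟩
  rw [h]
  simp only [finsum_bilinear_apply]
  rfl

theorem bullet_mem {p q : ℤ} {a : O.obj I J} {b : O.obj K L} (ha : a ∈ O.deg I J p)
    (hb : b ∈ O.deg K L q) : O.bullet a b ∈ O.coinvDeg (p + q - 1) :=
  finsum_mem_submodule _ fun _ => finsum_mem_submodule _ fun _ =>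
    O.cls_mem (O.glue_deg (O.map_deg _ _ ha) (O.map_deg _ _ hb))

theorem bullet_glue_left (a : O.obj (I ⊕ Fin 1) J) (b : O.obj K (L ⊕ Fin 1)) (c : O.obj M N) :
    O.bullet (O.glue a b) c =
      ∑ᶠ (i : I) (n : N), O.cls (O.glue (O.map (rightComm _ (Fin 1) K) (one _)
        (O.glue (O.map (Equiv.sumCongr (split i) (one _)) (one J) a) b))
        (O.map (one M) (split n) c)) +
      ∑ᶠ (x : K) (n : N), O.cls (O.glue (O.map (unassoc I _ (Fin 1)) (one _)
        (O.glue a (O.map (split x) (one _) b))) (O.map (one M) (split n) c)) := by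
  refine ((O.inputs (J ⊕ L)).sum_pointed_sum (F := fun I _ x => ∑ᶠ n, O.cls (O.glue x
    (O.map (one M) (split n) c)))
    (fun e a => finsum_congr fun t => O.cls_glue_map_left e _ a _) _).trans ?_
  simp only [O.glue_map_inputs_left, O.glue_map_inputs_right]

theorem bullet_glue_right (a : O.obj I J) (b : O.obj (K ⊕ Fin 1) L) (c : O.obj M (N ⊕ Fin 1)) :
    O.bullet a (O.glue b c) =
      ∑ᶠ (i : I) (l : L), O.cls (O.glue (O.map (split i) (one J) a)
        (O.map (one _) (rightComm _ (Fin 1) N) (O.glue (O.map (one _) (split l) b) c))) +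
      ∑ᶠ (i : I) (n : N), O.cls (O.glue (O.map (split i) (one J) a)
        (O.map (one _) (unassoc L _ (Fin 1))
          (O.glue b (O.map (one M) (Equiv.sumCongr (split n) (one _)) c)))) := by
  rw [← finsum_add_finite]
  refine finsum_congr fun i => ?_
  refine ((O.outputs (K ⊕ M)).sum_pointed_sum (F := fun L _ y => O.cls (O.glue
    (O.map (split i) (one J) a) y)) (fun h b => O.cls_glue_map_right _ h _ b) _).trans ?_
  simp only [O.glue_map_outputs_left, O.glue_map_outputs_right]

theorem bullet_box_left {p q : ℤ} {a : O.obj I J} {b : O.obj K L} (c : O.obj M N)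
    (ha : a ∈ O.deg I J p) (hb : b ∈ O.deg K L q) : O.bullet (O.box a b) c =
      ∑ᶠ (x : K) (n : N), O.cls (O.box a (O.comp x n b c)) +
      (p * q).negOnePow • ∑ᶠ (i : I) (n : N), O.cls (O.box b (O.comp i n a c)) := by
  refine ((O.inputs (J ⊕ L)).sum_pointed_sum (F := fun I _ x => ∑ᶠ n, O.cls (O.glue x
    (O.map (one M) (split n) c)))
    (fun e a => finsum_congr fun t => O.cls_glue_map_left e _ a _) _).trans ?_
  rw [add_comm, ← finsum_units_smul]
  congr 1
  · refine finsum_congr fun x => finsum_congr fun n => ?_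
    have h := O.box_map (one I) (one J) (split x) (one L) a b
    rw [O.map_refl, one, one, one, Equiv.sumCongr_refl] at h
    dsimp only
    rw [← h, ← O.cls_map (Equiv.sumAssoc I _ _) (Equiv.sumAssoc J _ _), O.box_glue]
    rfl
  · refine finsum_congr fun i => ?_
    rw [← finsum_units_smul]
    refine finsum_congr fun n => ?_
    -- An input of the first factor is brought into the second factor by `box_comm`, where
    -- `box_glue` applies.
    have h := O.box_map (split i) (one J) (one K) (one L) a b
    rw [O.map_refl, one, one, one, Equiv.sumCongr_refl] at h
    dsimp only
    rw [← h, O.box_comm (O.map_deg _ _ ha) hb, map_units_smul_right, map_units_smul_left,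
      map_units_smul_right, O.map_map, sumComm_trans_rightComm, Equiv.trans_refl,
      ← Equiv.refl_trans (Equiv.sumComm L J), O.map_trans,
      O.cls_glue_map_left, ← O.cls_map (Equiv.sumAssoc K _ _) (Equiv.sumAssoc L _ _), O.box_glue]
    rfl

theorem bullet_box_right {q r : ℤ} (a : O.obj I J) {b : O.obj K L} {c : O.obj M N}
    (hb : b ∈ O.deg K L q) (hc : c ∈ O.deg M N r) : O.bullet a (O.box b c) =
      ∑ᶠ (i : I) (l : L), O.cls (O.box (O.comp i l a b) c) +
      (q * r).negOnePow • ∑ᶠ (i : I) (n : N), O.cls (O.box (O.comp i n a c) b) := by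
  rw [← finsum_units_smul, ← finsum_add_finite]
  refine finsum_congr fun i => ?_
  refine ((O.outputs (K ⊕ M)).sum_pointed_sum (F := fun L _ y => O.cls (O.glue
    (O.map (split i) (one J) a) y)) (fun h b => O.cls_glue_map_right _ h _ b) _).trans ?_
  rw [← finsum_units_smul]
  congr 1
  · refine finsum_congr fun l => ?_
    have h := O.box_map (one K) (split l) (one M) (one N) b c
    rw [O.map_refl, one, one, one, Equiv.sumCongr_refl] at h
    dsimp only
    rw [← h, ← O.glue_box, O.cls_map]
    rfl
  · refine finsum_congr fun n => ?_
    have h := O.box_map (one K) (one L) (one M) (split n) b c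
    rw [O.map_refl, one, one, one, Equiv.sumCongr_refl] at h
    dsimp only
    rw [← h, O.box_comm hb (O.map_deg _ _ hc), map_units_smul_right, map_units_smul_right,
      map_units_smul_right, O.map_map, sumComm_trans_unassoc, Equiv.trans_refl,
      ← Equiv.refl_trans (Equiv.sumComm M K), O.map_trans,
      O.cls_glue_map_right, ← O.glue_box, O.cls_map]
    rfl

/-- The gluings of `a` and of `b` to two different outputs of `c`. -/
def outputGlue (a : O.obj I J) (b : O.obj K L) (c : O.obj M N) : O.coinv :=
  ∑ᶠ (i : I) (x : K) (n : N) (n' : {y // y ≠ n}), O.cls (O.glue (O.map (split i) (one J) a)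
    (O.map (one _) (unassoc L _ (Fin 1)) (O.glue (O.map (split x) (one L) b)
      (O.map (one M) (Equiv.sumCongr (split n') (one _)) (O.map (one M) (split n) c)))))

/-- The gluings of `b` and of `c` to two different inputs of `a`. -/
def inputGlue (a : O.obj I J) (b : O.obj K L) (c : O.obj M N) : O.coinv :=
  ∑ᶠ (l : L) (n : N) (i : I) (i' : {y // y ≠ i}), O.cls (O.glue
    (O.map (rightComm _ (Fin 1) K) (one _) (O.glue (O.map (Equiv.sumCongr (split i') (one _)) (one J)
      (O.map (split i) (one J) a)) (O.map (one K) (split l) b))) (O.map (one M) (split n) c))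

theorem outputGlue_symm {p q : ℤ} {a : O.obj I J} {b : O.obj K L} (c : O.obj M N)
    (ha : a ∈ O.deg I J p) (hb : b ∈ O.deg K L q) :
    O.outputGlue a b c = ((p - 1) * (q - 1)).negOnePow • O.outputGlue b a c := by
  rw [outputGlue, outputGlue, finsum_swap, ← finsum_units_smul]
  refine finsum_congr fun x => ?_
  rw [← finsum_units_smul]
  refine finsum_congr fun i => ?_
  -- `glue_outputs` exchanges the roles of the two chosen outputs of `c`; summing over ordered pairs
  -- of outputs absorbs this.
  have h := (O.outputs M).sum_pointed_swap (F := fun N _ y => O.cls (O.glue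
    (O.map (split x) (one L) b) (O.map (one _) (unassoc J _ (Fin 1))
      (O.glue (O.map (split i) (one J) a) y)))) (fun {N N'} _ _ e y => by
      dsimp only
      rw [O.glue_map_outputs_right, O.map_map, unassoc_natural, O.map_trans,
        O.cls_glue_map_right]) c
  dsimp only at h
  rw [h, ← finsum_units_smul]
  refine finsum_congr fun n => ?_
  rw [← finsum_units_smul]
  refine finsum_congr fun n' => ?_
  rw [O.glue_outputs _ (O.map_deg _ _ ha) (O.map_deg _ _ hb), map_units_smul_right, O.cls_map]

theorem inputGlue_symm {q r : ℤ} (a : O.obj I J) {b : O.obj K L} {c : O.obj M N}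
    (hb : b ∈ O.deg K L q) (hc : c ∈ O.deg M N r) :
    O.inputGlue a b c = ((q - 1) * (r - 1)).negOnePow • O.inputGlue a c b := by
  rw [inputGlue, inputGlue, finsum_swap, ← finsum_units_smul]
  refine finsum_congr fun n => ?_
  rw [← finsum_units_smul]
  refine finsum_congr fun l => ?_
  have h := (O.inputs J).sum_pointed_swap (F := fun I _ y => O.cls (O.glue
    (O.map (rightComm _ (Fin 1) M) (one _) (O.glue y (O.map (one M) (split n) c)))
      (O.map (one K) (split l) b))) (fun {N N'} _ _ e y => by
      dsimp only
      rw [O.glue_map_inputs_left, O.map_map, rightComm_natural, O.map_trans,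
        O.cls_glue_map_left]) a
  dsimp only at h
  rw [h, ← finsum_units_smul]
  refine finsum_congr fun i => ?_
  rw [← finsum_units_smul]
  refine finsum_congr fun i' => ?_
  rw [O.glue_inputs _ (O.map_deg _ _ hb) (O.map_deg _ _ hc), map_units_smul_right, O.cls_map]

/-- In `a • (b • c)` the output glued to `a` belongs to `b`, which gives a chain, or to `c`. In `(a
• b) • c` the input receiving `c` belongs to `b`, again a chain, or to `a`. The chains agree by
`glue_chain`. -/
theorem sum_bullet_assoc (a : O.obj I J) (b : O.obj K L) (c : O.obj M N) :
    ∑ᶠ (x : K) (n : N), O.bullet a (O.comp x n b c) =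
      ∑ᶠ (i : I) (l : L), O.bullet (O.comp i l a b) c + O.outputGlue a b c
        - O.inputGlue a b c := by
  have h : ∀ (i : I) (l : L) (x : K) (n : N), O.cls (O.glue (O.map (unassoc _ _ (Fin 1)) (one _)
      (O.glue (O.map (split i) (one J) a) (O.map (split x) (one _) (O.map (one K) (split l) b))))
        (O.map (one M) (split n) c)) =
      O.cls (O.glue (O.map (split i) (one J) a) (O.map (one _) (rightComm _ (Fin 1) _)
        (O.glue (O.map (one _) (split l) (O.map (split x) (one L) b))
          (O.map (one M) (split n) c)))) := by
    intro i l x n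
    have h' : O.map (split x) (one _) (O.map (one K) (split l) b) =
        O.map (one _) (split l) (O.map (split x) (one L) b) := by
      rw [O.map_map, O.map_map]; rfl
    rw [h', ← O.glue_chain, O.cls_map]
  simp only [comp, bullet_glue_left, bullet_glue_right, h, finsum_add_finite]
  -- From here on only the order of the summations has to be adjusted.
  have h₁ : ∀ f : K → N → I → L → O.coinv, ∑ᶠ (x) (n) (i) (l), f x n i l =
      ∑ᶠ (i) (l) (x) (n), f x n i l := fun f => by
    rw [finsum_rotate]
    exact finsum_congr fun i => finsum_rotate _
  have h₂ : ∑ᶠ (i : I) (l : L) (i' : {y // y ≠ i}) (n : N), O.cls (O.glue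
      (O.map (rightComm _ (Fin 1) K) (one _) (O.glue (O.map (Equiv.sumCongr (split i') (one _))
        (one J) (O.map (split i) (one J) a)) (O.map (one K) (split l) b)))
        (O.map (one M) (split n) c)) = O.inputGlue a b c := by
    rw [inputGlue, finsum_rotate]
    exact finsum_congr fun i => finsum_congr fun l => finsum_swap _
  have h₃ : _ = O.outputGlue a b c := finsum_rotate fun (x : K) (n : N) (i : I) =>
    ∑ᶠ n' : {y // y ≠ n}, O.cls (O.glue (O.map (split i) (one J) a)
      (O.map (one _) (unassoc L _ (Fin 1)) (O.glue (O.map (split x) (one L) b)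
        (O.map (one M) (Equiv.sumCongr (split n') (one _)) (O.map (one M) (split n) c)))))
  rw [h₁, h₂, h₃]
  abel

set_option maxHeartbeats 1000000 in
theorem exists_isGerstenhaber : ∃ mul br : O.coinv →ₗ[k] O.coinv →ₗ[k] O.coinv,
    (∀ (I J K L : Type) [Finite I] [Finite J] [Finite K] [Finite L]
      (a : O.obj I J) (b : O.obj K L), mul (O.cls a) (O.cls b) = O.cls (O.box a b)) ∧
    (∀ (I J K L : Type) [Finite I] [Finite J] [Finite K] [Finite L] (p q : ℤ)
      (a : O.obj I J) (b : O.obj K L), a ∈ O.deg I J p → b ∈ O.deg K L q →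
      br (O.cls a) (O.cls b) =
        O.bullet a b - ((p - 1) * (q - 1)).negOnePow • O.bullet b a) ∧
    IsGerstenhaber O.coinvDeg mul br ∧ IsGradedComm O.coinvDeg mul := by
  obtain ⟨mul, hmul⟩ := O.exists_mul
  obtain ⟨bul, hbul⟩ := O.exists_bul
  obtain ⟨br, hbr⟩ := exists_commutator O.coinvDeg_isInternal bul
  have hg := O.generatesGrading
  have mul_mem : ∀ i j : O.Gen, mul (O.cls i.2.2.1) (O.cls j.2.2.1) ∈ O.coinvDeg (i.2.1 + j.2.1) :=
    fun i j => by
      rw [hmul]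
      exact O.cls_mem (O.box_deg i.2.2.2 j.2.2.2)
  have bul_mem : ∀ i j : O.Gen,
      bul (O.cls i.2.2.1) (O.cls j.2.2.1) ∈ O.coinvDeg (i.2.1 + j.2.1 - 1) :=
    fun i j => by
      rw [hbul]
      exact O.bullet_mem i.2.2.2 j.2.2.2
  have comm : IsGradedComm O.coinvDeg mul := hg.isGradedComm fun i j => by
    rw [hmul, hmul, O.box_comm i.2.2.2 j.2.2.2, map_units_smul_right, O.cls_map]
  refine ⟨mul, br, hmul, fun I J K L _ _ _ _ p q a b ha hb => ?_,
    hg.isGerstenhaber O.coinvDeg_isInternal mul_mem (hg.commutator_mem hbr bul_mem) ?_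
      (hg.commutator_antisymm hbr)
      (hg.commutator_jacobi hbr bul_mem (fun i j l => O.outputGlue i.2.2.1 j.2.2.1 l.2.2.1)
        (fun i j l => O.inputGlue i.2.2.1 j.2.2.1 l.2.2.1) ?_
        (fun i j l => O.outputGlue_symm _ i.2.2.2 j.2.2.2)
        (fun i j l => O.inputGlue_symm _ j.2.2.2 l.2.2.2))
      (hg.commutator_leibniz hbr mul_mem (hg.bul_mul_of_comm comm bul_mem ?_)
        (hg.mul_bul_of_comm comm bul_mem ?_)), comm⟩
  · rw [hbr (O.cls_mem ha) (O.cls_mem hb), hbul, hbul]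
  · intro i j l
    rw [hmul, hmul, hmul, hmul, ← O.box_assoc, O.cls_map]
  -- The associator with `outputGlue` as the part symmetric in the first two arguments and
  -- `inputGlue` as the part symmetric in the last two.
  · intro i j l
    rw [hbul, hbul, bullet, bullet]
    simp only [map_finsum_left]
    simp only [map_finsum_linear, hbul]
    exact O.sum_bullet_assoc _ _ _
  · rintro ⟨⟨i, i'⟩, p, a, ha⟩ ⟨⟨j, j'⟩, q, b, hb⟩ ⟨⟨l, l'⟩, r, c, hc⟩
    rw [hmul, hbul, O.bullet_box_right _ hb hc, hbul, hbul, bullet, bullet]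
    simp only [map_finsum_left, hmul]
  · rintro ⟨⟨i, i'⟩, p, a, ha⟩ ⟨⟨j, j'⟩, q, b, hb⟩ ⟨⟨l, l'⟩, r, c, hc⟩
    rw [hmul, hbul, O.bullet_box_left _ ha hb, hbul, hbul, bullet, bullet]
    simp only [map_finsum_linear, hmul]

end OddNCDioperad

namespace SBimodule

variable {k : Type v} [Field k] (O : SBimodule.{u, v} k)
variable {I J I' J' : Type} [Finite I] [Finite J] [Finite I'] [Finite J']

theorem map_congr {e e' : I ≃ I'} {f f' : J ≃ J'} (he : e = e') (hf : f = f') (a : O.obj I J) :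
    O.map e f a = O.map e' f' a := by
  rw [he, hf]

theorem map_eq_self {e : I ≃ I} {f : J ≃ J} (he : e = one I) (hf : f = one J) (a : O.obj I J) :
    O.map e f a = a := by
  rw [he, hf, O.map_refl]

theorem map_injective (e : I ≃ I') (f : J ≃ J') : Function.Injective (O.map e f) := by
  intro a b h
  have h' := congrArg (O.map e.symm f.symm) h
  rwa [O.map_map, O.map_map, O.map_eq_self e.self_trans_symm f.self_trans_symm,
    O.map_eq_self e.self_trans_symm f.self_trans_symm] at h'

end SBimodule

/-- The Koszul signs for the exchange of two elements glued by an edge each. -/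
theorem exchange_sign {V : Type*} [AddCommGroup V] (q r : ℤ) (x : V) :
    q.negOnePow • (q * r).negOnePow • x =
      ((q - 1) * (r - 1)).negOnePow • r.negOnePow • -x := by
  by_cases hq : Even q <;> by_cases hr : Even r <;>
    simp only [negOnePow_eq_ite, Int.even_mul, Int.even_sub, Int.not_even_one, hq, hr,
      iff_self, iff_true, iff_false, true_iff, false_iff, not_true_eq_false, not_false_eq_true,
      or_true, true_or, or_self, if_true, if_false, Units.neg_smul, one_smul, neg_neg, smul_neg]

/-! ### Odd PROPs and their underlying odd nc-dioperads -/

namespace OddPROP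

variable {k : Type v} [Field k] (O : OddPROP.{u, v} k)
variable {I J K L M N I' J' K' L' : Type} [Finite I] [Finite J] [Finite K] [Finite L] [Finite M]
  [Finite N] [Finite I'] [Finite J'] [Finite K'] [Finite L']

theorem glue_map_left (n : ℕ) (e : I ≃ I') (f : J ≃ J') (a : O.obj (I ⊕ Fin n) J)
    (b : O.obj K (L ⊕ Fin n)) :
    O.glue n (O.map (Equiv.sumCongr e (one _)) f a) b =
      O.map (Equiv.sumCongr e (one K)) (Equiv.sumCongr f (one L)) (O.glue n a b) := by
  have h := O.glue_map n e f (one K) (one L) a b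
  rwa [one, one, one, Equiv.sumCongr_refl, O.map_refl] at h

theorem glue_map_right (n : ℕ) (g : K ≃ K') (h : L ≃ L') (a : O.obj (I ⊕ Fin n) J)
    (b : O.obj K (L ⊕ Fin n)) :
    O.glue n a (O.map g (Equiv.sumCongr h (one _)) b) =
      O.map (Equiv.sumCongr (one I) g) (Equiv.sumCongr (one J) h) (O.glue n a b) := by
  have h := O.glue_map n (one I) (one J) g h a b
  rwa [one, one, one, Equiv.sumCongr_refl, O.map_refl] at h

theorem glue_finCongr {n m : ℕ} (h : n = m) (a : O.obj (I ⊕ Fin n) J) (b : O.obj K (L ⊕ Fin n)) :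
    O.glue m (O.map (Equiv.sumCongr (one I) (finCongr h)) (one J) a)
      (O.map (one K) (Equiv.sumCongr (one L) (finCongr h)) b) = O.glue n a b := by
  subst h
  rw [finCongr_refl, one, one, Equiv.sumCongr_refl, Equiv.sumCongr_refl, O.map_refl, O.map_refl]

/-- Two vertices `a` and `c` which are not connected by edges. -/
theorem glue_chain (p r : ℕ) (a : O.obj (I ⊕ Fin p) J) (b : O.obj (K ⊕ Fin r) (L ⊕ Fin p))
    (c : O.obj M (N ⊕ Fin r)) :
    O.map (Equiv.sumAssoc I K M) (Equiv.sumAssoc J L N)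
      (O.glue r (O.map (unassoc I K (Fin r)) (one _) (O.glue p a b)) c) =
    O.glue p a (O.map (one _) (rightComm L (Fin p) N) (O.glue r b c)) := by
  -- `glue_assoc` needs the degree of `b` for its sign. With no edge between `a` and `c` the sign is
  -- trivial, so the identity extends from homogeneous `b` to all `b`.
  have hb : b ∈ ⨆ d, O.deg (K ⊕ Fin r) (L ⊕ Fin p) d := by
    rw [(O.graded _ _).submodule_iSup_eq_top]; trivial
  induction hb using Submodule.iSup_induction' with
  | zero => simp
  | add x y _ _ hx hy => simp only [map_add, LinearMap.add_apply, hx, hy]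
  | mem d b hb =>
    have h := O.glue_assoc p 0 r
      (O.map (Equiv.sumCongr (Equiv.sumEmpty I (Fin 0)).symm (one _)) (one J) a)
      (O.map (one M) (Equiv.sumCongr (Equiv.sumEmpty N (Fin 0)).symm (one _)) c) hb
    -- The number `p + 0` is `p` by definition, but `0 + r` is not `r`, so these edges are
    -- renumbered.
    rw [← O.glue_finCongr (zero_add r)] at h
    simp only [O.glue_map_left, O.glue_map_right, O.map_map] at h
    rw [Nat.cast_zero, zero_mul, Int.negOnePow_zero, one_smul] at h
    refine Eq.trans (congrArg _ (congrArg₂ (fun x y => O.glue r x y) (O.map_congr ?_ ?_ _)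
      (O.map_eq_self ?_ ?_ _).symm)) (h.trans (congrArg₂ (fun x y => O.glue p x y)
      (O.map_eq_self ?_ ?_ _) (O.map_congr ?_ ?_ _)))
    · ext (x | (x | x)) <;> simp [Equiv.sumSumSumComm]
    · ext (x | x) <;> rfl
    · rfl
    · ext (x | x) <;> simp
    · ext (x | x) <;> rfl
    · rfl
    · ext (x | x) <;> rfl
    · ext ((x | x) | x) <;> rfl

/-- The edges from `b` and from `c` end in two different inputs of `a`. -/
theorem glue_two_inputs {q : ℤ} (a : O.obj ((I ⊕ Fin 1) ⊕ Fin 1) J) {b : O.obj K (L ⊕ Fin 1)}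
    (c : O.obj M (N ⊕ Fin 1)) (hb : b ∈ O.deg _ _ q) :
    O.map (Equiv.sumAssoc I K M) (Equiv.sumAssoc J L N)
      (O.glue 1 (O.map (rightComm I (Fin 1) K) (one _) (O.glue 1 a b)) c) =
    q.negOnePow • O.glue 2
      (O.map (((rightComm I (Fin 1) (Fin 1)).trans (Equiv.sumAssoc I (Fin 1) (Fin 1))).trans
        (Equiv.sumCongr (one I) finSumFinEquiv)) (one J) a)
      (O.map (one (K ⊕ M)) ((Equiv.sumSumSumComm L (Fin 1) N (Fin 1)).trans
        (Equiv.sumCongr (one (L ⊕ N)) finSumFinEquiv)) (O.box b c)) := by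
  -- One edge from `a` to each of `b` and `c`, and none between `b` and `c`, so that the gluing of
  -- `b` with `c` is their horizontal composition.
  have h := O.glue_assoc 1 1 0 a (O.map (one M) (Equiv.sumEmpty (N ⊕ Fin 1) (Fin 0)).symm c)
    (O.map_deg (Equiv.sumEmpty K (Fin 0)).symm (one (L ⊕ Fin 1)) hb)
  rw [Nat.cast_one, one_mul] at h
  refine Eq.trans (congrArg _ (congrArg₂ (fun x y => O.glue 1 x y) ?_ ?_)) h
  · have h' := O.glue_map_right 1 (Equiv.sumEmpty K (Fin 0)).symm (one L) a b
    rw [one, one, Equiv.sumCongr_refl] at h'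
    rw [h', O.map_map]
    refine O.map_congr ?_ ?_ _
    · ext ((x | x) | x) <;> rfl
    · ext (x | x) <;> rfl
  · rw [O.map_map]
    refine (O.map_eq_self rfl ?_ _).symm
    ext (x | x) <;> rfl

/-- The edges to `a` and to `b` start from two different outputs of `c`. -/
theorem glue_two_outputs {q : ℤ} (a : O.obj (I ⊕ Fin 1) J) {b : O.obj (K ⊕ Fin 1) L}
    (c : O.obj M ((N ⊕ Fin 1) ⊕ Fin 1)) (hb : b ∈ O.deg _ _ q) :
    O.map (Equiv.sumAssoc I K M) (Equiv.sumAssoc J L N)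
      (O.glue 2 (O.map ((Equiv.sumSumSumComm I (Fin 1) K (Fin 1)).trans
          (Equiv.sumCongr (one (I ⊕ K)) finSumFinEquiv)) (one (J ⊕ L)) (O.box a b))
        (O.map (one M) ((Equiv.sumAssoc N (Fin 1) (Fin 1)).trans
          (Equiv.sumCongr (one N) finSumFinEquiv)) c)) =
    q.negOnePow • O.glue 1 a (O.map (one _) (unassoc L N (Fin 1)) (O.glue 1 b c)) := by
  have h := O.glue_assoc 0 1 1 (O.map (Equiv.sumEmpty (I ⊕ Fin 1) (Fin 0)).symm (one J) a) c
    (O.map_deg (one (K ⊕ Fin 1)) (Equiv.sumEmpty L (Fin 0)).symm hb)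
  rw [Nat.cast_one, one_mul] at h
  refine h.trans (congrArg _ (congrArg₂ (fun x y => O.glue 1 x y) ?_ ?_))
  · rw [O.map_map]
    refine O.map_eq_self ?_ rfl _
    ext (x | x)
    · rfl
    · exact congrArg Sum.inr (Subsingleton.elim (α := Fin 1) _ _)
  · have h' := O.glue_map_left 1 (one K) (Equiv.sumEmpty L (Fin 0)).symm b c
    rw [one, one, Equiv.sumCongr_refl] at h'
    rw [h', O.map_map]
    refine O.map_congr ?_ ?_ _
    · ext (x | x) <;> rfl
    · ext (x | (x | x))
      · rfl
      · rfl
      · exact congrArg Sum.inr (Subsingleton.elim (α := Fin 1) _ _)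

theorem box_comm {p q : ℤ} {a : O.obj I J} {b : O.obj K L} (ha : a ∈ O.deg _ _ p)
    (hb : b ∈ O.deg _ _ q) : O.box a b =
      (p * q).negOnePow • O.map (Equiv.sumComm K I) (Equiv.sumComm L J) (O.box b a) :=
  O.glue_zero_comm ha hb

/-- Exchanging two edges changes the sign. -/
theorem glue_two_swap (g : K ≃ K') (h : L ≃ L') (e : I ≃ I') (f : J ≃ J')
    (a : O.obj (I ⊕ Fin 2) J) (b : O.obj K (L ⊕ Fin 2)) :
    O.glue 2 (O.map (Equiv.sumCongr e (Equiv.swap 0 1)) f a)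
      (O.map g (Equiv.sumCongr h (Equiv.swap 0 1)) b) =
    -O.map (Equiv.sumCongr e g) (Equiv.sumCongr f h) (O.glue 2 a b) := by
  have h' := O.glue_perm 2 (Equiv.swap 0 1) a b
  rw [Equiv.Perm.sign_swap (by decide), Units.neg_smul, one_smul] at h'
  rw [← map_neg, ← h', ← O.glue_map, O.map_map, O.map_map]
  refine congrArg₂ (fun x y => O.glue 2 x y) (O.map_congr ?_ rfl _) (O.map_congr rfl ?_ _) <;>
  · ext (x | x) <;> rfl

/-- Either order of the two gluings is one gluing of `a` along two edges to the horizontal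
composition of `b` and `c`. Passing from one order to the other exchanges `b` with `c`, giving
`(-1)^(qr)`, and transposes the two edges, giving `-1`. `exchange_sign` combines these with the
signs of `glue_two_inputs`. -/
theorem glue_inputs {q r : ℤ} (a : O.obj ((I ⊕ Fin 1) ⊕ Fin 1) J) {b : O.obj K (L ⊕ Fin 1)}
    {c : O.obj M (N ⊕ Fin 1)} (hb : b ∈ O.deg _ _ q) (hc : c ∈ O.deg _ _ r) :
    O.glue 1 (O.map (rightComm I (Fin 1) K) (one _) (O.glue 1 a b)) c =
    ((q - 1) * (r - 1)).negOnePow • O.map (rightComm I M K) (rightComm J N L)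
      (O.glue 1 (O.map (rightComm I (Fin 1) M) (one _)
        (O.glue 1 (O.map (rightComm I (Fin 1) (Fin 1)) (one _) a) c)) b) := by
  apply O.map_injective (Equiv.sumAssoc I K M) (Equiv.sumAssoc J L N)
  have e : ∀ A B C : Type, (rightComm A C B).trans (Equiv.sumAssoc A B C) =
      (Equiv.sumAssoc A C B).trans (Equiv.sumCongr (one A) (Equiv.sumComm C B)) := by
    intro A B C
    ext ((x | x) | x) <;> rfl
  rw [O.glue_two_inputs a c hb, map_units_smul_right, O.map_map, e I K M, e J L N,
    O.map_trans, O.glue_two_inputs _ b hc, O.box_comm hb hc, map_units_smul_right,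
    map_units_smul_right, map_units_smul_right]
  have h := O.glue_two_swap (Equiv.sumComm M K) (Equiv.sumComm N L) (one I) (one J)
    (O.map (((rightComm I (Fin 1) (Fin 1)).trans (Equiv.sumAssoc I (Fin 1) (Fin 1))).trans
      (Equiv.sumCongr (one I) finSumFinEquiv)) (one J)
        (O.map (rightComm I (Fin 1) (Fin 1)) (one J) a))
    (O.map (one (M ⊕ K)) ((Equiv.sumSumSumComm N (Fin 1) L (Fin 1)).trans
      (Equiv.sumCongr (one (N ⊕ L)) finSumFinEquiv)) (O.box c b))
  rw [← neg_eq_iff_eq_neg] at h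
  rw [← h]
  simp only [O.map_map]
  rw [exchange_sign]
  refine congrArg (fun x => _ • _ • -x) (congrArg₂ (fun x y => O.glue 2 x y)
    (O.map_congr ?_ rfl _) (O.map_congr rfl ?_ _))
  · ext ((x | x) | x)
    · rfl
    all_goals
      fin_cases x
      rfl
  · ext ((x | x) | (x | x))
    · rfl
    · fin_cases x
      rfl
    · rfl
    · fin_cases x
      rfl

theorem glue_outputs {p q : ℤ} {a : O.obj (I ⊕ Fin 1) J} {b : O.obj (K ⊕ Fin 1) L}
    (c : O.obj M ((N ⊕ Fin 1) ⊕ Fin 1)) (ha : a ∈ O.deg _ _ p) (hb : b ∈ O.deg _ _ q) :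
    O.glue 1 a (O.map (one _) (unassoc L N (Fin 1)) (O.glue 1 b c)) =
    ((p - 1) * (q - 1)).negOnePow • O.map (leftComm K I M) (leftComm L J N)
      (O.glue 1 b (O.map (one _) (unassoc J N (Fin 1))
        (O.glue 1 a (O.map (one _) (rightComm N (Fin 1) (Fin 1)) c)))) := by
  -- Signs are their own inverses; this solves `glue_two_outputs` for the iterated gluing on its
  -- right side.
  have sq : ∀ (n : ℤ) {V : Type u} [AddCommGroup V] {x y : V}, x = n.negOnePow • y →
      y = n.negOnePow • x := by
    intro n V _ x y h
    rw [h, smul_smul, Int.units_mul_self, one_smul]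
  have e : ∀ A B C : Type, (Equiv.sumAssoc A B C).trans (leftComm A B C) =
      (Equiv.sumCongr (Equiv.sumComm A B) (one C)).trans (Equiv.sumAssoc B A C) := by
    intro A B C
    ext ((x | x) | x) <;> rfl
  rw [sq q (O.glue_two_outputs a c hb), sq p (O.glue_two_outputs b _ ha), O.box_comm ha hb,
    map_units_smul_right, map_units_smul_left, map_units_smul_right, map_units_smul_right,
    O.map_map (Equiv.sumAssoc K I M) (Equiv.sumAssoc L J N) (leftComm K I M) (leftComm L J N),
    e K I M, e L J N, O.map_trans]
  have h := O.glue_two_swap (one M) (one N) (Equiv.sumComm K I) (Equiv.sumComm L J)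
    (O.map ((Equiv.sumSumSumComm K (Fin 1) I (Fin 1)).trans
          (Equiv.sumCongr (one (K ⊕ I)) finSumFinEquiv)) (one (L ⊕ J)) (O.box b a))
    (O.map (one M) ((Equiv.sumAssoc N (Fin 1) (Fin 1)).trans
          (Equiv.sumCongr (one N) finSumFinEquiv)) (O.map (one _) (rightComm N (Fin 1) (Fin 1)) c))
  rw [← neg_eq_iff_eq_neg] at h
  rw [← h]
  simp only [O.map_map, map_neg]
  rw [mul_comm p q, exchange_sign, mul_comm (q - 1)]
  refine congrArg (fun x => _ • _ • -(O.map _ _ x)) (congrArg₂ (fun x y => O.glue 2 x y)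
    (O.map_congr ?_ rfl _) (O.map_congr rfl ?_ _))
  · ext ((x | x) | (x | x))
    · rfl
    · fin_cases x
      rfl
    · rfl
    · fin_cases x
      rfl
  · ext ((x | x) | x)
    · rfl
    all_goals
      fin_cases x
      rfl

/-- Like `box_glue` and `glue_box`, this is a case of `glue_chain` in which some number of edges is
zero; only the empty sets `Fin 0` have to be removed. -/
theorem box_assoc (a : O.obj I J) (b : O.obj K L) (c : O.obj M N) :
    O.map (Equiv.sumAssoc I K M) (Equiv.sumAssoc J L N) (O.box (O.box a b) c) =
      O.box a (O.box b c) := by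
  have h := O.glue_chain 0 0 (O.map (Equiv.sumEmpty I (Fin 0)).symm (one J) a)
    (O.map (Equiv.sumEmpty K (Fin 0)).symm (Equiv.sumEmpty L (Fin 0)).symm b)
    (O.map (one M) (Equiv.sumEmpty N (Fin 0)).symm c)
  have h₁ := O.glue_map_right 0 (Equiv.sumEmpty K (Fin 0)).symm (one L)
    (O.map (Equiv.sumEmpty I (Fin 0)).symm (one J) a)
    (O.map (one K) (Equiv.sumEmpty L (Fin 0)).symm b)
  have h₂ := O.glue_map_left 0 (one K) (Equiv.sumEmpty L (Fin 0)).symm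
    (O.map (Equiv.sumEmpty K (Fin 0)).symm (one L) b)
    (O.map (one M) (Equiv.sumEmpty N (Fin 0)).symm c)
  rw [O.map_map] at h₁ h₂
  rw [O.map_congr (e := (one K).trans _) (e' := (Equiv.sumEmpty K (Fin 0)).symm)
    (f' := (Equiv.sumEmpty L (Fin 0)).symm) rfl (by ext; rfl)] at h₁
  rw [O.map_congr (f := (one L).trans _) (e' := (Equiv.sumEmpty K (Fin 0)).symm)
    (f' := (Equiv.sumEmpty L (Fin 0)).symm) (by ext; rfl) rfl] at h₂
  rw [h₁, h₂, O.map_map, O.map_map] at h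
  refine Eq.trans (congrArg _ (congrArg₂ (fun x y => O.glue 0 x y) (O.map_congr ?_ ?_ _) rfl))
    (h.trans (congrArg₂ (fun x y => O.glue 0 x y) rfl (O.map_congr ?_ ?_ _)))
  all_goals ext (x | x) <;> rfl

theorem box_glue (a : O.obj I J) (b : O.obj (K ⊕ Fin 1) L) (c : O.obj M (N ⊕ Fin 1)) :
    O.map (Equiv.sumAssoc I K M) (Equiv.sumAssoc J L N)
      (O.glue 1 (O.map (unassoc I K (Fin 1)) (one _) (O.box a b)) c) = O.box a (O.glue 1 b c) := by
  refine (O.glue_chain 0 1 _ _ c).trans (congrArg₂ (fun x y => O.glue 0 x y) rfl ?_)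
  have h := O.glue_map_left 1 (one K) (Equiv.sumEmpty L (Fin 0)).symm b c
  rw [one, one, Equiv.sumCongr_refl] at h
  rw [h, O.map_map]
  refine O.map_congr ?_ ?_ _ <;>
  · ext (x | x) <;> rfl

theorem glue_box (a : O.obj (I ⊕ Fin 1) J) (b : O.obj K (L ⊕ Fin 1)) (c : O.obj M N) :
    O.map (Equiv.sumAssoc I K M) (Equiv.sumAssoc J L N) (O.box (O.glue 1 a b) c) =
      O.glue 1 a (O.map (one _) (rightComm L (Fin 1) N) (O.box b c)) := by
  refine Eq.trans (congrArg _ (congrArg₂ (fun x y => O.glue 0 x y) ?_ rfl))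
    (O.glue_chain 1 0 a (O.map (Equiv.sumEmpty K (Fin 0)).symm (one (L ⊕ Fin 1)) b)
      (O.map (one M) (Equiv.sumEmpty N (Fin 0)).symm c))
  have h := O.glue_map_right 1 (Equiv.sumEmpty K (Fin 0)).symm (one L) a b
  rw [one, one, Equiv.sumCongr_refl] at h
  rw [h, O.map_map]
  refine O.map_congr ?_ ?_ _ <;>
  · ext (x | x) <;> rfl

/-- The odd nc-dioperad underlying an odd PROP. -/
abbrev toNCDioperad : OddNCDioperad.{u, v} k where
  toSBimodule := O.toSBimodule
  glue := O.glue 1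
  box := fun {I J K L} _ _ _ _ => (O.glue 0).compl₁₂ (O.map (Equiv.sumEmpty I (Fin 0)).symm (one J))
    (O.map (one K) (Equiv.sumEmpty L (Fin 0)).symm)
  glue_deg ha hb := by simpa using O.glue_deg 1 ha hb
  box_deg ha hb := by simpa using O.glue_deg 0 (O.map_deg _ _ ha) (O.map_deg _ _ hb)
  glue_map := O.glue_map 1
  box_map e f g h a b := by
    simp only [LinearMap.compl₁₂_apply]
    rw [← O.glue_map, O.map_map, O.map_map, O.map_map, O.map_map]
    refine congrArg₂ (fun x y => O.glue 0 x y) (O.map_congr ?_ rfl _) (O.map_congr rfl ?_ _) <;>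
    · ext x; rfl
  glue_chain := O.glue_chain 1 1
  glue_inputs := O.glue_inputs
  glue_outputs := O.glue_outputs
  box_assoc := O.box_assoc
  box_comm := O.box_comm
  box_glue := O.box_glue
  glue_box := O.glue_box

/-- Coinvariants, `box` and `bullet` of an odd PROP unfold to those of its underlying odd
nc-dioperad, so the result carries over by definition. -/
theorem exists_isGerstenhaber : ∃ mul br : O.coinv →ₗ[k] O.coinv →ₗ[k] O.coinv,
    (∀ (I J K L : Type) [Finite I] [Finite J] [Finite K] [Finite L]
      (a : O.obj I J) (b : O.obj K L), mul (O.cls a) (O.cls b) = O.cls (O.box a b)) ∧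
    (∀ (I J K L : Type) [Finite I] [Finite J] [Finite K] [Finite L] (p q : ℤ)
      (a : O.obj I J) (b : O.obj K L), a ∈ O.deg I J p → b ∈ O.deg K L q →
      br (O.cls a) (O.cls b) =
        O.bullet a b - ((p - 1) * (q - 1)).negOnePow • O.bullet b a) ∧
    IsGerstenhaber O.coinvDeg mul br ∧ IsGradedComm O.coinvDeg mul :=
  O.toNCDioperad.exists_isGerstenhaber

end OddPROP

/-! ### Odd free nc-operads -/

theorem finsum_sum {A : Type*} [AddCommMonoid A] {ι κ : Type*} [Finite ι] [Finite κ]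
    (x : ι ⊕ κ → A) : ∑ᶠ i, x i = ∑ᶠ i, x (Sum.inl i) + ∑ᶠ j, x (Sum.inr j) := by
  cases nonempty_fintype ι
  cases nonempty_fintype κ
  simp only [finsum_eq_sum_of_fintype, Fintype.sum_sum_type]

/-- Contracting an edge shrinks the sets of inputs and roots. Extension by zero lets the next sum
run over the original sets, where two edges can be exchanged. -/
theorem finsum_subtype_ne {A : Type*} [AddCommMonoid A] {ι : Type*} [Finite ι] (i : ι)
    (x : {j // j ≠ i} → A) :
    ∑ᶠ j, x j = ∑ᶠ j, open scoped Classical in if h : j ≠ i then x ⟨j, h⟩ else 0 := by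
  classical
  cases nonempty_fintype ι
  simp only [finsum_eq_sum_of_fintype]
  rw [← Finset.sum_filter_add_sum_filter_not Finset.univ (fun j => j ≠ i)]
  rw [Finset.sum_eq_zero (s := Finset.univ.filter fun j => ¬ j ≠ i), add_zero]
  · rw [← Finset.sum_subtype_eq_sum_filter]
    refine (Finset.sum_congr (by ext; simp) fun j _ => ?_)
    simp [j.2]
  · intro j hj
    rw [dif_neg (Finset.mem_filter.mp hj).2]

theorem finsum_equiv {A : Type*} [AddCommMonoid A] {ι κ : Type*} (e : ι ≃ κ) {x : κ → A} {y : ι → A}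
    (h : ∀ i, x (e i) = y i) : ∑ᶠ j, x j = ∑ᶠ i, y i := by
  rw [← finsum_comp_equiv e]
  exact finsum_congr h

/-- `(S ∖ {s}) ⨿ T = (S ⨿ T) ∖ {s}`. -/
def neSum {S : Type} (T : Type) (s : S) : {x // x ≠ s} ⊕ T ≃ {x : S ⊕ T // x ≠ Sum.inl s} where
  toFun := Sum.elim (fun x => ⟨Sum.inl x.1, fun h => x.2 (Sum.inl.inj h)⟩)
    fun t => ⟨Sum.inr t, Sum.inr_ne_inl⟩
  invFun x := match x with
    | ⟨Sum.inl y, h⟩ => Sum.inl ⟨y, fun h' => h (congrArg Sum.inl h')⟩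
    | ⟨Sum.inr t, _⟩ => Sum.inr t
  left_inv := by rintro (x | t) <;> rfl
  right_inv := by rintro ⟨x | t, h⟩ <;> rfl

theorem neSum_val {S : Type} (T : Type) (s : S) (x : {x // x ≠ s} ⊕ T) :
    (neSum T s x).1 = Sum.map Subtype.val id x := by
  rcases x with x | t <;> rfl

/-- `(S ∖ {s}) ∖ {s'} = (S ∖ {s'}) ∖ {s}`. -/
def neNe {S : Type} {s s' : S} (h : s' ≠ s) (h' : s ≠ s') :
    {x : {x // x ≠ s} // x ≠ ⟨s', h⟩} ≃ {x : {x // x ≠ s'} // x ≠ ⟨s, h'⟩} where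
  toFun x := ⟨⟨x.1.1, fun e => x.2 (Subtype.ext e)⟩, fun e => x.1.2 (congrArg Subtype.val e)⟩
  invFun x := ⟨⟨x.1.1, fun e => x.2 (Subtype.ext e)⟩, fun e => x.1.2 (congrArg Subtype.val e)⟩
  left_inv _ := rfl
  right_inv _ := rfl

/-! ### Contracting two edges of a box -/

section ContractBox

open scoped Classical in
theorem contractBox_val {S R : Type} (π : S → R) (s : S) (r : R) (h : π s ≠ r) (x : {x // x ≠ s}) :
    (contractBox π s r h x).1 = if π x = r then π s else π x := by
  rw [contractBox]
  split_ifs <;> rfl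

variable {S R : Type} (π : S → R) {s s' : S} {r r' : R} (hs : s' ≠ s) (hs' : s ≠ s')
  (hr : r' ≠ r) (hr' : r ≠ r')

/-- The second edge may be contracted exactly if it is not a loop and does not close a cycle with
the first one. Together with `h` this condition is symmetric in the two edges, so both orders are
admissible at once. -/
theorem contractBox_ne_iff (h : π s ≠ r) :
    contractBox π s r h ⟨s', hs⟩ ≠ ⟨r', hr⟩ ↔ π s' ≠ r' ∧ ¬ (π s' = r ∧ π s = r') := by
  rw [Ne, Subtype.ext_iff, contractBox_val]
  grind

open scoped Classical in
theorem contractBox_contractBox_val (h₁ : π s ≠ r)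
    (h₂ : contractBox π s r h₁ ⟨s', hs⟩ ≠ ⟨r', hr⟩) (x : {x : {x // x ≠ s} // x ≠ ⟨s', hs⟩}) :
    (contractBox (contractBox π s r h₁) ⟨s', hs⟩ ⟨r', hr⟩ h₂ x).1.1 =
      if (if π x.1 = r then π s else π x.1) = r' then if π s' = r then π s else π s'
        else if π x.1 = r then π s else π x.1 := by
  have e : contractBox π s r h₁ x.1 = ⟨r', hr⟩ ↔ (if π x.1 = r then π s else π x.1) = r' := by
    rw [Subtype.ext_iff, contractBox_val]
  rw [contractBox_val, apply_ite Subtype.val, contractBox_val, contractBox_val]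
  by_cases h : contractBox π s r h₁ x.1 = ⟨r', hr⟩
  · rw [if_pos h, if_pos (e.mp h)]
  · rw [if_neg h, if_neg (mt e.mpr h)]

theorem contractBox_contractBox (h₁ : π s ≠ r) (h₂ : contractBox π s r h₁ ⟨s', hs⟩ ≠ ⟨r', hr⟩)
    (h₁' : π s' ≠ r') (h₂' : contractBox π s' r' h₁' ⟨s, hs'⟩ ≠ ⟨r, hr'⟩)
    (x : {x : {x // x ≠ s} // x ≠ ⟨s', hs⟩}) :
    contractBox (contractBox π s' r' h₁') ⟨s, hs'⟩ ⟨r, hr'⟩ h₂' (neNe hs hs' x) =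
      neNe hr hr' (contractBox (contractBox π s r h₁) ⟨s', hs⟩ ⟨r', hr⟩ h₂ x) := by
  have h := (contractBox_ne_iff π hs hr h₁).mp h₂
  refine Subtype.ext (Subtype.ext ?_)
  refine (contractBox_contractBox_val π hs' hr' h₁' h₂' _).trans
    (Eq.trans ?_ (contractBox_contractBox_val π hs hr h₁ h₂ x).symm)
  have e : (neNe hs hs' x).1.1 = x.1.1 := rfl
  rw [e]
  -- Only a case distinction on equalities between `π s`, `π s'`, `r`, `r'` and the root of `x`
  -- remains.
  clear h₂ h₂' e
  generalize π x.1.1 = z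
  grind

end ContractBox

/-! ### Batalin–Vilkovisky operators tested on generators -/

section BatalinVilkovisky

variable {k : Type v} [Field k] {A : Type u} [AddCommGroup A] [Module k A]

/-- With `x` and `y` the unsigned gluings of `b` into `a` and of `a` into `b`, this identifies the
contribution to `Δ` of the edges between `a` and `b` with the signed bracket. -/
theorem batalinVilkovisky_sign (p q : ℤ) (x y : A) :
    p.negOnePow • (p.negOnePow • x - ((p - 1) * (q - 1)).negOnePow • q.negOnePow • y) =
      x + (p * q).negOnePow • y := by
  by_cases hp : Even p <;> by_cases hq : Even q <;>
    simp only [negOnePow_eq_ite, Int.even_mul, Int.even_sub, Int.not_even_one, hp, hq, iff_self,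
      iff_true, iff_false, true_iff, false_iff, not_true_eq_false, not_false_eq_true, or_true,
      true_or, or_self, if_true, if_false, Units.neg_smul, one_smul, neg_neg, smul_neg] <;> abel

theorem GeneratesGrading.linear_mem {𝒜 : ℤ → Submodule k A} {ι : Type*} {g : ι → A} {d : ι → ℤ}
    (hg : GeneratesGrading 𝒜 g d) {n : ℤ} {Δ : A →ₗ[k] A} (h : ∀ i, Δ (g i) ∈ 𝒜 (d i + n))
    {p : ℤ} {a : A} (ha : a ∈ 𝒜 p) : Δ a ∈ 𝒜 (p + n) := by
  refine hg.induction (P := fun a => Δ a ∈ 𝒜 (p + n)) (by simp)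
    (fun x y hx hy => by simpa using add_mem hx hy) (fun i hi => ?_) ha
  rw [← hi]
  exact h i

theorem GeneratesGrading.batalinVilkovisky_mul {𝒜 : ℤ → Submodule k A} {ι : Type*} {g : ι → A}
    {d : ι → ℤ} (hg : GeneratesGrading 𝒜 g d) {mul br : A →ₗ[k] A →ₗ[k] A} {Δ : A →ₗ[k] A}
    (h : ∀ i j, Δ (mul (g i) (g j)) = mul (Δ (g i)) (g j) + (d i).negOnePow • mul (g i) (Δ (g j))
      + (d i).negOnePow • br (g i) (g j)) {p q : ℤ} {a b : A} (ha : a ∈ 𝒜 p) (hb : b ∈ 𝒜 q) :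
    Δ (mul a b) = mul (Δ a) b + p.negOnePow • mul a (Δ b) + p.negOnePow • br a b := by
  refine hg.induction (P := fun a => Δ (mul a b) = mul (Δ a) b + p.negOnePow • mul a (Δ b)
    + p.negOnePow • br a b) (by simp) (fun x y hx hy => ?_) (fun i hi => ?_) ha
  · simp only [map_add, LinearMap.add_apply, smul_add, hx, hy]
    abel
  refine hg.induction (P := fun b => Δ (mul (g i) b) = mul (Δ (g i)) b
    + p.negOnePow • mul (g i) (Δ b) + p.negOnePow • br (g i) b) (by simp) (fun x y hx hy => ?_)
    (fun j _ => ?_) hb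
  · simp only [map_add, LinearMap.add_apply, smul_add, hx, hy]
    abel
  rw [← hi]
  exact h i j

/-- A criterion on generators for the Gerstenhaber algebra of a Batalin–Vilkovisky operator. -/
theorem GeneratesGrading.isGerstenhaber_of_batalinVilkovisky {𝒜 : ℤ → Submodule k A} {ι : Type*}
    {g : ι → A} {d : ι → ℤ} (hg : GeneratesGrading 𝒜 g d) (hint : DirectSum.IsInternal 𝒜)
    {mul br : A →ₗ[k] A →ₗ[k] A} {Δ : A →ₗ[k] A}
    (mul_mem : ∀ i j, mul (g i) (g j) ∈ 𝒜 (d i + d j))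
    (br_mem : ∀ i j, br (g i) (g j) ∈ 𝒜 (d i + d j - 1))
    (mul_assoc : ∀ i j l, mul (mul (g i) (g j)) (g l) = mul (g i) (mul (g j) (g l)))
    (antisymm : ∀ i j,
      br (g i) (g j) = -(((d i - 1) * (d j - 1)).negOnePow • br (g j) (g i)))
    (leibniz : ∀ i j l, br (g i) (mul (g j) (g l)) =
      mul (br (g i) (g j)) (g l) + ((d i - 1) * d j).negOnePow • mul (g j) (br (g i) (g l)))
    (Δ_mem : ∀ i, Δ (g i) ∈ 𝒜 (d i - 1)) (Δ_sq : ∀ i, Δ (Δ (g i)) = 0)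
    (Δ_mul : ∀ i j, Δ (mul (g i) (g j)) = mul (Δ (g i)) (g j)
      + (d i).negOnePow • mul (g i) (Δ (g j)) + (d i).negOnePow • br (g i) (g j)) :
    IsGerstenhaber 𝒜 mul br := by
  refine hg.isGerstenhaber hint mul_mem br_mem mul_assoc antisymm (fun i j l => ?_) leibniz
  refine jacobi_of_batalinVilkovisky (LinearMap.congr_fun (f := Δ ∘ₗ Δ) (g := 0)
    (hg.linearMap_ext hint Δ_sq)) (fun ha => hg.linear_mem (n := -1) Δ_mem ha) (fun ha hb => ?_)
    (fun ha hb => hg.bilinear_mem (n := -1) br_mem ha hb) (hg.batalinVilkovisky_mul Δ_mul)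
    (hg.antisymm antisymm) (fun c ha hb => hg.leibniz hint leibniz c ha hb) (hg.mem i) (hg.mem j)
    (hg.mem l)
  simpa using hg.bilinear_mem (n := 0) (fun i j => by simpa using mul_mem i j) ha hb

theorem mul_bul_sign (p q : ℤ) (x y : A) :
    (p + q).negOnePow • (p.negOnePow • x + (p * q + q).negOnePow • y) =
      q.negOnePow • x + (p * q).negOnePow • p.negOnePow • y := by
  by_cases hp : Even p <;> by_cases hq : Even q <;>
    simp only [negOnePow_eq_ite, Int.even_mul, Int.even_add, hp, hq, iff_self,
      iff_true, iff_false, true_iff, false_iff, not_true_eq_false, not_false_eq_true, or_true,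
      true_or, or_self, if_true, if_false, Units.neg_smul, one_smul, neg_neg, smul_neg] <;> abel

end BatalinVilkovisky

/-! ### Classes of boxes and sums over contracted edges -/

namespace OddFreeNCOperad

variable {k : Type v} [Field k] (O : OddFreeNCOperad.{u, v} k)
variable {S R T Q U P S' R' T' Q' : Type} [Finite S] [Finite R] [Finite T] [Finite Q] [Finite U]
  [Finite P] [Finite S'] [Finite R'] [Finite T'] [Finite Q']
variable {π : S → R} {ρ : T → Q} {τ : U → P} {π' : S' → R'} {ρ' : T' → Q'}

/-- The box `π` with standard sets of inputs and roots. -/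
abbrev stdBox (π : S → R) : StdBox :=
  ⟨Nat.card S, Nat.card R, fun i => Finite.equivFin R (π ((Finite.equivFin S).symm i))⟩

/-- The relabellings of the standard boxes. -/
abbrev relabelling (x y : StdBox) : Set (O.obj x.2.2 →ₗ[k] O.obj y.2.2) :=
  {φ | ∃ (e : Fin x.1 ≃ Fin y.1)
    (f : Fin x.2.1 ≃ Fin y.2.1) (h : ∀ i, y.2.2 (e i) = f (x.2.2 i)), φ = O.map e f h}

/-- The class of an element with standard sets of inputs and roots. -/
abbrev stdCls (x : StdBox) : O.obj x.2.2 →ₗ[k] O.coinv :=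
  Coinv.mk k (fun x : StdBox => O.obj x.2.2) O.relabelling x

theorem stdCls_map {x y : StdBox} (e : Fin x.1 ≃ Fin y.1) (f : Fin x.2.1 ≃ Fin y.2.1)
    (h : ∀ i, y.2.2 (e i) = f (x.2.2 i)) (a : O.obj x.2.2) :
    O.stdCls y (O.map e f h a) = O.stdCls x a :=
  Coinv.mk_rel (k := k) (M := fun x : StdBox => O.obj x.2.2) (rel := O.relabelling)
    (φ := O.map e f h) ⟨e, f, h, rfl⟩ a

theorem map_congr {e e' : S ≃ S'} {f f' : R ≃ R'} (he : e = e') (hf : f = f')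
    (h : ∀ x, π' (e x) = f (π x)) (a : O.obj π) :
    O.map e f h a = O.map e' f' (fun x => by rw [← he, ← hf, h]) a := by
  subst he hf
  rfl

theorem cls_eq_stdCls (x : StdBox) (e : S ≃ Fin x.1) (f : R ≃ Fin x.2.1)
    (h : ∀ i, x.2.2 (e i) = f (π i)) (a : O.obj π) : O.cls a = O.stdCls x (O.map e f h a) := by
  have h' := O.stdCls_map
    (x := stdBox π) (y := x) ((Finite.equivFin S).symm.trans e) ((Finite.equivFin R).symm.trans f)
    (fun i => by simp [h]) (O.map (Finite.equivFin S) (Finite.equivFin R) (fun x => by simp) a)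
  rw [← O.map_trans _ _ _ _ _ _ (fun i => by simp [h]), O.map_congr (self_trans_symm_trans _ _)
    (self_trans_symm_trans _ _)] at h'
  exact h'.symm

@[simp]
theorem cls_map (e : S ≃ S') (f : R ≃ R') (h : ∀ x, π' (e x) = f (π x)) (a : O.obj π) :
    O.cls (O.map e f h a) = O.cls a := by
  refine Eq.trans ?_ (O.cls_eq_stdCls (stdBox π')
    (e.trans (Finite.equivFin S')) (f.trans (Finite.equivFin R')) (fun i => by simp [h]) a).symm
  exact congrArg (O.stdCls (stdBox π')) (O.map_trans e f h (Finite.equivFin S')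
    (Finite.equivFin R') (fun i => by simp) (fun i => by simp [h]) a).symm

theorem cls_mem {p : ℤ} {a : O.obj π} (ha : a ∈ O.deg π p) : O.cls a ∈ O.coinvDeg p :=
  Coinv.mk_mem_deg (𝒢 := fun x : StdBox => O.deg x.2.2)
    (x := stdBox π)
    (O.map_deg _ _ _ ha)

theorem coinvDeg_isInternal : DirectSum.IsInternal O.coinvDeg := by
  refine Coinv.deg_isInternal (fun x => O.graded x.2.2) ?_
  rintro x y _ ⟨e, f, h, rfl⟩ d a ha
  exact O.map_deg e f h ha

/-- Homogeneous elements with standard sets of inputs and roots. -/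
abbrev Gen : Type u := Σ (x : StdBox) (p : ℤ), O.deg x.2.2 p

theorem cls_std (x : StdBox) (a : O.obj x.2.2) : O.cls a = O.stdCls x a := by
  rw [O.cls_eq_stdCls (π := x.2.2) x (Equiv.refl _) (Equiv.refl _) (fun _ => rfl) a, O.map_refl]

theorem generatesGrading :
    GeneratesGrading O.coinvDeg (fun i : O.Gen => O.cls i.2.2.1) (fun i => i.2.1) where
  mem i := O.cls_mem i.2.2.2
  closure p a ha := by
    refine Coinv.deg_induction
      (p := fun a => a ∈ AddSubmonoid.closure {x | ∃ i : O.Gen, i.2.1 = p ∧ O.cls i.2.2.1 = x})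
      (zero_mem _) (fun a b => add_mem) (fun x a ha => ?_) ha
    exact AddSubmonoid.subset_closure ⟨⟨x, p, a, ha⟩, rfl, O.cls_std x a⟩

theorem exists_linear {V : Type*} [AddCommGroup V] [Module k V]
    (B : ∀ {S R : Type} [Finite S] [Finite R] (π : S → R), O.obj π →ₗ[k] V)
    (hB : ∀ {S R S' R' : Type} [Finite S] [Finite R] [Finite S'] [Finite R'] {π : S → R}
      {π' : S' → R'} (e : S ≃ S') (f : R ≃ R') (h : ∀ x, π' (e x) = f (π x)) (a : O.obj π),
      B π' (O.map e f h a) = B π a) :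
    ∃ F : O.coinv →ₗ[k] V, ∀ {S R : Type} [Finite S] [Finite R] {π : S → R} (a : O.obj π),
      F (O.cls a) = B π a := by
  obtain ⟨F, hF⟩ := Coinv.exists_lift (k := k) (M := fun x : StdBox => O.obj x.2.2)
    (rel := O.relabelling)
    (fun x => B x.2.2)
    (by
      rintro x y _ ⟨e, f, h, rfl⟩ a
      exact hB e f h a)
  exact ⟨F, fun a => (hF ⟨_, _, _⟩ _).trans (hB _ _ _ _)⟩

theorem exists_bilinear {V : Type*} [AddCommGroup V] [Module k V]
    (B : ∀ {S R T Q : Type} [Finite S] [Finite R] [Finite T] [Finite Q] (π : S → R) (ρ : T → Q),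
      O.obj π →ₗ[k] O.obj ρ →ₗ[k] V)
    (hB : ∀ {S R T Q S' R' T' Q' : Type} [Finite S] [Finite R] [Finite T] [Finite Q] [Finite S']
      [Finite R'] [Finite T'] [Finite Q'] {π : S → R} {ρ : T → Q} {π' : S' → R'} {ρ' : T' → Q'}
      (e : S ≃ S') (f : R ≃ R') (h : ∀ x, π' (e x) = f (π x)) (e' : T ≃ T') (f' : Q ≃ Q')
      (h' : ∀ x, ρ' (e' x) = f' (ρ x)) (a : O.obj π) (b : O.obj ρ),
      B π' ρ' (O.map e f h a) (O.map e' f' h' b) = B π ρ a b) :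
    ∃ F : O.coinv →ₗ[k] O.coinv →ₗ[k] V, ∀ {S R T Q : Type} [Finite S] [Finite R] [Finite T]
      [Finite Q] {π : S → R} {ρ : T → Q} (a : O.obj π) (b : O.obj ρ),
      F (O.cls a) (O.cls b) = B π ρ a b := by
  obtain ⟨F, hF⟩ := Coinv.exists_lift₂ (k := k) (M := fun x : StdBox => O.obj x.2.2)
    (rel := O.relabelling)
    (fun x y => B x.2.2 y.2.2)
    (by
      rintro x y _ ⟨e, f, h, rfl⟩ l a b
      simpa [O.map_refl] using
        hB (ρ := l.2.2) (ρ' := l.2.2) e f h (Equiv.refl _) (Equiv.refl _) (fun _ => rfl) a b)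
    (by
      rintro x y _ ⟨e, f, h, rfl⟩ l a b
      simpa [O.map_refl] using
        hB (π := l.2.2) (π' := l.2.2) (Equiv.refl _) (Equiv.refl _) (fun _ => rfl) e f h a b)
  exact ⟨F, fun a b => (hF ⟨_, _, _⟩ ⟨_, _, _⟩ _ _).trans (hB _ _ _ _ _ _ _ _)⟩

theorem cls_box_assoc (a : O.obj π) (b : O.obj ρ) (c : O.obj τ) :
    O.cls (O.box (O.box a b) c) = O.cls (O.box a (O.box b c)) := by
  rw [← O.box_assoc (by rintro ((x | x) | x) <;> rfl), O.cls_map]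

theorem cls_box_comm {p q : ℤ} {a : O.obj π} {b : O.obj ρ} (ha : a ∈ O.deg π p)
    (hb : b ∈ O.deg ρ q) : O.cls (O.box a b) = (p * q).negOnePow • O.cls (O.box b a) := by
  rw [O.box_comm (by rintro (x | x) <;> rfl) ha hb, map_units_smul_right, O.cls_map]

theorem box_map_left (e : S ≃ S') (f : R ≃ R') (h : ∀ x, π' (e x) = f (π x)) (a : O.obj π)
    (b : O.obj ρ) : O.box (O.map e f h a) b =
      O.map (Equiv.sumCongr e (one T)) (Equiv.sumCongr f (one Q))
        (by rintro (x | x) <;> simp [h]) (O.box a b) := by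
  have h' := O.box_map e f h (one T) (one Q) (fun _ => rfl)
    (by rintro (x | x) <;> simp [h]) a b
  rwa [O.map_refl] at h'

theorem box_map_right (e : T ≃ T') (f : Q ≃ Q') (h : ∀ x, ρ' (e x) = f (ρ x)) (a : O.obj π)
    (b : O.obj ρ) : O.box a (O.map e f h b) =
      O.map (Equiv.sumCongr (one S) e) (Equiv.sumCongr (one R) f)
        (by rintro (x | x) <;> simp [h]) (O.box a b) := by
  have h' := O.box_map (one S) (one R) (fun _ => rfl) e f h
    (by rintro (x | x) <;> simp [h]) a b
  rwa [O.map_refl] at h'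

/-- The class of the contraction of the edge from the root `r` to the input `s`, which is zero if
both belong to the same corolla. -/
def edge (π : S → R) (s : S) (r : R) : O.obj π →ₗ[k] O.coinv :=
  open scoped Classical in
  if h : π s ≠ r then O.cls ∘ₗ O.contract π s r h else 0

theorem edge_of_ne {s : S} {r : R} (h : π s ≠ r) (a : O.obj π) :
    O.edge π s r a = O.cls (O.contract π s r h a) := by
  rw [edge, dif_pos h, LinearMap.comp_apply]

theorem edge_of_eq {s : S} {r : R} (h : π s = r) (a : O.obj π) : O.edge π s r a = 0 := by
  rw [edge, dif_neg (not_not.mpr h), LinearMap.zero_apply]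

theorem edge_mem (s : S) (r : R) {d : ℤ} {a : O.obj π} (ha : a ∈ O.deg π d) :
    O.edge π s r a ∈ O.coinvDeg (d - 1) := by
  by_cases h : π s = r
  · rw [O.edge_of_eq h]
    exact zero_mem _
  · rw [O.edge_of_ne h]
    exact O.cls_mem (O.contract_deg π s r h ha)

theorem edge_map (e : S ≃ S') (f : R ≃ R') (h : ∀ x, π' (e x) = f (π x)) (s : S) (r : R)
    (a : O.obj π) : O.edge π' (e s) (f r) (O.map e f h a) = O.edge π s r a := by
  by_cases hs : π s = r
  · rw [O.edge_of_eq hs, O.edge_of_eq (by rw [h, hs])]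
  · have hs' : π' (e s) ≠ f r := by rwa [h, Ne, f.apply_eq_iff_eq]
    rw [O.edge_of_ne hs, O.edge_of_ne hs', O.contract_map e f h s r hs hs'
      (e.subtypeEquiv fun x => by simp) (f.subtypeEquiv fun x => by simp) ?_ (fun _ => rfl)
      (fun _ => rfl), O.cls_map]
    intro x
    classical
    refine Subtype.ext ((contractBox_val _ _ _ _ _).trans ?_)
    change (if π' (e x.1) = f r then π' (e s) else π' (e x.1)) = f (contractBox π s r hs x).1
    rw [contractBox_val, apply_ite f]
    simp only [h, f.apply_eq_iff_eq]

/-- The axiom `contract_box` concerns edges inside the first box only. Other edges are brought into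
this position by `edge_box_comm` and `edge_box_assoc`. -/
theorem edge_box_inl {mul : O.coinv →ₗ[k] O.coinv →ₗ[k] O.coinv}
    (hmul : ∀ {S R T Q : Type} [Finite S] [Finite R] [Finite T] [Finite Q] {π : S → R} {ρ : T → Q}
      (a : O.obj π) (b : O.obj ρ), mul (O.cls a) (O.cls b) = O.cls (O.box a b))
    (s : S) (r : R) (a : O.obj π) (b : O.obj ρ) :
    O.edge (Sum.map π ρ) (Sum.inl s) (Sum.inl r) (O.box a b) =
      mul (O.edge π s r a) (O.cls b) := by
  by_cases hs : π s = r
  · rw [O.edge_of_eq hs, O.edge_of_eq (by simp [hs]), map_zero, LinearMap.zero_apply]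
  · have hs' : Sum.map π ρ (Sum.inl s) ≠ Sum.inl r := by simpa using hs
    rw [O.edge_of_ne hs, O.edge_of_ne hs', hmul, ← O.contract_box s r hs hs' (neSum T s)
      (neSum Q r) ?_ (neSum_val T s) (neSum_val Q r), O.cls_map]
    rintro (x | x)
    · refine Subtype.ext ?_
      rw [contractBox_val, neSum_val, neSum_val]
      by_cases hx : π x = r <;> simp [contractBox_val, hx]
    · refine Subtype.ext ?_
      rw [contractBox_val, neSum_val, neSum_val]
      simp

theorem edge_box_comm {p q : ℤ} {a : O.obj π} {b : O.obj ρ} (ha : a ∈ O.deg π p)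
    (hb : b ∈ O.deg ρ q) (x : S ⊕ T) (y : R ⊕ Q) :
    O.edge (Sum.map π ρ) x y (O.box a b) =
      (p * q).negOnePow • O.edge (Sum.map ρ π) x.swap y.swap (O.box b a) := by
  rw [O.box_comm (by rintro (x | x) <;> rfl) ha hb, map_units_smul_right]
  have e := O.edge_map (π := Sum.map ρ π) (π' := Sum.map π ρ) (Equiv.sumComm T S)
    (Equiv.sumComm Q R) (by rintro (x | x) <;> rfl) x.swap y.swap (O.box b a)
  have hx : Equiv.sumComm T S x.swap = x := x.swap_swap
  have hy : Equiv.sumComm Q R y.swap = y := y.swap_swap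
  rw [hx, hy] at e
  exact congrArg _ e

theorem edge_box_assoc (a : O.obj π) (b : O.obj ρ) (c : O.obj τ) (x : (S ⊕ T) ⊕ U)
    (y : (R ⊕ Q) ⊕ P) :
    O.edge (Sum.map (Sum.map π ρ) τ) x y (O.box (O.box a b) c) =
      O.edge (Sum.map π (Sum.map ρ τ)) (Equiv.sumAssoc S T U x) (Equiv.sumAssoc R Q P y)
        (O.box a (O.box b c)) := by
  rw [← O.box_assoc (by rintro ((x | x) | x) <;> rfl), O.edge_map]

theorem exists_mul : ∃ mul : O.coinv →ₗ[k] O.coinv →ₗ[k] O.coinv,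
    ∀ {S R T Q : Type} [Finite S] [Finite R] [Finite T] [Finite Q] {π : S → R} {ρ : T → Q}
      (a : O.obj π) (b : O.obj ρ), mul (O.cls a) (O.cls b) = O.cls (O.box a b) :=
  O.exists_bilinear (fun _ _ => O.box.compr₂ O.cls) fun e f h e' f' h' a b => by
    simp only [LinearMap.compr₂_apply]
    rw [O.box_map e f h e' f' h' (by rintro (x | x) <;> simp [h, h']), O.cls_map]

/-- The sum over the contractions of all edges. -/
theorem exists_batalinVilkovisky : ∃ Δ : O.coinv →ₗ[k] O.coinv,
    ∀ {S R : Type} [Finite S] [Finite R] {π : S → R} (a : O.obj π),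
      Δ (O.cls a) = ∑ᶠ (s : S) (r : R), O.edge π s r a := by
  obtain ⟨Δ, h⟩ := O.exists_linear (fun {S R} _ _ π => ∑ᶠ (s : S) (r : R), O.edge π s r)
    fun e f h a => by
      simp only [finsum_linear_apply]
      exact finsum_equiv e fun s => finsum_equiv f fun r => O.edge_map e f h s r a
  refine ⟨Δ, fun a => ?_⟩
  rw [h]
  simp only [finsum_linear_apply]

/-- The sum over the gluings of a root of `b` to an input of `a`, without the sign. -/
def preBullet (a : O.obj π) (b : O.obj ρ) : O.coinv :=
  ∑ᶠ (s : S) (q : Q), O.edge (Sum.map π ρ) (Sum.inl s) (Sum.inr q) (O.box a b)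

theorem bullet_eq (p : ℤ) (a : O.obj π) (b : O.obj ρ) :
    O.bullet p a b = p.negOnePow • O.preBullet a b := by
  rw [bullet, preBullet]
  refine congrArg _ (finsum_congr fun s => finsum_congr fun q => ?_)
  rw [O.edge_of_ne (by simp), preComp]

theorem preBullet_mem {p q : ℤ} {a : O.obj π} {b : O.obj ρ} (ha : a ∈ O.deg π p)
    (hb : b ∈ O.deg ρ q) : O.preBullet a b ∈ O.coinvDeg (p + q - 1) :=
  finsum_mem_submodule _ fun _ => finsum_mem_submodule _ fun _ => O.edge_mem _ _ (O.box_deg ha hb)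

theorem preBullet_map (e : S ≃ S') (f : R ≃ R') (h : ∀ x, π' (e x) = f (π x)) (e' : T ≃ T')
    (f' : Q ≃ Q') (h' : ∀ x, ρ' (e' x) = f' (ρ x)) (a : O.obj π) (b : O.obj ρ) :
    O.preBullet (O.map e f h a) (O.map e' f' h' b) = O.preBullet a b := by
  refine finsum_equiv e fun s => finsum_equiv f' fun q => ?_
  rw [O.box_map e f h e' f' h' (by rintro (x | x) <;> simp [h, h'])]
  exact O.edge_map (Equiv.sumCongr e e') (Equiv.sumCongr f f') _ (Sum.inl s) (Sum.inr q) _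

theorem exists_bul : ∃ bul : O.coinv →ₗ[k] O.coinv →ₗ[k] O.coinv,
    ∀ {S R T Q : Type} [Finite S] [Finite R] [Finite T] [Finite Q] {π : S → R} {ρ : T → Q}
      {p q : ℤ} {a : O.obj π} {b : O.obj ρ}, a ∈ O.deg π p → b ∈ O.deg ρ q →
      bul (O.cls a) (O.cls b) = p.negOnePow • O.preBullet a b := by
  obtain ⟨pre, h⟩ := O.exists_bilinear
    (fun {S R T Q} _ _ _ _ π ρ => ∑ᶠ (s : S) (q : Q),
      O.box.compr₂ (O.edge (Sum.map π ρ) (Sum.inl s) (Sum.inr q)))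
    fun e f h e' f' h' a b => by
      simp only [finsum_bilinear_apply, LinearMap.compr₂_apply]
      exact O.preBullet_map e f h e' f' h' a b
  -- The sign for moving the contraction symbol past `a` depends on the degree, so it is added after
  -- the unsigned gluing has descended.
  obtain ⟨bul, hbul⟩ := exists_signed O.coinvDeg_isInternal (fun p _ => p.negOnePow) pre
  refine ⟨bul, fun ha hb => ?_⟩
  rw [hbul (O.cls_mem ha) (O.cls_mem hb), h]
  simp only [finsum_bilinear_apply, LinearMap.compr₂_apply, preBullet]

section Mul

variable {mul : O.coinv →ₗ[k] O.coinv →ₗ[k] O.coinv}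
  (hmul : ∀ {S R T Q : Type} [Finite S] [Finite R] [Finite T] [Finite Q] {π : S → R} {ρ : T → Q}
    (a : O.obj π) (b : O.obj ρ), mul (O.cls a) (O.cls b) = O.cls (O.box a b))
  (comm : IsGradedComm O.coinvDeg mul)

include hmul

/-- The root being glued belongs to `b` or to `c`. In the first case reassociation puts the edge
inside `a ⊟ b`; the second case is reduced to the first by exchanging `b` and `c`. -/
theorem preBullet_box_right {q r : ℤ} (a : O.obj π) {b : O.obj ρ} {c : O.obj τ}
    (hb : b ∈ O.deg ρ q) (hc : c ∈ O.deg τ r) :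
    O.preBullet a (O.box b c) = mul (O.preBullet a b) (O.cls c)
      + (q * r).negOnePow • mul (O.preBullet a c) (O.cls b) := by
  have h : ∀ {T Q U P : Type} [Finite T] [Finite Q] [Finite U] [Finite P] {ρ : T → Q} {τ : U → P}
      (b : O.obj ρ) (c : O.obj τ), ∑ᶠ (s : S) (l : Q), O.edge (Sum.map π (Sum.map ρ τ)) (Sum.inl s)
        (Sum.inr (Sum.inl l)) (O.box a (O.box b c)) = mul (O.preBullet a b) (O.cls c) := by
    intro T Q U P _ _ _ _ ρ τ b c
    rw [preBullet]
    simp only [map_finsum_left]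
    refine finsum_congr fun s => finsum_congr fun l => ?_
    rw [← O.edge_box_inl hmul, O.edge_box_assoc]
    rfl
  rw [preBullet]
  simp only [finsum_sum, finsum_add_finite]
  rw [h b c, ← h c b, ← finsum_units_smul]
  refine congrArg _ (finsum_congr fun s => ?_)
  rw [← finsum_units_smul]
  refine finsum_congr fun l => ?_
  rw [O.box_comm (by rintro (x | x) <;> rfl) hb hc, map_units_smul_right, map_units_smul_right,
    O.box_map_right]
  exact congrArg _ (O.edge_map (π := Sum.map π (Sum.map τ ρ)) (π' := Sum.map π (Sum.map ρ τ))
    (Equiv.sumCongr (one S) (Equiv.sumComm U T)) (Equiv.sumCongr (one R) (Equiv.sumComm P Q)) _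
    (Sum.inl s) (Sum.inr (Sum.inl l)) _)

include comm

theorem preBullet_box_left {p q r : ℤ} {a : O.obj π} {b : O.obj ρ} {c : O.obj τ}
    (ha : a ∈ O.deg π p) (hb : b ∈ O.deg ρ q) (hc : c ∈ O.deg τ r) :
    O.preBullet (O.box a b) c = p.negOnePow • mul (O.cls a) (O.preBullet b c)
      + (p * q + q).negOnePow • mul (O.cls b) (O.preBullet a c) := by
  -- The case of an input of the second factor: reassociating and moving `a` to the end puts the
  -- edge inside the first box `b ⊟ c`. An input of the first factor is treated by exchanging `a`
  -- and `b`.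
  have h : ∀ {S R T Q : Type} [Finite S] [Finite R] [Finite T] [Finite Q] {π : S → R} {ρ : T → Q}
      {p q : ℤ} {a : O.obj π} {b : O.obj ρ} (ha : a ∈ O.deg π p) (hb : b ∈ O.deg ρ q),
      ∑ᶠ (t : T) (l : P), O.edge (Sum.map (Sum.map π ρ) τ) (Sum.inl (Sum.inr t))
        (Sum.inr l) (O.box (O.box a b) c) = p.negOnePow • mul (O.cls a) (O.preBullet b c) := by
    intro S R T Q _ _ _ _ π ρ p q a b ha hb
    rw [comm (O.cls_mem ha) (O.preBullet_mem hb hc), smul_smul, ← Int.negOnePow_add, preBullet]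
    simp only [map_finsum_left, ← finsum_units_smul]
    refine finsum_congr fun s => finsum_congr fun l => ?_
    rw [← O.edge_box_inl hmul, O.edge_box_assoc, O.edge_box_comm ha (O.box_deg hb hc)]
    congr 2
    ring
  rw [preBullet, finsum_sum, h ha hb, Int.negOnePow_add, mul_smul, ← h hb ha, add_comm]
  simp only [← finsum_units_smul]
  refine congrArg _ (finsum_congr fun s => finsum_congr fun l => ?_)
  rw [O.box_comm (by rintro (x | x) <;> rfl) ha hb, map_units_smul_left, map_units_smul_right,
    O.box_map_left]
  exact congrArg _ (O.edge_map (π := Sum.map (Sum.map ρ π) τ) (π' := Sum.map (Sum.map π ρ) τ)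
    (Equiv.sumCongr (Equiv.sumComm T S) (one U)) (Equiv.sumCongr (Equiv.sumComm Q R) (one P)) _
    (Sum.inl (Sum.inr s)) (Sum.inr l) _)

/-- A pair of an input and a root of `a ⊟ b` lies in `a`, lies in `b`, or joins the two in one of
two directions. These four cases give the four terms. -/
theorem batalinVilkovisky_mul {Δ : O.coinv →ₗ[k] O.coinv}
    (hΔ : ∀ {S R : Type} [Finite S] [Finite R] {π : S → R} (a : O.obj π),
      Δ (O.cls a) = ∑ᶠ (s : S) (r : R), O.edge π s r a)
    {p q : ℤ} {a : O.obj π} {b : O.obj ρ} (ha : a ∈ O.deg π p) (hb : b ∈ O.deg ρ q) :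
    Δ (O.cls (O.box a b)) = mul (Δ (O.cls a)) (O.cls b) + p.negOnePow • mul (O.cls a) (Δ (O.cls b))
      + (O.preBullet a b + (p * q).negOnePow • O.preBullet b a) := by
  have hb' : Δ (O.cls b) ∈ O.coinvDeg (q - 1) := by
    rw [hΔ]
    exact finsum_mem_submodule _ fun _ => finsum_mem_submodule _ fun _ => O.edge_mem _ _ hb
  have e : p.negOnePow • (p * (q - 1)).negOnePow = (p * q).negOnePow := by
    rw [smul_eq_mul, ← Int.negOnePow_add]
    congr 1
    ring
  rw [comm (O.cls_mem ha) hb', smul_smul, ← smul_eq_mul, e, hΔ, hΔ, hΔ, preBullet, preBullet]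
  simp only [finsum_sum, finsum_add_finite, map_finsum_left, O.edge_box_inl hmul]
  have h₁ : ∑ᶠ (t : T) (l : Q), O.edge (Sum.map π ρ) (Sum.inr t) (Sum.inr l) (O.box a b) =
      (p * q).negOnePow • ∑ᶠ (t : T) (l : Q), mul (O.edge ρ t l b) (O.cls a) := by
    simp only [← finsum_units_smul]
    refine finsum_congr fun t => finsum_congr fun l => ?_
    rw [O.edge_box_comm ha hb, ← O.edge_box_inl hmul]
    rfl
  have h₂ : ∑ᶠ (t : T) (r : R), O.edge (Sum.map π ρ) (Sum.inr t) (Sum.inl r) (O.box a b) =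
      (p * q).negOnePow • ∑ᶠ (t : T) (r : R),
        O.edge (Sum.map ρ π) (Sum.inl t) (Sum.inr r) (O.box b a) := by
    simp only [← finsum_units_smul]
    refine finsum_congr fun t => finsum_congr fun l => ?_
    rw [O.edge_box_comm ha hb]
    rfl
  rw [h₁, h₂]
  abel

end Mul

/-- The class of the contraction of two edges, which is zero unless this is possible. -/
def edgeEdge (a : O.obj π) (x y : S × R) : O.coinv :=
  open scoped Classical in
  if h : π x.1 ≠ x.2 ∧ y.1 ≠ x.1 ∧ y.2 ≠ x.2 then
    O.edge _ ⟨y.1, h.2.1⟩ ⟨y.2, h.2.2⟩ (O.contract π x.1 x.2 h.1 a) else 0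

theorem edgeEdge_eq_zero_or (a : O.obj π) (x y : S × R) : O.edgeEdge a x y = 0 ∨
    ∃ (h₁ : π x.1 ≠ x.2) (hs : y.1 ≠ x.1) (hr : y.2 ≠ x.2)
      (h₂ : contractBox π x.1 x.2 h₁ ⟨y.1, hs⟩ ≠ ⟨y.2, hr⟩),
      O.edgeEdge a x y = O.cls (O.contract _ ⟨y.1, hs⟩ ⟨y.2, hr⟩ h₂ (O.contract π x.1 x.2 h₁ a)) := by
  by_cases h : π x.1 ≠ x.2 ∧ y.1 ≠ x.1 ∧ y.2 ≠ x.2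
  · rw [edgeEdge, dif_pos h]
    by_cases h₂ : contractBox π x.1 x.2 h.1 ⟨y.1, h.2.1⟩ = ⟨y.2, h.2.2⟩
    · exact Or.inl (O.edge_of_eq h₂ _)
    · exact Or.inr ⟨h.1, h.2.1, h.2.2, h₂, O.edge_of_ne h₂ _⟩
  · exact Or.inl (by rw [edgeEdge, dif_neg h])

/-- If the double contraction is defined in one order, then by `contractBox_ne_iff` it is defined in
the other, and `contract_contract` gives the sign. The inequality `y ≠ x` will show that exchanging
the two edges fixes no nonzero term. -/
theorem edgeEdge_ne_zero {a : O.obj π} {x y : S × R} (h : O.edgeEdge a x y ≠ 0) :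
    O.edgeEdge a x y = -O.edgeEdge a y x ∧ y ≠ x := by
  obtain h₀ | ⟨h₁, hs, hr, h₂, e⟩ := O.edgeEdge_eq_zero_or a x y
  · exact absurd h₀ h
  · have h₃ := (contractBox_ne_iff π hs hr h₁).mp h₂
    have h₂' : contractBox π y.1 y.2 h₃.1 ⟨x.1, hs.symm⟩ ≠ ⟨x.2, hr.symm⟩ :=
      (contractBox_ne_iff π hs.symm hr.symm h₃.1).mpr ⟨h₁, fun h' => h₃.2 h'.symm⟩
    refine ⟨?_, fun h' => hs (congrArg Prod.fst h')⟩
    have e' : O.edgeEdge a y x = O.cls (O.contract _ ⟨x.1, hs.symm⟩ ⟨x.2, hr.symm⟩ h₂'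
        (O.contract π y.1 y.2 h₃.1 a)) := by
      rw [edgeEdge, dif_pos ⟨h₃.1, hs.symm, hr.symm⟩, O.edge_of_ne h₂']
    rw [e, e', ← map_neg, ← O.contract_contract π x.1 y.1 x.2 y.2 hs hs.symm hr hr.symm h₁ h₂ h₃.1
      h₂' (neNe hs hs.symm) (neNe hr hr.symm)
      (contractBox_contractBox π hs hs.symm hr hr.symm h₁ h₂ h₃.1 h₂') (fun _ => rfl) (fun _ => rfl),
      O.cls_map]

theorem edgeEdge_add_swap (a : O.obj π) (x y : S × R) :
    O.edgeEdge a x y + O.edgeEdge a y x = 0 := by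
  by_cases h : O.edgeEdge a x y = 0
  · by_cases h' : O.edgeEdge a y x = 0
    · rw [h, h', add_zero]
    · rw [(O.edgeEdge_ne_zero h').1, add_neg_cancel]
  · rw [(O.edgeEdge_ne_zero h).1, neg_add_cancel]

/-- Exchanging the two edges pairs each nonzero term with its negative. The diagonal terms vanish by
definition and not by antisymmetry, so characteristic two is no exception. -/
theorem sum_edgeEdge (a : O.obj π) : ∑ᶠ (x : S × R) (y : S × R), O.edgeEdge a x y = 0 := by
  classical
  cases nonempty_fintype S
  cases nonempty_fintype R
  simp only [finsum_eq_sum_of_fintype]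
  rw [← Finset.sum_product']
  exact Finset.sum_involution (fun x _ => x.swap) (fun x _ => O.edgeEdge_add_swap a x.1 x.2)
    (fun x _ hx h => (O.edgeEdge_ne_zero hx).2 (congrArg Prod.fst h)) (fun _ _ => Finset.mem_univ _)
    (fun x _ => x.swap_swap)

theorem batalinVilkovisky_sq {Δ : O.coinv →ₗ[k] O.coinv}
    (hΔ : ∀ {S R : Type} [Finite S] [Finite R] {π : S → R} (a : O.obj π),
      Δ (O.cls a) = ∑ᶠ (s : S) (r : R), O.edge π s r a) (a : O.obj π) :
    Δ (Δ (O.cls a)) = 0 := by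
  -- The right side `0` is replaced by the vanishing sum over ordered pairs of edges, and the two
  -- sums are compared term by term; the pairs excluded by the first contraction contribute zero to
  -- `edgeEdge`.
  rw [← O.sum_edgeEdge a, hΔ, finsum_curry _ (Set.toFinite _)]
  simp only [map_finsum_linear]
  refine finsum_congr fun s => finsum_congr fun r => ?_
  rw [finsum_curry _ (Set.toFinite _)]
  by_cases h : π s = r
  · simp [O.edge_of_eq h, edgeEdge, h]
  · rw [O.edge_of_ne h, hΔ, finsum_subtype_ne]
    refine finsum_congr fun s' => ?_
    by_cases hs : s' = s
    · simp [edgeEdge, hs]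
    · rw [dif_pos hs, finsum_subtype_ne]
      refine finsum_congr fun r' => ?_
      by_cases hr : r' = r
      · simp [edgeEdge, hr]
      · rw [dif_pos hr, edgeEdge, dif_pos ⟨h, hs, hr⟩]

set_option maxHeartbeats 1000000 in
theorem exists_isGerstenhaber : ∃ mul br : O.coinv →ₗ[k] O.coinv →ₗ[k] O.coinv,
    (∀ (S R T Q : Type) [Finite S] [Finite R] [Finite T] [Finite Q] (π : S → R) (ρ : T → Q)
      (a : O.obj π) (b : O.obj ρ), mul (O.cls a) (O.cls b) = O.cls (O.box a b)) ∧
    (∀ (S R T Q : Type) [Finite S] [Finite R] [Finite T] [Finite Q] (π : S → R) (ρ : T → Q)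
      (p q : ℤ) (a : O.obj π) (b : O.obj ρ), a ∈ O.deg π p → b ∈ O.deg ρ q →
      br (O.cls a) (O.cls b) =
        O.bullet p a b - ((p - 1) * (q - 1)).negOnePow • O.bullet q b a) ∧
    IsGerstenhaber O.coinvDeg mul br ∧ IsGradedComm O.coinvDeg mul := by
  obtain ⟨mul, hmul⟩ := O.exists_mul
  obtain ⟨bul, hbul⟩ := O.exists_bul
  obtain ⟨br, hbr⟩ := exists_commutator O.coinvDeg_isInternal bul
  obtain ⟨Δ, hΔ⟩ := O.exists_batalinVilkovisky
  have hg := O.generatesGrading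
  have mul_mem : ∀ i j : O.Gen, mul (O.cls i.2.2.1) (O.cls j.2.2.1) ∈ O.coinvDeg (i.2.1 + j.2.1) :=
    fun i j => by
      rw [hmul]
      exact O.cls_mem (O.box_deg i.2.2.2 j.2.2.2)
  have bul_mem : ∀ i j : O.Gen,
      bul (O.cls i.2.2.1) (O.cls j.2.2.1) ∈ O.coinvDeg (i.2.1 + j.2.1 - 1) :=
    fun i j => by
      rw [hbul i.2.2.2 j.2.2.2]
      exact units_smul_mem _ _ (O.preBullet_mem i.2.2.2 j.2.2.2)
  have comm : IsGradedComm O.coinvDeg mul := hg.isGradedComm fun i j => by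
    rw [hmul, hmul]
    exact O.cls_box_comm i.2.2.2 j.2.2.2
  have leibniz := hg.commutator_leibniz hbr mul_mem
    (hg.bul_mul_of_comm comm bul_mem fun ⟨_, p, a, ha⟩ ⟨_, q, b, hb⟩ ⟨_, r, c, hc⟩ => by
      simp only
      rw [hmul, hbul ha (O.box_deg hb hc), hbul ha hb, hbul ha hc,
        O.preBullet_box_right hmul _ hb hc, map_units_smul_left, map_units_smul_left, smul_add,
        smul_comm])
    (hg.mul_bul_of_comm comm bul_mem fun ⟨_, p, a, ha⟩ ⟨_, q, b, hb⟩ ⟨_, r, c, hc⟩ => by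
      simp only
      rw [hmul, hbul (O.box_deg ha hb) hc, hbul hb hc, hbul ha hc,
        O.preBullet_box_left hmul comm ha hb hc, map_units_smul_right, map_units_smul_right,
        mul_bul_sign])
  refine ⟨mul, br, fun S R T Q _ _ _ _ π ρ a b => hmul a b,
    fun S R T Q _ _ _ _ π ρ p q a b ha hb => ?_,
    hg.isGerstenhaber_of_batalinVilkovisky (Δ := Δ) O.coinvDeg_isInternal mul_mem
      (hg.commutator_mem hbr bul_mem) ?_ (hg.commutator_antisymm hbr) leibniz ?_
      (fun i => O.batalinVilkovisky_sq hΔ _) ?_, comm⟩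
  · rw [hbr (O.cls_mem ha) (O.cls_mem hb), hbul ha hb, hbul hb ha, bullet_eq, bullet_eq]
  · intro i j l
    rw [hmul, hmul, hmul, hmul]
    exact O.cls_box_assoc _ _ _
  · rintro ⟨_, p, a, ha⟩
    refine (congrArg (· ∈ O.coinvDeg (p - 1)) (hΔ a)).mpr ?_
    exact finsum_mem_submodule _ fun _ => finsum_mem_submodule _ fun _ => O.edge_mem _ _ ha
  -- The two sums over edges between `a` and `b` are recognized as the signed commutator of the
  -- gluing.
  · rintro ⟨_, p, a, ha⟩ ⟨_, q, b, hb⟩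
    refine (congrArg Δ (hmul a b)).trans
      ((O.batalinVilkovisky_mul hmul comm hΔ ha hb).trans (congrArg _ ?_))
    rw [hbr (O.cls_mem ha) (O.cls_mem hb), hbul ha hb, hbul hb ha, batalinVilkovisky_sign]

end OddFreeNCOperad

end OddNC

end

theorem mainTheorem9 {k : Type v} [Field k] :
    -- odd PROPs
    (∀ O : OddNC.OddPROP.{u, v} k, ∃ mul br : O.coinv →ₗ[k] O.coinv →ₗ[k] O.coinv,
      (∀ (I J K L : Type) [Finite I] [Finite J] [Finite K] [Finite L]
        (a : O.obj I J) (b : O.obj K L), mul (O.cls a) (O.cls b) = O.cls (O.box a b)) ∧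
      (∀ (I J K L : Type) [Finite I] [Finite J] [Finite K] [Finite L] (p q : ℤ)
        (a : O.obj I J) (b : O.obj K L), a ∈ O.deg I J p → b ∈ O.deg K L q →
        br (O.cls a) (O.cls b) =
          O.bullet a b - ((p - 1) * (q - 1)).negOnePow • O.bullet b a) ∧
      OddNC.IsGerstenhaber O.coinvDeg mul br ∧ OddNC.IsGradedComm O.coinvDeg mul) ∧
    -- odd nc-dioperads
    (∀ O : OddNC.OddNCDioperad.{u, v} k, ∃ mul br : O.coinv →ₗ[k] O.coinv →ₗ[k] O.coinv,
      (∀ (I J K L : Type) [Finite I] [Finite J] [Finite K] [Finite L]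
        (a : O.obj I J) (b : O.obj K L), mul (O.cls a) (O.cls b) = O.cls (O.box a b)) ∧
      (∀ (I J K L : Type) [Finite I] [Finite J] [Finite K] [Finite L] (p q : ℤ)
        (a : O.obj I J) (b : O.obj K L), a ∈ O.deg I J p → b ∈ O.deg K L q →
        br (O.cls a) (O.cls b) =
          O.bullet a b - ((p - 1) * (q - 1)).negOnePow • O.bullet b a) ∧
      OddNC.IsGerstenhaber O.coinvDeg mul br ∧ OddNC.IsGradedComm O.coinvDeg mul) ∧
    -- odd free nc-operads
    (∀ O : OddNC.OddFreeNCOperad.{u, v} k, ∃ mul br : O.coinv →ₗ[k] O.coinv →ₗ[k] O.coinv,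
      (∀ (S R T Q : Type) [Finite S] [Finite R] [Finite T] [Finite Q] (π : S → R) (ρ : T → Q)
        (a : O.obj π) (b : O.obj ρ), mul (O.cls a) (O.cls b) = O.cls (O.box a b)) ∧
      (∀ (S R T Q : Type) [Finite S] [Finite R] [Finite T] [Finite Q] (π : S → R) (ρ : T → Q)
        (p q : ℤ) (a : O.obj π) (b : O.obj ρ), a ∈ O.deg π p → b ∈ O.deg ρ q →
        br (O.cls a) (O.cls b) =
          O.bullet p a b - ((p - 1) * (q - 1)).negOnePow • O.bullet q b a) ∧
      OddNC.IsGerstenhaber O.coinvDeg mul br ∧ OddNC.IsGradedComm O.coinvDeg mul) ∧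
    -- odd operads with nc-multiplication
    (∀ O : OddNC.OddNCMultOperad.{u, v} k, ∃ mul br : O.coinv →ₗ[k] O.coinv →ₗ[k] O.coinv,
      (∀ (S T : Type) [Finite S] [Finite T] (a : O.obj S) (b : O.obj T),
        mul (O.cls a) (O.cls b) = O.cls (O.box a b)) ∧
      (∀ (S T : Type) [Finite S] [Finite T] (p q : ℤ) (a : O.obj S) (b : O.obj T),
        a ∈ O.deg S p → b ∈ O.deg T q →
        br (O.cls a) (O.cls b) =
          O.bullet a b - ((p - 1) * (q - 1)).negOnePow • O.bullet b a) ∧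
      OddNC.IsGerstenhaber O.coinvDeg mul br) ∧
    -- odd nc-cyclic operads
    (∀ O : OddNC.OddNCCyclicOperad.{u, v} k, ∃ mul br : O.coinv →ₗ[k] O.coinv →ₗ[k] O.coinv,
      (∀ (S T : Type) [Finite S] [Finite T] (a : O.obj S) (b : O.obj T),
        mul (O.cls a) (O.cls b) = O.cls (O.box a b)) ∧
      (∀ (S T : Type) [Finite S] [Finite T] (a : O.obj S) (b : O.obj T),
        br (O.cls a) (O.cls b) = O.odot a b) ∧
      OddNC.IsGerstenhaber O.coinvDeg mul br ∧ OddNC.IsGradedComm O.coinvDeg mul) :=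
  ⟨fun O => O.exists_isGerstenhaber, fun O => O.exists_isGerstenhaber,
    fun O => O.exists_isGerstenhaber, fun O => O.exists_isGerstenhaber,
    fun O => O.exists_isGerstenhaber⟩
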